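/- **Conventions.** $\mathbb N=\{0,1,2,\dots\}$, $\mathbb R_+=(0,\infty)$, functions are complex-valued, $T_xf(t)=f(t-x)$, $|\alpha|=\alpha_1+\dots+\alpha_n$ for $\alpha\in\mathbb N^n$, and $B(0,1)$ is the Euclidean unit ball of $\mathbb R^n$. *Function spaces.* A solid translation-invariant Banach function space of bounded type on $\mathbb R^n$ is a non-trivial Banach space $E$ that is continuously included in $L^1_{\mathrm{loc}}(\mathbb R^n)$ and satisfies: $T_xE\subseteq E$ for all $x\in\mathbb R^n$; there is $C_0>0$ with $\|T_xf\|_E\le C_0\|f\|_E$ for all $x\in\mathbb R^n$, $f\in E$; $E*C_c(\mathbb R^n)\subseteq E$; and, if $f\in E$, $g\in L^1_{\mathrm{loc}}(\mathbb R^n)$ and $|g|\le|f|$ almost everywhere, then $g\in E$ and $\|g\|_E\le\|f\|_E$. *Weight functions.* A weight function is a continuous $w:\mathbb R^n\to[1,\infty)$. A weight function system is a family $\mathcal W=\{w^\lambda\mid\lambda\in\mathbb R_+\}$ of weight functions with $w^\lambda\le w^\mu$ whenever $\mu\le\lambda$. Consider the following conditions, where $\lambda,\mu,\nu$ range over $\mathbb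 R_+$. - $(\mathrm{wM})$ [resp. $\{\mathrm{wM}\}$]: $\forall\lambda\,\exists\mu$ [resp. $\forall\mu\,\exists\lambda$] $\exists C>0\ \forall x\in\mathbb R^n,\,y\in B(0,1)$: $w^\lambda(x+y)\le Cw^\mu(x)$. - $(\mathrm M)$ [resp. $\{\mathrm M\}$]: $\forall\lambda\,\exists\mu,\nu$ [resp. $\forall\mu,\nu\,\exists\lambda$] $\exists C>0\ \forall x,y\in\mathbb R^n$: $w^\lambda(x+y)\le Cw^\mu(x)w^\nu(y)$. - $\mathcal W(\subseteq)\mathcal V$ [resp. $\mathcal W\{\subseteq\}\mathcal V$]: $\forall\lambda\,\exists\mu$ [resp. $\forall\mu\,\exists\lambda$]: $v^\lambda(t)=O(w^\mu(t))$ as $|t|\to\infty$. *Weight sequences.* A weight sequence is a family $M=(M_\alpha)_{\alpha\in\mathbb N^n}$ of positive numbers with $M_0=1$ and $\lim_{|\alpha|\to\infty}M_\alpha^{1/|\alpha|}=\infty$. It is log-convex if there is a convex $F:[0,\infty)^n\to\mathbb R$ with $F(\alpha)=\log M_\alpha$ for all $\alpha\in\mathbb N^n$. A weight sequence system is a family $\mathcal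 M=\{M^\lambda\mid\lambda\in\mathbb R_+\}$ of weight sequences with $M^\lambda_\alpha\le M^\mu_\alpha$ for all $\alpha$ whenever $\lambda\le\mu$; it is log-convex if each $M^\lambda$ is. Consider the following conditions, where $\alpha,\beta$ range over $\mathbb N^n$. - $(\mathrm L)$ [resp. $\{\mathrm L\}$]: $\forall R>0\ \forall\lambda\,\exists\mu$ [resp. $\forall R>0\ \forall\mu\,\exists\lambda$] $\exists C>0\ \forall\alpha$: $R^{|\alpha|}M^\mu_\alpha\le CM^\lambda_\alpha$. - $(\mathrm{wI})$ [resp. $\{\mathrm{wI}\}$]: $\forall\lambda\,\exists\mu$ [resp. $\forall\mu\,\exists\lambda$] $\exists H>0\ \forall R>0\ \exists C>0\ \forall\alpha,\beta$: $M^\mu_\alpha R^{|\beta|}\le CH^{|\alpha+\beta|}M^\lambda_{\alpha+\beta}$. - $(\mathrm I)$ [resp. $\{\mathrm I\}$]: $\forall\lambda\,\exists\mu,\nu$ [resp. $\forall\mu,\nu\,\exists\lambda$] $\exists C,H>0\ \forall\alpha,\beta$: $M^\mu_\alpha M^\nu_\beta\le CH^{|\alpha+\beta|}M^\lambda_{\alpha+\beta}$.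 - $\mathcal M(\subseteq)\mathcal N$ [resp. $\mathcal M\{\subseteq\}\mathcal N$]: $\forall\lambda\,\exists\mu$ [resp. $\forall\mu\,\exists\lambda$] $\exists C>0\ \forall\alpha$: $M^\mu_\alpha\le CN^\lambda_\alpha$. *Gelfand–Shilov type spaces.* $E^M_w$ is the space of all $f\in C^\infty(\mathbb R^n)$ such that $f^{(\alpha)}w\in E$ for all $\alpha\in\mathbb N^n$ and $\|f\|_{E,M,w}=\sup_{\alpha}\|f^{(\alpha)}w\|_E/M_\alpha<\infty$, normed by $\|\cdot\|_{E,M,w}$. Put $E^{(\mathcal M)}_{(\mathcal W)}=\bigcap_{\lambda>0}E^{M^\lambda}_{w^\lambda}$ with the projective limit topology, and $E^{\{\mathcal M\}}_{\{\mathcal W\}}=\bigcup_{\lambda>0}E^{M^\lambda}_{w^\lambda}$ with the locally convex inductive limit topology. **Theorem.** Let $E$ be a solid translation-invariant Banach function space of bounded type on $\mathbb R^n$, let $\mathcal M,\mathcal N$ be weight sequence systems and let $\mathcal W,\mathcal V$ be weight function systems on $\mathbb R^n$. Let $[\ ]$ stand either for $(\ )$ throughout or for $\{\ \}$ throughout.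 Assume that $\mathcal M$ is log-convex and satisfies $[\mathrm L]$ and $[\mathrm I]$, $\mathcal N$ is log-convex and satisfies $[\mathrm L]$ and $[\mathrm{wI}]$, $\mathcal W$ satisfies $[\mathrm M]$, and $\mathcal V$ satisfies $[\mathrm{wM}]$. Suppose that $E^{[\mathcal M]}_{[\mathcal W]}\neq\{0\}$. Then the following statements are equivalent: 1. $\mathcal M[\subseteq]\mathcal N$ and $\mathcal W[\subseteq]\mathcal V$. 2. $E^{[\mathcal M]}_{[\mathcal W]}\subseteq E^{[\mathcal N]}_{[\mathcal V]}$ as sets. 3. $E^{[\mathcal M]}_{[\mathcal W]}\subseteq E^{[\mathcal N]}_{[\mathcal V]}$ and the inclusion map is continuous. -/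

import Mathlib

open MeasureTheory Filter Topology Asymptotics Set
open scoped ContDiff Convolution

namespace GelfandShilov

/-- The Euclidean space `ℝⁿ`. -/
abbrev Rn (n : ℕ) : Type := EuclideanSpace ℝ (Fin n)

/-- Multi-indices in `ℕⁿ`. -/
abbrev MultiIndex (n : ℕ) : Type := Fin n → ℕ

/-- The length `|α| = α₁ + ⋯ + αₙ` of a multi-index. -/
def len {n : ℕ} (α : MultiIndex n) : ℕ := ∑ i, α i

/-- The set `ℝ₊` of positive real numbers, which indexes all weight systems. -/
abbrev RPos : Type := {r : ℝ // 0 < r}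

/-- The two cases treated simultaneously by the notation `[ ]`:
the Beurling case `( )` and the Roumieu case `{ }`. -/
inductive Regime where
  | beurling : Regime
  | roumieu : Regime

/-! ### Weight functions and weight function systems -/

/-- A weight function: a continuous function `w ≥ 1` on `ℝⁿ`. -/
structure WeightFunction (n : ℕ) where
  toFun : Rn n → ℝ
  continuous_toFun : Continuous toFun
  one_le_toFun : ∀ x, 1 ≤ toFun x

instance (n : ℕ) : CoeFun (WeightFunction n) (fun _ => Rn n → ℝ) := ⟨WeightFunction.toFun⟩

/-- A weight function system: a family of weight functions, decreasing in the parameter. -/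
structure WeightFunctionSystem (n : ℕ) where
  toFun : RPos → WeightFunction n
  anti : ∀ l m : RPos, m ≤ l → ∀ x, toFun l x ≤ toFun m x

instance (n : ℕ) : CoeFun (WeightFunctionSystem n) (fun _ => RPos → WeightFunction n) :=
  ⟨WeightFunctionSystem.toFun⟩

/-- The condition `[wM]`. -/
def WeightFunctionSystem.CondwM {n : ℕ} (W : WeightFunctionSystem n) : Regime → Prop
  | .beurling => ∀ l : RPos, ∃ m : RPos, ∃ C : ℝ, 0 < C ∧
      ∀ x : Rn n, ∀ y ∈ Metric.ball (0 : Rn n) 1, W l (x + y) ≤ C * W m x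
  | .roumieu => ∀ m : RPos, ∃ l : RPos, ∃ C : ℝ, 0 < C ∧
      ∀ x : Rn n, ∀ y ∈ Metric.ball (0 : Rn n) 1, W l (x + y) ≤ C * W m x

/-- The condition `[M]`. -/
def WeightFunctionSystem.CondM {n : ℕ} (W : WeightFunctionSystem n) : Regime → Prop
  | .beurling => ∀ l : RPos, ∃ m k : RPos, ∃ C : ℝ, 0 < C ∧
      ∀ x y : Rn n, W l (x + y) ≤ C * W m x * W k y
  | .roumieu => ∀ m k : RPos, ∃ l : RPos, ∃ C : ℝ, 0 < C ∧
      ∀ x y : Rn n, W l (x + y) ≤ C * W m x * W k y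

/-- The relation `W [⊆] V` between weight function systems;
`v(t) = O(w(t))` is understood as `|t| → ∞`. -/
def WeightFunctionSystem.Incl {n : ℕ} (W V : WeightFunctionSystem n) : Regime → Prop
  | .beurling => ∀ l : RPos, ∃ m : RPos, (V l).toFun =O[cocompact (Rn n)] (W m).toFun
  | .roumieu => ∀ m : RPos, ∃ l : RPos, (V l).toFun =O[cocompact (Rn n)] (W m).toFun

/-! ### Weight sequences and weight sequence systems -/

/-- A weight sequence: positive numbers `M_α`, `α ∈ ℕⁿ`, with `M_0 = 1` and
`(M_α)^{1/|α|} → ∞` as `|α| → ∞`. -/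
structure WeightSequence (n : ℕ) where
  toFun : MultiIndex n → ℝ
  pos : ∀ α, 0 < toFun α
  map_zero : toFun 0 = 1
  tendsto_root : Tendsto (fun α => toFun α ^ (1 / (len α : ℝ))) (comap len atTop) atTop

instance (n : ℕ) : CoeFun (WeightSequence n) (fun _ => MultiIndex n → ℝ) :=
  ⟨WeightSequence.toFun⟩

/-- `M` is log-convex: `log M` is the restriction to `ℕⁿ` of a convex function on `[0,∞)ⁿ`. -/
def WeightSequence.LogConvex {n : ℕ} (M : WeightSequence n) : Prop :=
  ∃ F : (Fin n → ℝ) → ℝ, ConvexOn ℝ {x | ∀ i, 0 ≤ x i} F ∧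
    ∀ α : MultiIndex n, F (fun i => (α i : ℝ)) = Real.log (M α)

/-- `M ⊆ N`: there is `C > 0` with `M_α ≤ C N_α` for all `α`. -/
def WeightSequence.Incl {n : ℕ} (M N : WeightSequence n) : Prop :=
  ∃ C : ℝ, 0 < C ∧ ∀ α, M α ≤ C * N α

/-- A weight sequence system: a family of weight sequences, increasing in the parameter. -/
structure WeightSequenceSystem (n : ℕ) where
  toFun : RPos → WeightSequence n
  mono : ∀ l m : RPos, l ≤ m → ∀ α, toFun l α ≤ toFun m α

instance (n : ℕ) : CoeFun (WeightSequenceSystem n) (fun _ => RPos → WeightSequence n) :=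
  ⟨WeightSequenceSystem.toFun⟩

/-- A weight sequence system is log-convex if each of its members is. -/
def WeightSequenceSystem.LogConvex {n : ℕ} (M : WeightSequenceSystem n) : Prop :=
  ∀ l, (M l).LogConvex

/-- The condition `[L]`. -/
def WeightSequenceSystem.CondL {n : ℕ} (M : WeightSequenceSystem n) : Regime → Prop
  | .beurling => ∀ R : ℝ, 0 < R → ∀ l : RPos, ∃ m : RPos, ∃ C : ℝ, 0 < C ∧
      ∀ α, R ^ len α * M m α ≤ C * M l α
  | .roumieu => ∀ R : ℝ, 0 < R → ∀ m : RPos, ∃ l : RPos, ∃ C : ℝ, 0 < C ∧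
      ∀ α, R ^ len α * M m α ≤ C * M l α

/-- The condition `[wI]`. -/
def WeightSequenceSystem.CondwI {n : ℕ} (M : WeightSequenceSystem n) : Regime → Prop
  | .beurling => ∀ l : RPos, ∃ m : RPos, ∃ H : ℝ, 0 < H ∧ ∀ R : ℝ, 0 < R → ∃ C : ℝ, 0 < C ∧
      ∀ α β, M m α * R ^ len β ≤ C * H ^ len (α + β) * M l (α + β)
  | .roumieu => ∀ m : RPos, ∃ l : RPos, ∃ H : ℝ, 0 < H ∧ ∀ R : ℝ, 0 < R → ∃ C : ℝ, 0 < C ∧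
      ∀ α β, M m α * R ^ len β ≤ C * H ^ len (α + β) * M l (α + β)

/-- The condition `[I]`. -/
def WeightSequenceSystem.CondI {n : ℕ} (M : WeightSequenceSystem n) : Regime → Prop
  | .beurling => ∀ l : RPos, ∃ m k : RPos, ∃ C H : ℝ, 0 < C ∧ 0 < H ∧
      ∀ α β, M m α * M k β ≤ C * H ^ len (α + β) * M l (α + β)
  | .roumieu => ∀ m k : RPos, ∃ l : RPos, ∃ C H : ℝ, 0 < C ∧ 0 < H ∧
      ∀ α β, M m α * M k β ≤ C * H ^ len (α + β) * M l (α + β)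

/-- The relation `M [⊆] N` between weight sequence systems. -/
def WeightSequenceSystem.Incl {n : ℕ} (M N : WeightSequenceSystem n) : Regime → Prop
  | .beurling => ∀ l : RPos, ∃ m : RPos, (M m).Incl (N l)
  | .roumieu => ∀ m : RPos, ∃ l : RPos, (M m).Incl (N l)

/-! ### Solid translation-invariant Banach function spaces of bounded type -/

/-- The structure of a solid translation-invariant Banach function space of bounded type on a
Banach space `E`. The injective map `emb` realizes the elements of `E` as (almost everywhere
classes of) locally integrable functions; `E` is identified with its image. -/
structure SolidTIBF (n : ℕ) (E : Type*) [NormedAddCommGroup E] [NormedSpace ℂ E]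
    [CompleteSpace E] where
  emb : E →ₗ[ℂ] (Rn n →ₘ[volume] ℂ)
  emb_injective : Function.Injective emb
  nontrivial : Nontrivial E
  locallyIntegrable : ∀ f, LocallyIntegrable (emb f) volume
  /-- The inclusion `E ⊆ L¹_loc` is continuous. -/
  continuous_incl : ∀ K : Set (Rn n), IsCompact K →
    ∃ C : ℝ, ∀ f, ∫ x in K, ‖emb f x‖ ≤ C * ‖f‖
  /-- (A.1) `T_x E ⊆ E`. -/
  translate_mem : ∀ (x : Rn n) (f : E), ∃ g : E, emb g =ᵐ[volume] fun t => emb f (t - x)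
  /-- (A.2) The translations are uniformly bounded. -/
  translate_bound : ∃ C₀ : ℝ, 0 < C₀ ∧ ∀ (x : Rn n) (f g : E),
    (emb g =ᵐ[volume] fun t => emb f (t - x)) → ‖g‖ ≤ C₀ * ‖f‖
  /-- (A.3) `E * C_c ⊆ E`. -/
  convolution_mem : ∀ (f : E) (χ : Rn n → ℂ), Continuous χ → HasCompactSupport χ →
    ∃ g : E, emb g =ᵐ[volume] (emb f ⋆[ContinuousLinearMap.mul ℂ ℂ, volume] χ)
  solid : ∀ (f : E) (g : Rn n → ℂ), LocallyIntegrable g volume →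
    (∀ᵐ x, ‖g x‖ ≤ ‖emb f x‖) → ∃ h : E, emb h =ᵐ[volume] g ∧ ‖h‖ ≤ ‖f‖

section
variable {n : ℕ} {E : Type*} [NormedAddCommGroup E] [NormedSpace ℂ E] [CompleteSpace E]

/-- The function `g` belongs to `E`. -/
def SolidTIBF.Mem (T : SolidTIBF n E) (g : Rn n → ℂ) : Prop :=
  ∃ e : E, T.emb e =ᵐ[volume] g

open Classical in
/-- The norm in `E` of a function `g` that belongs to `E` (and `0` if `g` does not). -/
noncomputable def SolidTIBF.norm (T : SolidTIBF n E) (g : Rn n → ℂ) : ℝ :=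
  if h : T.Mem g then ‖h.choose‖ else 0

theorem SolidTIBF.norm_eq (T : SolidTIBF n E) {g : Rn n → ℂ} {e : E}
    (he : T.emb e =ᵐ[volume] g) : T.norm g = ‖e‖ := by
  have h : T.Mem g := ⟨e, he⟩
  have h2 : h.choose = e := T.emb_injective (AEEqFun.ext (h.choose_spec.trans he.symm))
  simp only [SolidTIBF.norm, dif_pos h, h2]

theorem SolidTIBF.norm_nonneg (T : SolidTIBF n E) (g : Rn n → ℂ) : 0 ≤ T.norm g := by
  unfold SolidTIBF.norm; split_ifs <;> simp

theorem SolidTIBF.mem_zero (T : SolidTIBF n E) : T.Mem (fun _ => 0) :=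
  ⟨0, by rw [map_zero]; exact AEEqFun.coeFn_zero⟩

theorem SolidTIBF.norm_zero (T : SolidTIBF n E) : T.norm (fun _ => 0) = 0 := by
  rw [T.norm_eq (e := 0) (by rw [map_zero]; exact AEEqFun.coeFn_zero), _root_.norm_zero]

theorem SolidTIBF.mem_norm_add (T : SolidTIBF n E) {f g : Rn n → ℂ} (hf : T.Mem f)
    (hg : T.Mem g) : T.Mem (fun x => f x + g x) ∧
      T.norm (fun x => f x + g x) ≤ T.norm f + T.norm g := by
  obtain ⟨a, ha⟩ := hf
  obtain ⟨b, hb⟩ := hg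
  have h : T.emb (a + b) =ᵐ[volume] fun x => f x + g x := by
    rw [map_add]
    filter_upwards [AEEqFun.coeFn_add (T.emb a) (T.emb b), ha, hb] with x h1 h2 h3
    rw [h1, Pi.add_apply, h2, h3]
  refine ⟨⟨_, h⟩, ?_⟩
  rw [T.norm_eq h, T.norm_eq ha, T.norm_eq hb]
  exact norm_add_le a b

theorem SolidTIBF.mem_norm_smul (T : SolidTIBF n E) (c : ℂ) {f : Rn n → ℂ} (hf : T.Mem f) :
    T.Mem (fun x => c * f x) ∧ T.norm (fun x => c * f x) = ‖c‖ * T.norm f := by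
  obtain ⟨a, ha⟩ := hf
  have h : T.emb (c • a) =ᵐ[volume] fun x => c * f x := by
    rw [map_smul]
    filter_upwards [AEEqFun.coeFn_smul c (T.emb a), ha] with x h1 h2
    rw [h1, Pi.smul_apply, h2, smul_eq_mul]
  refine ⟨⟨_, h⟩, ?_⟩
  rw [T.norm_eq h, T.norm_eq ha, norm_smul]

theorem SolidTIBF.ae_eq_zero (T : SolidTIBF n E) {f : Rn n → ℂ} (hf : T.Mem f)
    (h0 : T.norm f = 0) : f =ᵐ[volume] fun _ => 0 := by
  obtain ⟨a, ha⟩ := hf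
  rw [T.norm_eq ha, norm_eq_zero] at h0
  subst h0
  rw [map_zero] at ha
  exact ha.symm.trans AEEqFun.coeFn_zero

theorem SolidTIBF.mem_norm_mono (T : SolidTIBF n E) {f g : Rn n → ℂ} (hf : T.Mem f)
    (hg : Continuous g) (h : ∀ x, ‖g x‖ ≤ ‖f x‖) : T.Mem g ∧ T.norm g ≤ T.norm f := by
  obtain ⟨a, ha⟩ := hf
  obtain ⟨b, hb, hab⟩ := T.solid a g hg.locallyIntegrable
    (by filter_upwards [ha] with x hx; rw [hx]; exact h x)
  refine ⟨⟨b, hb⟩, ?_⟩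
  rw [T.norm_eq ha, T.norm_eq hb]
  exact hab

end

/-! ### Partial derivatives -/

/-- The partial derivative `∂f/∂x_i`. -/
noncomputable def pderiv {n : ℕ} (i : Fin n) (f : Rn n → ℂ) : Rn n → ℂ :=
  fun x => fderiv ℝ f x (EuclideanSpace.single i 1)

/-- The partial derivative `f^{(α)} = ∂_1^{α_1} ⋯ ∂_n^{α_n} f`. -/
noncomputable def mderiv {n : ℕ} (α : MultiIndex n) (f : Rn n → ℂ) : Rn n → ℂ :=
  (List.finRange n).foldr (fun i g => (pderiv i)^[α i] g) f

theorem contDiff_pderiv {n : ℕ} (i : Fin n) {f : Rn n → ℂ} (hf : ContDiff ℝ ∞ f) :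
    ContDiff ℝ ∞ (pderiv i f) :=
  (hf.fderiv_right (m := ∞) (by simp)).clm_apply contDiff_const

theorem contDiff_iterate_pderiv {n : ℕ} (i : Fin n) (k : ℕ) {f : Rn n → ℂ}
    (hf : ContDiff ℝ ∞ f) : ContDiff ℝ ∞ ((pderiv i)^[k] f) := by
  induction k with
  | zero => exact hf
  | succ k ih => rw [Function.iterate_succ_apply']; exact contDiff_pderiv i ih

theorem contDiff_mderiv {n : ℕ} (α : MultiIndex n) {f : Rn n → ℂ} (hf : ContDiff ℝ ∞ f) :
    ContDiff ℝ ∞ (mderiv α f) := by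
  unfold mderiv
  induction List.finRange n with
  | nil => exact hf
  | cons i l ih => exact contDiff_iterate_pderiv i _ ih

theorem iterate_pderiv_add {n : ℕ} (i : Fin n) (k : ℕ) {f g : Rn n → ℂ}
    (hf : ContDiff ℝ ∞ f) (hg : ContDiff ℝ ∞ g) :
    (pderiv i)^[k] (f + g) = (pderiv i)^[k] f + (pderiv i)^[k] g := by
  induction k with
  | zero => rfl
  | succ k ih =>
    simp only [Function.iterate_succ_apply', ih]
    funext x
    have h1 := ((contDiff_iterate_pderiv i k hf).differentiable (by simp)) x
    have h2 := ((contDiff_iterate_pderiv i k hg).differentiable (by simp)) x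
    simp [pderiv, fderiv_add h1 h2]

theorem mderiv_add {n : ℕ} (α : MultiIndex n) {f g : Rn n → ℂ}
    (hf : ContDiff ℝ ∞ f) (hg : ContDiff ℝ ∞ g) :
    mderiv α (f + g) = mderiv α f + mderiv α g := by
  have key : ∀ (L : List (Fin n)),
      ContDiff ℝ ∞ (L.foldr (fun i g => (pderiv i)^[α i] g) f) ∧
      ContDiff ℝ ∞ (L.foldr (fun i g => (pderiv i)^[α i] g) g) ∧
      L.foldr (fun i g => (pderiv i)^[α i] g) (f + g) =
        L.foldr (fun i g => (pderiv i)^[α i] g) f +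
          L.foldr (fun i g => (pderiv i)^[α i] g) g := by
    intro L
    induction L with
    | nil => exact ⟨hf, hg, rfl⟩
    | cons i L ih =>
      obtain ⟨h1, h2, h3⟩ := ih
      refine ⟨contDiff_iterate_pderiv i _ h1, contDiff_iterate_pderiv i _ h2, ?_⟩
      simp only [List.foldr_cons, h3]
      exact iterate_pderiv_add i _ h1 h2
  exact (key _).2.2

theorem iterate_pderiv_smul {n : ℕ} (i : Fin n) (k : ℕ) (c : ℂ) {f : Rn n → ℂ}
    (hf : ContDiff ℝ ∞ f) : (pderiv i)^[k] (c • f) = c • (pderiv i)^[k] f := by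
  induction k with
  | zero => rfl
  | succ k ih =>
    simp only [Function.iterate_succ_apply', ih]
    funext x
    have h1 := ((contDiff_iterate_pderiv i k hf).differentiable (by simp)) x
    simp [pderiv, fderiv_const_smul h1 c]

theorem mderiv_smul {n : ℕ} (α : MultiIndex n) (c : ℂ) {f : Rn n → ℂ}
    (hf : ContDiff ℝ ∞ f) : mderiv α (c • f) = c • mderiv α f := by
  have key : ∀ (L : List (Fin n)),
      ContDiff ℝ ∞ (L.foldr (fun i g => (pderiv i)^[α i] g) f) ∧
      L.foldr (fun i g => (pderiv i)^[α i] g) (c • f) =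
        c • L.foldr (fun i g => (pderiv i)^[α i] g) f := by
    intro L
    induction L with
    | nil => exact ⟨hf, rfl⟩
    | cons i L ih =>
      obtain ⟨h1, h3⟩ := ih
      refine ⟨contDiff_iterate_pderiv i _ h1, ?_⟩
      simp only [List.foldr_cons, h3]
      exact iterate_pderiv_smul i _ c h1
  exact (key _).2

theorem mderiv_zero_index {n : ℕ} (f : Rn n → ℂ) : mderiv 0 f = f := by
  unfold mderiv
  induction List.finRange n with
  | nil => rfl
  | cons i l ih => simpa using ih

/-! ### The Gelfand-Shilov type spaces -/

section
variable {n : ℕ} {E : Type*} [NormedAddCommGroup E] [NormedSpace ℂ E] [CompleteSpace E]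

/-- The function `f^{(α)} w`. -/
noncomputable def weightedDeriv (w : WeightFunction n) (α : MultiIndex n) (f : Rn n → ℂ) :
    Rn n → ℂ :=
  fun x => mderiv α f x * (w x : ℂ)

theorem weightedDeriv_add (w : WeightFunction n) (α : MultiIndex n) {f g : Rn n → ℂ}
    (hf : ContDiff ℝ ∞ f) (hg : ContDiff ℝ ∞ g) :
    weightedDeriv w α (f + g) = fun x => weightedDeriv w α f x + weightedDeriv w α g x := by
  funext x
  simp [weightedDeriv, mderiv_add α hf hg, add_mul]

theorem weightedDeriv_smul (w : WeightFunction n) (α : MultiIndex n) (c : ℂ) {f : Rn n → ℂ}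
    (hf : ContDiff ℝ ∞ f) :
    weightedDeriv w α (c • f) = fun x => c * weightedDeriv w α f x := by
  funext x
  simp [weightedDeriv, mderiv_smul α c hf, mul_assoc]

theorem weightedDeriv_zero (w : WeightFunction n) (α : MultiIndex n) :
    weightedDeriv w α 0 = fun _ => 0 := by
  have h := weightedDeriv_smul w α 0 (f := 0) contDiff_const
  simp at h
  exact h

/-- The space `E^M_w`: all `f ∈ C^∞(ℝⁿ)` such that `f^{(α)} w ∈ E` for all `α` and
`sup_α ‖f^{(α)} w‖_E / M_α < ∞`. -/
def stepSubmodule (T : SolidTIBF n E) (M : WeightSequence n) (w : WeightFunction n) :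
    Submodule ℂ (Rn n → ℂ) where
  carrier := {f | ContDiff ℝ ∞ f ∧ (∀ α, T.Mem (weightedDeriv w α f)) ∧
    BddAbove (range fun α => T.norm (weightedDeriv w α f) / M α)}
  add_mem' := by
    rintro f g ⟨hf, hf2, A, hA⟩ ⟨hg, hg2, B, hB⟩
    refine ⟨hf.add hg, fun α => ?_, A + B, ?_⟩
    · rw [weightedDeriv_add w α hf hg]
      exact (T.mem_norm_add (hf2 α) (hg2 α)).1
    · rintro _ ⟨α, rfl⟩
      have h1 := hA ⟨α, rfl⟩
      have h2 := hB ⟨α, rfl⟩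
      have h3 := (T.mem_norm_add (hf2 α) (hg2 α)).2
      simp only at h1 h2 ⊢
      rw [weightedDeriv_add w α hf hg]
      calc _ ≤ (T.norm (weightedDeriv w α f) + T.norm (weightedDeriv w α g)) / M α := by
            have := (M.pos α).le
            gcongr
        _ ≤ A + B := by rw [add_div]; exact add_le_add h1 h2
  zero_mem' := by
    refine ⟨contDiff_const, fun α => ?_, 0, ?_⟩
    · rw [weightedDeriv_zero]; exact T.mem_zero
    · rintro _ ⟨α, rfl⟩
      simp only
      rw [weightedDeriv_zero, T.norm_zero, zero_div]
  smul_mem' := by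
    rintro c f ⟨hf, hf2, A, hA⟩
    refine ⟨contDiff_const.smul hf, fun α => ?_, ‖c‖ * A, ?_⟩
    · rw [weightedDeriv_smul w α c hf]
      exact (T.mem_norm_smul c (hf2 α)).1
    · rintro _ ⟨α, rfl⟩
      have h1 := hA ⟨α, rfl⟩
      simp only at h1 ⊢
      rw [weightedDeriv_smul w α c hf, (T.mem_norm_smul c (hf2 α)).2, mul_div_assoc]
      gcongr

/-- The space `E^M_w` as a type of its own, which carries the norm topology (and not the
topology of pointwise convergence). -/
def Step (T : SolidTIBF n E) (M : WeightSequence n) (w : WeightFunction n) : Type :=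
  ↥(stepSubmodule T M w)

noncomputable instance (T : SolidTIBF n E) (M : WeightSequence n) (w : WeightFunction n) :
    AddCommGroup (Step T M w) :=
  inferInstanceAs (AddCommGroup ↥(stepSubmodule T M w))

noncomputable instance (T : SolidTIBF n E) (M : WeightSequence n) (w : WeightFunction n) :
    Module ℂ (Step T M w) :=
  inferInstanceAs (Module ℂ ↥(stepSubmodule T M w))

/-- The norm `‖f‖_{E,M,w} = sup_α ‖f^{(α)} w‖_E / M_α`. -/
noncomputable instance (T : SolidTIBF n E) (M : WeightSequence n) (w : WeightFunction n) :
    Norm (Step T M w) where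
  norm f := ⨆ α : MultiIndex n, T.norm (weightedDeriv w α f.1) / M α

theorem Step.core (T : SolidTIBF n E) (M : WeightSequence n) (w : WeightFunction n) :
    NormedSpace.Core ℂ (Step T M w) where
  norm_nonneg f := Real.iSup_nonneg fun α => div_nonneg (T.norm_nonneg _) (M.pos α).le
  norm_smul c f := by
    change (⨆ α : MultiIndex n, T.norm (weightedDeriv w α (c • f.1)) / M α) =
      ‖c‖ * ⨆ α : MultiIndex n, T.norm (weightedDeriv w α f.1) / M α
    rw [Real.mul_iSup_of_nonneg (_root_.norm_nonneg c)]
    congr 1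
    funext α
    rw [weightedDeriv_smul w α c f.2.1, (T.mem_norm_smul c (f.2.2.1 α)).2, mul_div_assoc]
  norm_triangle f g := by
    change (⨆ α : MultiIndex n, T.norm (weightedDeriv w α (f.1 + g.1)) / M α) ≤
      (⨆ α : MultiIndex n, T.norm (weightedDeriv w α f.1) / M α) +
      ⨆ α : MultiIndex n, T.norm (weightedDeriv w α g.1) / M α
    refine ciSup_le fun α => ?_
    have h1 := le_ciSup f.2.2.2 α
    have h2 := le_ciSup g.2.2.2 α
    have h3 := (T.mem_norm_add (f.2.2.1 α) (g.2.2.1 α)).2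
    rw [weightedDeriv_add w α f.2.1 g.2.1]
    calc _ ≤ (T.norm (weightedDeriv w α f.1) + T.norm (weightedDeriv w α g.1)) / M α := by
          have := (M.pos α).le
          gcongr
      _ ≤ _ := by rw [add_div]; exact add_le_add h1 h2
  norm_eq_zero_iff f := by
    change (⨆ α : MultiIndex n, T.norm (weightedDeriv w α f.1) / M α) = 0 ↔ _
    constructor
    · intro h
      have h1 := le_ciSup f.2.2.2 0
      rw [h, M.map_zero, div_one] at h1
      have h2 := T.ae_eq_zero (f.2.2.1 0) (le_antisymm h1 (T.norm_nonneg _))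
      have hc : Continuous (weightedDeriv w 0 f.1) :=
        (contDiff_mderiv 0 f.2.1).continuous.mul
          (Complex.continuous_ofReal.comp w.continuous_toFun)
      have h3 := (hc.ae_eq_iff_eq volume continuous_const).1 h2
      refine Subtype.ext (funext fun x => ?_)
      have h4 := congrFun h3 x
      have h5 : (w x : ℂ) ≠ 0 := by
        have := w.one_le_toFun x
        exact_mod_cast (by linarith : w x ≠ 0)
      change f.1 x = 0
      simpa [weightedDeriv, mderiv_zero_index, h5] using h4
    · rintro rfl
      change (⨆ α : MultiIndex n, T.norm (weightedDeriv w α 0) / M α) = 0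
      simp [weightedDeriv_zero, T.norm_zero]

noncomputable instance (T : SolidTIBF n E) (M : WeightSequence n) (w : WeightFunction n) :
    NormedAddCommGroup (Step T M w) :=
  NormedAddCommGroup.ofCore (Step.core T M w)

noncomputable instance (T : SolidTIBF n E) (M : WeightSequence n) (w : WeightFunction n) :
    NormedSpace ℂ (Step T M w) :=
  NormedSpace.ofCore (Step.core T M w)

theorem stepSubmodule_mono (T : SolidTIBF n E) (M : WeightSequenceSystem n)
    (W : WeightFunctionSystem n) {l m : RPos} (h : l ≤ m) :
    stepSubmodule T (M l) (W l) ≤ stepSubmodule T (M m) (W m) := by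
  rintro f ⟨hf, hf2, A, hA⟩
  have key : ∀ α, T.Mem (weightedDeriv (W m) α f) ∧
      T.norm (weightedDeriv (W m) α f) ≤ T.norm (weightedDeriv (W l) α f) := by
    intro α
    refine T.mem_norm_mono (hf2 α) ((contDiff_mderiv α hf).continuous.mul
          (Complex.continuous_ofReal.comp (W m).continuous_toFun)) fun x => ?_
    simp only [weightedDeriv, norm_mul, Complex.norm_real, Real.norm_eq_abs]
    have h1 := (W m).one_le_toFun x
    have h2 := W.anti m l h x
    rw [abs_of_nonneg (by linarith), abs_of_nonneg (by linarith)]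
    gcongr
  refine ⟨hf, fun α => (key α).1, A, ?_⟩
  rintro _ ⟨α, rfl⟩
  refine le_trans ?_ (hA ⟨α, rfl⟩)
  exact div_le_div₀ (T.norm_nonneg _) (key α).2 ((M l).pos α) (M.mono l m h α)

/-- The space `E^{(M)}_{(W)}`, the intersection of the spaces `E^{M^λ}_{w^λ}`, `λ > 0`. -/
def beurlingSpace (T : SolidTIBF n E) (M : WeightSequenceSystem n)
    (W : WeightFunctionSystem n) : Submodule ℂ (Rn n → ℂ) where
  carrier := {f | ∀ l : RPos, f ∈ stepSubmodule T (M l) (W l)}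
  add_mem' hf hg l := Submodule.add_mem _ (hf l) (hg l)
  zero_mem' _ := Submodule.zero_mem _
  smul_mem' c _ hf l := Submodule.smul_mem _ c (hf l)

/-- The space `E^{{M}}_{{W}}`, the union of the spaces `E^{M^λ}_{w^λ}`, `λ > 0`. -/
def roumieuSpace (T : SolidTIBF n E) (M : WeightSequenceSystem n)
    (W : WeightFunctionSystem n) : Submodule ℂ (Rn n → ℂ) where
  carrier := {f | ∃ l : RPos, f ∈ stepSubmodule T (M l) (W l)}
  add_mem' := by
    rintro f g ⟨l, hf⟩ ⟨m, hg⟩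
    exact ⟨max l m, Submodule.add_mem _ (stepSubmodule_mono T M W (le_max_left l m) hf)
      (stepSubmodule_mono T M W (le_max_right l m) hg)⟩
  zero_mem' := ⟨⟨1, one_pos⟩, Submodule.zero_mem _⟩
  smul_mem' := by
    rintro c f ⟨l, hf⟩
    exact ⟨l, Submodule.smul_mem _ c hf⟩

/-- The inclusion of `E^{(M)}_{(W)}` into the normed space `E^{M^λ}_{w^λ}`. -/
def beurlingToStep (T : SolidTIBF n E) (M : WeightSequenceSystem n)
    (W : WeightFunctionSystem n) (l : RPos) (f : ↥(beurlingSpace T M W)) : Step T (M l) (W l) :=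
  ⟨f.1, f.2 l⟩

/-- The inclusion of the normed space `E^{M^λ}_{w^λ}` into `E^{{M}}_{{W}}`. -/
def stepToRoumieu (T : SolidTIBF n E) (M : WeightSequenceSystem n)
    (W : WeightFunctionSystem n) (l : RPos) (f : Step T (M l) (W l)) : ↥(roumieuSpace T M W) :=
  ⟨f.1, l, f.2⟩

/-- The projective limit topology on `E^{(M)}_{(W)}`: the coarsest topology such that the
inclusions into the normed spaces `E^{M^λ}_{w^λ}` are continuous. -/
@[reducible] noncomputable def beurlingTopology (T : SolidTIBF n E) (M : WeightSequenceSystem n)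
    (W : WeightFunctionSystem n) : TopologicalSpace ↥(beurlingSpace T M W) :=
  ⨅ l : RPos, TopologicalSpace.induced (beurlingToStep T M W l)
    (inferInstance : TopologicalSpace (Step T (M l) (W l)))

/-- The inductive limit topology (in the category of locally convex spaces) on `E^{{M}}_{{W}}`:
the finest locally convex vector space topology such that the inclusions of the normed spaces
`E^{M^λ}_{w^λ}` are continuous. (The infimum in Mathlib's order on topologies is the topology
generated by all members of the set, and it is itself locally convex.) -/
@[reducible] noncomputable def roumieuTopology (T : SolidTIBF n E) (M : WeightSequenceSystem n)
    (W : WeightFunctionSystem n) : TopologicalSpace ↥(roumieuSpace T M W) :=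
  sInf {t | @IsTopologicalAddGroup _ t _ ∧ @ContinuousSMul ℂ _ _ _ t ∧
    @LocallyConvexSpace ℝ _ _ _ _ _ t ∧
    ∀ l : RPos, Continuous[(inferInstance : TopologicalSpace (Step T (M l) (W l))), t]
      (stepToRoumieu T M W l)}

/-- The space `E^{[M]}_{[W]}`. -/
def space (T : SolidTIBF n E) (M : WeightSequenceSystem n) (W : WeightFunctionSystem n) :
    Regime → Submodule ℂ (Rn n → ℂ)
  | .beurling => beurlingSpace T M W
  | .roumieu => roumieuSpace T M W

/-- The locally convex topology of the space `E^{[M]}_{[W]}`. -/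
@[reducible] noncomputable def topology (T : SolidTIBF n E) (M : WeightSequenceSystem n)
    (W : WeightFunctionSystem n) : (r : Regime) → TopologicalSpace ↥(space T M W r)
  | .beurling => beurlingTopology T M W
  | .roumieu => roumieuTopology T M W

end

end GelfandShilov

/-! That the growth relations imply a continuous inclusion is a comparison of norms, step space by
step space. The content is the converse: a bare inclusion of sets forces the growth relations.

Both halves of the converse follow one scheme. The source space contains an `f` with bounded
derivatives and `f 0 ≠ 0` (`exists_bounded_mem_space`). If a growth relation fails, test functions
`g_k` are made from such an `f`, normalized so that `∑ 2⁻ᵏ c_k g_k` lies in the source, hence in the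
target, for every bounded sequence `c`. A Baire argument (`exists_bound_of_closed_relations`,
`exists_uniform_step_bound`) then yields one target step and one constant `C` with `‖g_k‖ ≤ C 2ᵏ`
for all `k`. It uses only that derivatives of the series at a point depend continuously on `c`, so
no topology on the two spaces enters. The failure of the relation was arranged to make `‖g_k‖` at
least of order `k 2ᵏ`, a contradiction.

Weight functions: `g_k = w_k(x_k)⁻¹ f(· - x_k)`, where `v(x_k)` exceeds `k 2ᵏ w_k(x_k)`. Condition
[M] keeps the series in the source. Condition [wM] bounds `v(x_k)` by the norm of the translate
(`exists_weight_le_norm_translate`).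

Weight sequences: `g_k = P_k⁻¹ f exp(i ξ_k·x)`. Log-convexity provides `ξ_k` with `ξ_k^β ≤ P_k M_β`
for all `β` and equality at the critical index `α_k` (`exists_maximizing`,
`exists_scaled_frequencies`). Conditions [L] and [I] keep the series in the source. For the lower
bound (`exists_symb_bound`), `f` is paired with a band-limited `g` such that `∫ f g ≠ 0`.
Integration by parts writes `(iξ)^α ∫ f g` as an integral of `∂^α (f exp(iξ·x) g)` against a
unimodular factor. As the derivatives of `g` grow only geometrically, Leibniz and [wI] bound it by
`N_α` times the norm of the modulation. -/

open scoped FourierTransform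

namespace GelfandShilov

/-! ### Calculus of the mixed partial derivatives -/

theorem pderiv_comm {n : ℕ} (i j : Fin n) {f : Rn n → ℂ} (hf : ContDiff ℝ ∞ f) :
    pderiv i (pderiv j f) = pderiv j (pderiv i f) := by
  have key : ∀ (i j : Fin n) (x : Rn n), pderiv i (pderiv j f) x =
      fderiv ℝ (fderiv ℝ f) x (EuclideanSpace.single i 1) (EuclideanSpace.single j 1) := by
    intro i j x
    have h1 : DifferentiableAt ℝ (fderiv ℝ f) x :=
      ((hf.fderiv_right (m := ∞) (by simp)).differentiable (by simp)) x
    change fderiv ℝ (fun y => fderiv ℝ f y (EuclideanSpace.single j 1)) x _ = _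
    rw [fderiv_clm_apply h1 (differentiableAt_const _)]
    simp
  funext x
  rw [key, key]
  exact (hf.contDiffAt.isSymmSndFDerivAt (by simpa using ENat.LEInfty.out)).eq _ _

theorem pderiv_iterate_comm {n : ℕ} (i j : Fin n) (k : ℕ) {f : Rn n → ℂ}
    (hf : ContDiff ℝ ∞ f) : (pderiv j)^[k] (pderiv i f) = pderiv i ((pderiv j)^[k] f) := by
  induction k with
  | zero => rfl
  | succ k ih =>
    rw [Function.iterate_succ_apply', ih, Function.iterate_succ_apply',
      pderiv_comm j i (contDiff_iterate_pderiv j k hf)]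

/-- The fold applies the coordinates in a fixed order, so the extra derivative sits inside the nest
and has to be commuted outwards. Absence of repetitions in the list ensures that it is gained only
once. -/
theorem mderiv_add_single {n : ℕ} (α : MultiIndex n) (i : Fin n) {f : Rn n → ℂ}
    (hf : ContDiff ℝ ∞ f) : mderiv (α + Pi.single i 1) f = pderiv i (mderiv α f) := by
  have key : ∀ L : List (Fin n), L.Nodup →
      ContDiff ℝ ∞ (L.foldr (fun j g => (pderiv j)^[α j] g) f) ∧
      L.foldr (fun j g => (pderiv j)^[(α + Pi.single i 1 : MultiIndex n) j] g) f =
        if i ∈ L then pderiv i (L.foldr (fun j g => (pderiv j)^[α j] g) f)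
        else L.foldr (fun j g => (pderiv j)^[α j] g) f := by
    intro L hL
    induction L with
    | nil => exact ⟨hf, by simp⟩
    | cons j L ih =>
      obtain ⟨hjL, hL'⟩ := List.nodup_cons.1 hL
      obtain ⟨h1, h2⟩ := ih hL'
      refine ⟨contDiff_iterate_pderiv j _ h1, ?_⟩
      rw [List.foldr_cons, List.foldr_cons, h2]
      by_cases hij : i = j
      · subst hij
        simp only [hjL, if_false, List.mem_cons, true_or, if_true, Pi.add_apply,
          Pi.single_eq_same]
        rw [Function.iterate_succ_apply']
      · have h3 : (α + Pi.single i 1 : MultiIndex n) j = α j := by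
          simp [Ne.symm hij]
        rw [h3]
        by_cases hi : i ∈ L
        · simp [hi, pderiv_iterate_comm i j _ h1]
        · simp [hi, hij]
  have h := (key _ (List.nodup_finRange n)).2
  simpa [mderiv] using h

theorem len_zero {n : ℕ} : len (0 : MultiIndex n) = 0 := by simp [len]

theorem len_add {n : ℕ} (α β : MultiIndex n) : len (α + β) = len α + len β := by
  simp [len, Finset.sum_add_distrib]

theorem len_single {n : ℕ} (i : Fin n) : len (Pi.single i 1 : MultiIndex n) = 1 := by
  simp [len]

theorem len_eq_zero {n : ℕ} {α : MultiIndex n} (h : len α = 0) : α = 0 := by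
  funext i
  exact (Finset.sum_eq_zero_iff.1 h) i (Finset.mem_univ i)

theorem exists_eq_add_single {n : ℕ} {α : MultiIndex n} {k : ℕ} (h : len α = k + 1) :
    ∃ (β : MultiIndex n) (i : Fin n), α = β + Pi.single i 1 ∧ len β = k := by
  have h0 : ∃ i, α i ≠ 0 := by
    by_contra! h0
    have : α = 0 := funext h0
    rw [this, len_zero] at h
    omega
  obtain ⟨i, hi⟩ := h0
  have h1 : α = (α - Pi.single i 1) + Pi.single i 1 := by
    funext j
    by_cases hj : j = i
    · subst hj
      simp only [Pi.add_apply, Pi.sub_apply, Pi.single_eq_same]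
      omega
    · simp [hj]
  refine ⟨_, i, h1, ?_⟩
  have h2 := congrArg len h1
  rw [len_add, len_single] at h2
  omega

/-- Together with `mderiv_add_single`, this lets identities for `mderiv` be proved one derivative at
a time, without unfolding the fold. -/
theorem multiIndex_induction {n : ℕ} {P : MultiIndex n → Prop} (h0 : P 0)
    (h1 : ∀ α i, P α → P (α + Pi.single i 1)) (α : MultiIndex n) : P α := by
  obtain ⟨k, hk⟩ : ∃ k, len α = k := ⟨_, rfl⟩
  induction k generalizing α with
  | zero => rwa [len_eq_zero hk]
  | succ k ih =>
    obtain ⟨β, i, rfl, hβ⟩ := exists_eq_add_single hk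
    exact h1 β i (ih β hβ)

theorem mderiv_pderiv {n : ℕ} (α : MultiIndex n) (i : Fin n) {f : Rn n → ℂ}
    (hf : ContDiff ℝ ∞ f) : mderiv α (pderiv i f) = mderiv (α + Pi.single i 1) f := by
  induction α using multiIndex_induction with
  | h0 => rw [mderiv_zero_index, mderiv_add_single _ _ hf, mderiv_zero_index]
  | h1 α j ih =>
    rw [mderiv_add_single _ _ (contDiff_pderiv i hf), ih, ← mderiv_add_single _ _ hf]
    congr 1
    abel

theorem mderiv_comp_sub {n : ℕ} (α : MultiIndex n) (a : Rn n) {f : Rn n → ℂ}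
    (hf : ContDiff ℝ ∞ f) :
    mderiv α (fun x => f (x - a)) = fun x => mderiv α f (x - a) := by
  have hfa : ContDiff ℝ ∞ (fun x => f (x - a)) := hf.comp (contDiff_id.sub contDiff_const)
  induction α using multiIndex_induction with
  | h0 => simp only [mderiv_zero_index]
  | h1 α j ih =>
    rw [mderiv_add_single _ _ hfa, ih, mderiv_add_single _ _ hf]
    funext x
    simp only [pderiv]
    rw [fderiv_comp_sub]

theorem pderiv_mul {n : ℕ} (i : Fin n) {f g : Rn n → ℂ} (hf : ContDiff ℝ ∞ f)
    (hg : ContDiff ℝ ∞ g) : pderiv i (f * g) = pderiv i f * g + f * pderiv i g := by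
  funext x
  have h1 := (hf.differentiable (by simp)) x
  have h2 := (hg.differentiable (by simp)) x
  simp only [pderiv, fderiv_mul h1 h2, Pi.add_apply, Pi.mul_apply]
  simp
  ring

theorem pderiv_list_sum {n : ℕ} (i : Fin n) (L : List (Rn n → ℂ))
    (hL : ∀ f ∈ L, ContDiff ℝ ∞ f) :
    ContDiff ℝ ∞ L.sum ∧ pderiv i L.sum = (L.map (pderiv i)).sum := by
  induction L with
  | nil =>
    refine ⟨contDiff_const, ?_⟩
    funext x
    simp [pderiv]
  | cons f L ih =>
    obtain ⟨h1, h2⟩ := ih fun g hg => hL g (List.mem_cons_of_mem _ hg)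
    have hf := hL f List.mem_cons_self
    rw [List.sum_cons, List.map_cons, List.sum_cons, ← h2]
    exact ⟨hf.add h1, iterate_pderiv_add i 1 hf h1⟩

/-- The Leibniz rule, with the `2^|α|` terms listed individually. -/
theorem exists_leibniz {n : ℕ} (α : MultiIndex n) :
    ∃ L : List (MultiIndex n × MultiIndex n), L.length = 2 ^ len α ∧
      (∀ p ∈ L, p.1 + p.2 = α) ∧ ∀ f g : Rn n → ℂ, ContDiff ℝ ∞ f → ContDiff ℝ ∞ g →
        mderiv α (f * g) = (L.map fun p => mderiv p.1 f * mderiv p.2 g).sum := by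
  induction α using multiIndex_induction with
  | h0 =>
    refine ⟨[(0, 0)], by simp [len_zero], by simp, fun f g _ _ => ?_⟩
    simp [mderiv_zero_index]
  | h1 α i ih =>
    obtain ⟨L, h1, h2, h3⟩ := ih
    -- Every old term splits in two, the new derivative falling on the first or on the second
    -- factor. Binomial coefficients appear as repetitions in the list.
    refine ⟨L.map (fun p => (p.1 + Pi.single i 1, p.2)) ++
      L.map (fun p => (p.1, p.2 + Pi.single i 1)), ?_, ?_, ?_⟩
    · simp [h1, len_add, len_single, pow_succ, mul_two]
    · intro p hp
      rcases List.mem_append.1 hp with hp | hp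
      · obtain ⟨q, hq, rfl⟩ := List.mem_map.1 hp
        rw [← h2 q hq]
        simp only
        abel
      · obtain ⟨q, hq, rfl⟩ := List.mem_map.1 hp
        rw [← h2 q hq]
        simp only
        abel
    · intro f g hf hg
      rw [mderiv_add_single _ _ (f := f * g) (hf.mul hg), h3 f g hf hg, (pderiv_list_sum i _ _).2]
      · rw [List.map_append, List.sum_append, List.map_map, List.map_map, List.map_map,
          ← List.sum_map_add]
        congr 2
        funext p
        simp only [Function.comp_apply]
        rw [pderiv_mul i (contDiff_mderiv _ hf) (contDiff_mderiv _ hg),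
          ← mderiv_add_single _ _ hf, ← mderiv_add_single _ _ hg]
      · intro u hu
        obtain ⟨q, -, rfl⟩ := List.mem_map.1 hu
        exact (contDiff_mderiv _ hf).mul (contDiff_mderiv _ hg)

/-- Evaluation form of `exists_leibniz`. -/
theorem exists_leibniz_apply {n : ℕ} (α : MultiIndex n) :
    ∃ L : List (MultiIndex n × MultiIndex n), L.length = 2 ^ len α ∧
      (∀ p ∈ L, p.1 + p.2 = α) ∧ ∀ f g : Rn n → ℂ, ContDiff ℝ ∞ f → ContDiff ℝ ∞ g → ∀ x,
        mderiv α (fun x => f x * g x) x =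
          (L.map fun p => mderiv p.1 f x * mderiv p.2 g x).sum := by
  obtain ⟨L, h1, h2, h3⟩ := exists_leibniz α
  refine ⟨L, h1, h2, fun f g hf hg x => ?_⟩
  have h4 : ∀ L : List (MultiIndex n × MultiIndex n),
      (L.map fun p => mderiv p.1 f * mderiv p.2 g).sum x =
        (L.map fun p => mderiv p.1 f x * mderiv p.2 g x).sum := by
    intro L
    induction L with
    | nil => rfl
    | cons p L ih => simp [ih]
  rw [← h4, ← h3 f g hf hg]
  rfl

/-! ### Mixed partial derivatives and the full derivatives -/

/-- The vectors are coordinate vectors and depend on `α` only. Since one `v` serves all functions,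
facts about full derivatives of series transfer to `mderiv`. -/
theorem exists_mderiv_eq_iteratedFDeriv {n : ℕ} (α : MultiIndex n) (k : ℕ) (hk : len α = k) :
    ∃ v : Fin k → Rn n, (∀ i, ‖v i‖ ≤ 1) ∧ ∀ f : Rn n → ℂ, ContDiff ℝ ∞ f → ∀ x,
      mderiv α f x = iteratedFDeriv ℝ k f x v := by
  induction k generalizing α with
  | zero =>
    rw [len_eq_zero hk]
    refine ⟨0, by simp, fun f _ x => ?_⟩
    simp [mderiv_zero_index]
  | succ k ih =>
    obtain ⟨β, i, rfl, hβ⟩ := exists_eq_add_single hk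
    obtain ⟨v, hv, h⟩ := ih β hβ
    refine ⟨Fin.cons (EuclideanSpace.single i 1) v, ?_, fun f hf x => ?_⟩
    · intro j
      refine Fin.cases ?_ (fun j => ?_) j
      · simp
      · simpa using hv j
    · rw [mderiv_add_single _ _ hf, iteratedFDeriv_succ_apply_left]
      have h1 : mderiv β f = fun y => iteratedFDeriv ℝ k f y v := funext fun y => h f hf y
      have h2 : DifferentiableAt ℝ (iteratedFDeriv ℝ k f) x :=
        (hf.differentiable_iteratedFDeriv (m := k) (by exact_mod_cast ENat.natCast_lt_top k)) x
      rw [h1, pderiv]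
      simp only [Fin.cons_zero, Fin.tail_cons]
      have h3 := (ContinuousMultilinearMap.apply ℝ (fun _ : Fin k => Rn n) ℂ v).hasFDerivAt.comp x
        h2.hasFDerivAt
      have h4 := h3.fderiv
      change fderiv ℝ (fun y => iteratedFDeriv ℝ k f y v) x = _ at h4
      rw [h4]
      rfl

theorem norm_mderiv_le {n : ℕ} (α : MultiIndex n) {f : Rn n → ℂ} (hf : ContDiff ℝ ∞ f)
    (x : Rn n) : ‖mderiv α f x‖ ≤ ‖iteratedFDeriv ℝ (len α) f x‖ := by
  obtain ⟨v, hv, h⟩ := exists_mderiv_eq_iteratedFDeriv α (len α) rfl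
  rw [h f hf x]
  refine (ContinuousMultilinearMap.le_opNorm _ _).trans ?_
  refine mul_le_of_le_one_right (norm_nonneg _) ?_
  exact Finset.prod_le_one (fun i _ => norm_nonneg _) fun i _ => hv i

/-- Induction by peeling off the innermost derivative: `Df = ∑ i, ∂_i f ⊗ dx_i` with `‖dx_i‖ ≤ 1`,
so each order costs a factor `n`. -/
theorem norm_iteratedFDeriv_le {n : ℕ} (k : ℕ) {f : Rn n → ℂ} (hf : ContDiff ℝ ∞ f)
    (x : Rn n) {B : ℝ} (hB : ∀ α : MultiIndex n, len α = k → ‖mderiv α f x‖ ≤ B) :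
    ‖iteratedFDeriv ℝ k f x‖ ≤ n ^ k * B := by
  induction k generalizing f with
  | zero =>
    have := hB 0 len_zero
    simpa [mderiv_zero_index] using this
  | succ k ih =>
    have h1 : ∀ i : Fin n, ‖iteratedFDeriv ℝ k (pderiv i f) x‖ ≤ n ^ k * B := by
      intro i
      refine ih (contDiff_pderiv i hf) fun α hα => ?_
      rw [mderiv_pderiv _ _ hf]
      exact hB _ (by rw [len_add, len_single, hα])
    have h2 : fderiv ℝ f = fun y => ∑ i : Fin n,
        (ContinuousLinearMap.smulRightL ℝ (Rn n) ℂ (EuclideanSpace.proj i : Rn n →L[ℝ] ℝ))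
          (pderiv i f y) := by
      funext y
      ext v
      have hv : v = ∑ i : Fin n, v i • (EuclideanSpace.single i (1:ℝ) : Rn n) := by
        ext j
        simp [Finset.sum_apply, Pi.single_apply]
      conv_lhs => rw [hv]
      simp [pderiv, map_sum]
    rw [← norm_iteratedFDeriv_fderiv, h2]
    have hcd : ∀ i : Fin n, ContDiff ℝ ∞ fun y =>
        (ContinuousLinearMap.smulRightL ℝ (Rn n) ℂ (EuclideanSpace.proj i : Rn n →L[ℝ] ℝ))
          (pderiv i f y) := fun i =>
      (ContinuousLinearMap.contDiff _).comp (contDiff_pderiv i hf)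
    rw [iteratedFDeriv_fun_sum_apply fun i _ => ((hcd i).of_le (by exact_mod_cast le_top)).contDiffAt]
    refine (norm_sum_le _ _).trans ?_
    have h3 : ∀ i ∈ (Finset.univ : Finset (Fin n)), ‖iteratedFDeriv ℝ k (fun y =>
        (ContinuousLinearMap.smulRightL ℝ (Rn n) ℂ (EuclideanSpace.proj i : Rn n →L[ℝ] ℝ))
          (pderiv i f y)) x‖ ≤ n ^ k * B := by
      intro i _
      refine ((ContinuousLinearMap.smulRightL ℝ (Rn n) ℂ
        (EuclideanSpace.proj i : Rn n →L[ℝ] ℝ)).norm_iteratedFDeriv_comp_left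
        (contDiff_pderiv i hf).contDiffAt (n := k) (by exact_mod_cast le_top)).trans ?_
      have h4 : ‖ContinuousLinearMap.smulRightL ℝ (Rn n) ℂ
          (EuclideanSpace.proj i : Rn n →L[ℝ] ℝ)‖ ≤ 1 := by
        refine ContinuousLinearMap.opNorm_le_bound _ zero_le_one fun z => ?_
        refine ContinuousLinearMap.opNorm_le_bound _ (by positivity) fun v => ?_
        have : ‖v i‖ ≤ ‖v‖ := PiLp.norm_apply_le v i
        change ‖v i • z‖ ≤ 1 * ‖z‖ * ‖v‖
        rw [norm_smul, one_mul]
        rw [mul_comm]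
        exact mul_le_mul_of_nonneg_left this (norm_nonneg _)
      calc _ ≤ 1 * ‖iteratedFDeriv ℝ k (pderiv i f) x‖ := by gcongr
        _ ≤ _ := by rw [one_mul]; exact h1 i
    refine (Finset.sum_le_sum h3).trans ?_
    simp [pow_succ]
    ring_nf
    rfl

/-! ### Exponentials -/

/-- The exponential `x ↦ exp(i ξ·x)`. -/
noncomputable def expo {n : ℕ} (ξ : Fin n → ℝ) (x : Rn n) : ℂ :=
  Complex.exp ((∑ i, ξ i * x i : ℝ) * Complex.I)

theorem norm_expo {n : ℕ} (ξ : Fin n → ℝ) (x : Rn n) : ‖expo ξ x‖ = 1 :=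
  Complex.norm_exp_ofReal_mul_I _

theorem expo_mul_expo_neg {n : ℕ} (ξ : Fin n → ℝ) (x : Rn n) : expo ξ x * expo (-ξ) x = 1 := by
  rw [expo, expo, ← Complex.exp_add]
  simp

theorem contDiff_expo {n : ℕ} (ξ : Fin n → ℝ) : ContDiff ℝ ∞ (expo ξ) := by
  unfold expo
  refine ContDiff.cexp (ContDiff.mul ?_ contDiff_const)
  have h : ContDiff ℝ ∞ fun x : Rn n => ∑ i, ξ i * x i :=
    ContDiff.sum fun i _ => contDiff_const.mul (EuclideanSpace.proj i : Rn n →L[ℝ] ℝ).contDiff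
  exact Complex.ofRealCLM.contDiff.comp h

theorem pderiv_expo {n : ℕ} (ξ : Fin n → ℝ) (i : Fin n) (x : Rn n) :
    pderiv i (expo ξ) x = (ξ i * Complex.I) * expo ξ x := by
  have h1 : HasFDerivAt (fun x : Rn n => ∑ j, ξ j * x j)
      (∑ j, ξ j • (EuclideanSpace.proj j : Rn n →L[ℝ] ℝ)) x :=
    HasFDerivAt.fun_sum fun j _ =>
      ((EuclideanSpace.proj j : Rn n →L[ℝ] ℝ).hasFDerivAt).const_mul (ξ j)
  have h2 := ((Complex.ofRealCLM.hasFDerivAt.comp x h1).mul_const Complex.I).cexp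
  have h3 := h2.fderiv
  change fderiv ℝ (expo ξ) x = _ at h3
  rw [pderiv, h3]
  simp [expo]
  ring

/-- The symbol `(iξ)^α` of the partial derivative of order `α`. -/
noncomputable def symb {n : ℕ} (ξ : Fin n → ℝ) (α : MultiIndex n) : ℂ :=
  ∏ i, (ξ i * Complex.I) ^ α i

theorem symb_zero {n : ℕ} (ξ : Fin n → ℝ) : symb ξ 0 = 1 := by simp [symb]

theorem symb_add_single {n : ℕ} (ξ : Fin n → ℝ) (α : MultiIndex n) (i : Fin n) :
    symb ξ (α + Pi.single i 1) = (ξ i * Complex.I) * symb ξ α := by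
  simp only [symb, Pi.add_apply, pow_add, Finset.prod_mul_distrib]
  rw [mul_comm]
  congr 1
  rw [Finset.prod_eq_single i]
  · simp
  · intro j _ hj
    simp [hj]
  · simp

theorem norm_symb {n : ℕ} (ξ : Fin n → ℝ) (α : MultiIndex n) :
    ‖symb ξ α‖ = ∏ i, |ξ i| ^ α i := by
  simp [symb]

theorem mderiv_expo {n : ℕ} (ξ : Fin n → ℝ) (α : MultiIndex n) (x : Rn n) :
    mderiv α (expo ξ) x = symb ξ α * expo ξ x := by
  induction α using multiIndex_induction generalizing x with
  | h0 => rw [mderiv_zero_index, symb_zero, one_mul]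
  | h1 α i ih =>
    have h1 : mderiv α (expo ξ) = fun x => symb ξ α * expo ξ x := funext ih
    rw [mderiv_add_single _ _ (contDiff_expo ξ), h1, symb_add_single]
    have h2 := congrFun (iterate_pderiv_smul i 1 (symb ξ α) (contDiff_expo ξ)) x
    simp only [Function.iterate_one, Pi.smul_apply, smul_eq_mul] at h2
    change pderiv i (symb ξ α • expo ξ) x = _
    rw [h2, pderiv_expo]
    ring

theorem norm_mderiv_expo {n : ℕ} (ξ : Fin n → ℝ) (α : MultiIndex n) (x : Rn n) :
    ‖mderiv α (expo ξ) x‖ = ∏ i, |ξ i| ^ α i := by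
  rw [mderiv_expo, norm_mul, norm_expo, mul_one, norm_symb]

/-! ### Series of smooth functions -/

/-- Termwise differentiation is carried out for full derivatives, dominated through
`norm_iteratedFDeriv_le`, and is then evaluated on coordinate vectors. -/
theorem contDiff_tsum_and_mderiv_tsum {n : ℕ} {u : ℕ → Rn n → ℂ} (hu : ∀ j, ContDiff ℝ ∞ (u j))
    {B : MultiIndex n → ℕ → ℝ} (hB : ∀ α, Summable (B α))
    (h : ∀ α j x, ‖mderiv α (u j) x‖ ≤ B α j) :
    ContDiff ℝ ∞ (fun x => ∑' j, u j x) ∧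
      ∀ α x, mderiv α (fun x => ∑' j, u j x) x = ∑' j, mderiv α (u j) x := by
  classical
  -- `Finset.piAntidiag` lists the finitely many multi-indices of length `k`; their bounds are
  -- summed to dominate the maximum.
  let v : ℕ → ℕ → ℝ := fun k j =>
    n ^ k * ∑ α ∈ Finset.piAntidiag (Finset.univ : Finset (Fin n)) k, B α j
  have hB0 : ∀ α j, 0 ≤ B α j := fun α j => (norm_nonneg _).trans (h α j 0)
  have hv : ∀ k, Summable (v k) := fun k =>
    (summable_sum fun α _ => hB α).mul_left _
  have hd : ∀ k j x, ‖iteratedFDeriv ℝ k (u j) x‖ ≤ v k j := by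
    intro k j x
    refine norm_iteratedFDeriv_le k (hu j) x fun α hα => (h α j x).trans ?_
    refine Finset.single_le_sum (f := fun α => B α j) (fun α _ => hB0 α j) ?_
    rw [Finset.mem_piAntidiag]
    exact ⟨hα, fun i _ => Finset.mem_univ i⟩
  have hc : ContDiff ℝ ∞ (fun x => ∑' j, u j x) :=
    contDiff_tsum (N := ⊤) hu (fun k _ => hv k) (fun k j x _ => hd k j x)
  refine ⟨hc, fun α x => ?_⟩
  obtain ⟨w, -, hw⟩ := exists_mderiv_eq_iteratedFDeriv α (len α) rfl
  rw [hw _ hc, iteratedFDeriv_tsum_apply (N := ⊤) hu (fun k _ => hv k)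
    (fun k j x _ => hd k j x) le_top]
  have hs : Summable fun j => iteratedFDeriv ℝ (len α) (u j) x :=
    Summable.of_norm_bounded (hv (len α)) fun j => hd _ j x
  have h1 := (ContinuousMultilinearMap.apply ℝ (fun _ : Fin (len α) => Rn n) ℂ w).map_tsum hs
  simp only [ContinuousMultilinearMap.apply_apply] at h1
  rw [h1]
  exact tsum_congr fun j => (hw _ (hu j) x).symm

/-- The series `∑ 2⁻ᵏ c_k g_k`. -/
noncomputable def series {n : ℕ} (g : ℕ → Rn n → ℂ) (c : BoundedContinuousFunction ℕ ℂ)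
    (x : Rn n) : ℂ :=
  ∑' k, c k * (1 / 2) ^ k * g k x

theorem norm_series_term_le {c : BoundedContinuousFunction ℕ ℂ} {z : ℕ → ℂ} {D : ℝ}
    (hz : ∀ k, ‖z k‖ ≤ D) (k : ℕ) : ‖c k * (1 / 2) ^ k * z k‖ ≤ ‖c‖ * D * (1 / 2) ^ k := by
  have h1 := c.norm_coe_le_norm k
  have h2 : ‖((1 / 2 : ℂ)) ^ k‖ = (1 / 2 : ℝ) ^ k := by simp
  rw [norm_mul, norm_mul, h2]
  calc ‖c k‖ * (1 / 2) ^ k * ‖z k‖ ≤ ‖c‖ * (1 / 2) ^ k * D := by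
        gcongr
        exact hz k
    _ = _ := by ring

theorem summable_series_bound (a : ℝ) : Summable fun k : ℕ => a * (1 / 2 : ℝ) ^ k :=
  (summable_geometric_of_lt_one (by norm_num) (by norm_num)).mul_left a

theorem summable_series_term (c : BoundedContinuousFunction ℕ ℂ) {z : ℕ → ℂ} {D : ℝ}
    (hz : ∀ k, ‖z k‖ ≤ D) : Summable fun k => c k * (1 / 2) ^ k * z k :=
  Summable.of_norm_bounded (summable_series_bound _) (norm_series_term_le hz)

theorem norm_tsum_series_le (c : BoundedContinuousFunction ℕ ℂ) {z : ℕ → ℂ} {D : ℝ}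
    (hz : ∀ k, ‖z k‖ ≤ D) : ‖∑' k, c k * (1 / 2) ^ k * z k‖ ≤ 2 * D * ‖c‖ := by
  have h1 := tsum_of_norm_bounded (summable_series_bound (‖c‖ * D)).hasSum
    (norm_series_term_le (c := c) hz)
  rw [tsum_mul_left, tsum_geometric_of_lt_one (by norm_num) (by norm_num)] at h1
  linarith

theorem contDiff_series_and_mderiv_series {n : ℕ} {g : ℕ → Rn n → ℂ}
    (hg : ∀ j, ContDiff ℝ ∞ (g j)) {D : MultiIndex n → ℝ}
    (h : ∀ α j x, ‖mderiv α (g j) x‖ ≤ D α) (c : BoundedContinuousFunction ℕ ℂ) :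
    ContDiff ℝ ∞ (series g c) ∧
      ∀ α, mderiv α (series g c) = series (fun j => mderiv α (g j)) c := by
  have h1 : ∀ α j x, mderiv α (fun x => c j * (1 / 2) ^ j * g j x) x =
      c j * (1 / 2) ^ j * mderiv α (g j) x := fun α j x =>
    congrFun (mderiv_smul α (c j * (1 / 2) ^ j) (hg j)) x
  obtain ⟨h2, h3⟩ := contDiff_tsum_and_mderiv_tsum
    (u := fun j x => c j * (1 / 2) ^ j * g j x) (fun j => contDiff_const.mul (hg j))
    (B := fun α j => ‖c‖ * D α * (1 / 2) ^ j) (fun α => summable_series_bound _)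
    (fun α j x => by
      rw [h1]
      exact norm_series_term_le (fun k => h α k x) j)
  refine ⟨h2, fun α => funext fun x => ?_⟩
  rw [series, ← tsum_congr fun j => h1 α j x]
  exact h3 α x

/-! ### A factorization theorem for countable families of closed linear relations -/

/-- If the Banach space `X` is covered by the domains of countably many closed linear relations
between `X` and a Banach space `Y`, then one of them is everywhere defined and bounded. -/
theorem exists_bound_of_closed_relations {X Y : Type*} [NormedAddCommGroup X] [NormedSpace ℂ X]
    [CompleteSpace X] [NormedAddCommGroup Y] [NormedSpace ℂ Y] [CompleteSpace Y]
    (F : ℕ → Submodule ℂ (X × Y)) (hF : ∀ j, IsClosed (F j : Set (X × Y)))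
    (h : ∀ x, ∃ j y, (x, y) ∈ F j) :
    ∃ (j : ℕ) (C : ℝ), 0 ≤ C ∧ ∀ x, ∃ y, (x, y) ∈ F j ∧ ‖y‖ ≤ C * ‖x‖ := by
  -- Points related by `F j` to some `y` of norm at most `m`. These sets cover `X`, so by Baire the
  -- closure of one of them contains a ball.
  let S : ℕ × ℕ → Set X := fun p => {x | ∃ y, (x, y) ∈ F p.1 ∧ ‖y‖ ≤ p.2}
  have hS : ⋃ p, closure (S p) = univ := by
    refine Subset.antisymm (subset_univ _) fun x _ => ?_
    obtain ⟨j, y, hy⟩ := h x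
    obtain ⟨m, hm⟩ := exists_nat_ge ‖y‖
    exact mem_iUnion.2 ⟨(j, m), subset_closure ⟨y, hy, hm⟩⟩
  obtain ⟨⟨j, m⟩, a, ha⟩ := nonempty_interior_of_iUnion_of_closed
    (fun p => isClosed_closure (s := S p)) hS
  rw [mem_interior_iff_mem_nhds, Metric.mem_nhds_iff] at ha
  obtain ⟨ε, hε, hball⟩ := ha
  -- Subtracting approximations of `a + z` and `a` moves the ball to the origin; the bound `m`
  -- becomes `2 * m`.
  have approx : ∀ z : X, ‖z‖ < ε → ∀ δ > 0, ∃ x y, (x, y) ∈ F j ∧ ‖y‖ ≤ 2 * m ∧ ‖z - x‖ < δ := by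
    intro z hz δ hδ
    have h1 : a + z ∈ closure (S (j, m)) := hball (by simpa [dist_eq_norm] using hz)
    have h2 : a ∈ closure (S (j, m)) := hball (Metric.mem_ball_self hε)
    obtain ⟨x1, ⟨y1, hy1, hm1⟩, hx1⟩ := Metric.mem_closure_iff.1 h1 (δ / 2) (half_pos hδ)
    obtain ⟨x2, ⟨y2, hy2, hm2⟩, hx2⟩ := Metric.mem_closure_iff.1 h2 (δ / 2) (half_pos hδ)
    refine ⟨x1 - x2, y1 - y2, (F j).sub_mem hy1 hy2, ?_, ?_⟩
    · simp only at hm1 hm2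
      linarith [norm_sub_le y1 y2]
    · rw [dist_eq_norm] at hx1 hx2
      have h3 : z - (x1 - x2) = (a + z - x1) - (a - x2) := by abel
      rw [h3]
      linarith [norm_sub_le (a + z - x1) (a - x2)]
  -- A vector scaled to norm `ε / 2` is approximated within `ε / 4`, half its norm, at cost `2 * m =
  -- K * (ε / 2)`.
  set K : ℝ := 4 * m / ε with hK
  have hK0 : 0 ≤ K := by positivity
  have step : ∀ x : X, ∃ p : X × Y, p ∈ F j ∧ ‖x - p.1‖ ≤ 1 / 2 * ‖x‖ ∧ ‖p.2‖ ≤ K * ‖x‖ := by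
    intro x
    rcases eq_or_ne x 0 with rfl | hx
    · exact ⟨0, (F j).zero_mem, by simp, by simp⟩
    have hx0 : 0 < ‖x‖ := norm_pos_iff.2 hx
    set t : ℝ := ε / 2 / ‖x‖ with ht
    have ht0 : 0 < t := by positivity
    have htx : t * ‖x‖ = ε / 2 := by rw [ht]; field_simp
    have htn : ‖(t : ℂ)‖ = t := by rw [Complex.norm_real, Real.norm_of_nonneg ht0.le]
    have htc : (t : ℂ) ≠ 0 := by exact_mod_cast ht0.ne'
    obtain ⟨x1, y1, h1, h2, h3⟩ := approx ((t : ℂ) • x)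
      (by rw [norm_smul, htn, htx]; linarith) (ε / 4) (by positivity)
    refine ⟨(t : ℂ)⁻¹ • (x1, y1), (F j).smul_mem _ h1, ?_, ?_⟩
    · have h4 : x - ((t : ℂ)⁻¹ • (x1, y1)).1 = (t : ℂ)⁻¹ • ((t : ℂ) • x - x1) := by
        rw [smul_sub, smul_smul, inv_mul_cancel₀ htc, one_smul, Prod.smul_fst]
      rw [h4, norm_smul, norm_inv, htn, inv_mul_le_iff₀ ht0]
      linarith
    · rw [Prod.smul_snd, norm_smul, norm_inv, htn, inv_mul_le_iff₀ ht0]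
      calc ‖y1‖ ≤ 2 * m := h2
        _ = K * (t * ‖x‖) := by rw [htx, hK]; field_simp; ring
        _ = _ := by ring
  choose p hp1 hp2 hp3 using step
  refine ⟨j, K * 2, by positivity, fun x => ?_⟩
  -- Successive approximation as in the open mapping theorem: the remainder is halved each time, the
  -- corrections sum to at most `K * 2 * ‖x‖`, and closedness of `F j` admits the limit.
  let r : ℕ → X := fun k => (fun z => z - (p z).1)^[k] x
  have hr0 : r 0 = x := rfl
  have hrs : ∀ k, r (k + 1) = r k - (p (r k)).1 := fun k =>
    Function.iterate_succ_apply' _ _ _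
  have hr : ∀ k, ‖r k‖ ≤ ‖x‖ * (1 / 2) ^ k := by
    intro k
    induction k with
    | zero => simp [hr0]
    | succ k ih =>
      rw [hrs, pow_succ]
      linarith [hp2 (r k)]
  have hy : ∀ k, ‖(p (r k)).2‖ ≤ K * ‖x‖ * (1 / 2) ^ k := fun k => by
    calc _ ≤ K * ‖r k‖ := hp3 _
      _ ≤ K * (‖x‖ * (1 / 2) ^ k) := by gcongr; exact hr k
      _ = _ := by ring
  have hsum := summable_series_bound (K * ‖x‖)
  have hs : Summable fun k => (p (r k)).2 := Summable.of_norm_bounded hsum hy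
  refine ⟨∑' k, (p (r k)).2, ?_, ?_⟩
  · have h1 : Tendsto (fun N => (x - r N, ∑ k ∈ Finset.range N, (p (r k)).2)) atTop
        (𝓝 (x, ∑' k, (p (r k)).2)) := by
      refine Tendsto.prodMk_nhds ?_ hs.hasSum.tendsto_sum_nat
      have h2 : Tendsto r atTop (𝓝 0) := by
        refine squeeze_zero_norm hr ?_
        simpa using (tendsto_pow_atTop_nhds_zero_of_lt_one (r := (1 / 2 : ℝ)) (by norm_num)
          (by norm_num)).const_mul ‖x‖
      simpa using tendsto_const_nhds.sub h2
    refine (hF j).mem_of_tendsto h1 (Eventually.of_forall fun N => ?_)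
    induction N with
    | zero =>
      simp only [hr0, sub_self, Finset.range_zero, Finset.sum_empty]
      exact (F j).zero_mem
    | succ N ih =>
      have h3 := (F j).add_mem ih (hp1 (r N))
      have h4 : (x - r (N + 1), ∑ k ∈ Finset.range (N + 1), (p (r k)).2) =
          (x - r N, ∑ k ∈ Finset.range N, (p (r k)).2) + p (r N) := by
        rw [hrs, Finset.sum_range_succ]
        refine Prod.ext ?_ rfl
        simp only [Prod.fst_add]
        abel
      rw [h4]
      exact h3
  · have h1 := tsum_of_norm_bounded hsum.hasSum hy
    rw [tsum_mul_left, tsum_geometric_of_lt_one (by norm_num) (by norm_num)] at h1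
    linarith

section

variable {n : ℕ} {E : Type*} [NormedAddCommGroup E] [NormedSpace ℂ E] [CompleteSpace E]

/-! ### Solid translation-invariant Banach function spaces -/

theorem SolidTIBF.Mem.locallyIntegrable {T : SolidTIBF n E} {f : Rn n → ℂ} (hf : T.Mem f) :
    LocallyIntegrable f volume := by
  obtain ⟨a, ha⟩ := hf
  intro x
  obtain ⟨U, hU, hi⟩ := T.locallyIntegrable a x
  exact ⟨U, hU, hi.congr (ae_restrict_of_ae ha)⟩

theorem SolidTIBF.mem_norm_le (T : SolidTIBF n E) {f g : Rn n → ℂ} (hf : T.Mem f)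
    (hg : LocallyIntegrable g volume) {C : ℝ} (hC : 0 ≤ C) (h : ∀ x, ‖g x‖ ≤ C * ‖f x‖) :
    T.Mem g ∧ T.norm g ≤ C * T.norm f := by
  obtain ⟨⟨a, ha⟩, h2⟩ := T.mem_norm_smul (C : ℂ) hf
  obtain ⟨b, hb, hab⟩ := T.solid a g hg (by
    filter_upwards [ha] with x hx
    rw [hx, norm_mul, Complex.norm_real, Real.norm_of_nonneg hC]
    exact h x)
  refine ⟨⟨b, hb⟩, ?_⟩
  rw [Complex.norm_real, Real.norm_of_nonneg hC, T.norm_eq ha] at h2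
  rw [T.norm_eq hb, ← h2]
  exact hab

theorem SolidTIBF.exists_translate_bound (T : SolidTIBF n E) :
    ∃ C : ℝ, 0 < C ∧ ∀ (a : Rn n) (f : Rn n → ℂ), T.Mem f →
      T.Mem (fun x => f (x - a)) ∧ T.norm (fun x => f (x - a)) ≤ C * T.norm f := by
  obtain ⟨C, hC, h⟩ := T.translate_bound
  refine ⟨C, hC, fun a f ⟨e, he⟩ => ?_⟩
  obtain ⟨g, hg⟩ := T.translate_mem a e
  have h1 : (fun t => T.emb e (t - a)) =ᵐ[volume] fun t => f (t - a) :=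
    (measurePreserving_sub_right volume a).quasiMeasurePreserving.ae_eq_comp he
  refine ⟨⟨g, hg.trans h1⟩, ?_⟩
  rw [T.norm_eq (hg.trans h1), T.norm_eq he]
  exact h a e g hg

theorem SolidTIBF.exists_lintegral_bound (T : SolidTIBF n E) (K : Set (Rn n))
    (hK : IsCompact K) : ∃ C : ℝ, 0 ≤ C ∧ ∀ f : Rn n → ℂ, T.Mem f →
      ∫⁻ x in K, ‖f x‖ₑ ≤ ENNReal.ofReal (C * T.norm f) := by
  obtain ⟨C, hC⟩ := T.continuous_incl K hK
  refine ⟨max C 0, le_max_right _ _, fun f hf => ?_⟩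
  have hfi : IntegrableOn f K volume := hf.locallyIntegrable.integrableOn_isCompact hK
  obtain ⟨e, he⟩ := hf
  rw [← ofReal_integral_norm_eq_lintegral_enorm hfi, T.norm_eq he]
  refine ENNReal.ofReal_le_ofReal ?_
  have h1 : ∫ x in K, ‖f x‖ = ∫ x in K, ‖T.emb e x‖ := by
    refine integral_congr_ae ?_
    filter_upwards [ae_restrict_of_ae he] with x hx
    rw [hx]
  rw [h1]
  refine (hC e).trans ?_
  gcongr
  exact le_max_left _ _

/-- The constant is independent of the centre because the ball can be translated to the origin at
bounded cost. -/
theorem SolidTIBF.exists_lintegral_closedBall_bound (T : SolidTIBF n E) (r : ℝ) :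
    ∃ C : ℝ, 0 ≤ C ∧ ∀ (a : Rn n) (f : Rn n → ℂ), T.Mem f →
      ∫⁻ x in Metric.closedBall a r, ‖f x‖ₑ ≤ ENNReal.ofReal (C * T.norm f) := by
  obtain ⟨C, hC, h⟩ := T.exists_lintegral_bound _ (isCompact_closedBall (0 : Rn n) r)
  obtain ⟨C', hC', h'⟩ := T.exists_translate_bound
  refine ⟨C * C', by positivity, fun a f hf => ?_⟩
  obtain ⟨h1, h2⟩ := h' (-a) f hf
  have h3 := (measurePreserving_sub_right (volume : Measure (Rn n)) (-a)).setLIntegral_comp_emb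
    (MeasurableEquiv.subRight (-a)).measurableEmbedding (fun x => ‖f x‖ₑ)
    (Metric.closedBall 0 r)
  have h4 : (fun x => x - -a) '' Metric.closedBall (0 : Rn n) r = Metric.closedBall a r := by
    ext x
    simp only [sub_neg_eq_add, mem_image, Metric.mem_closedBall, dist_eq_norm, sub_zero]
    constructor
    · rintro ⟨y, hy, rfl⟩
      simpa using hy
    · intro hx
      exact ⟨x - a, hx, by simp⟩
  have h5 : ∫⁻ x in Metric.closedBall a r, ‖f x‖ₑ =
      ∫⁻ x in Metric.closedBall (0 : Rn n) r, ‖f (x - -a)‖ₑ := by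
    rw [← h4]
    exact h3.symm
  rw [h5]
  refine (h _ h1).trans (ENNReal.ofReal_le_ofReal ?_)
  rw [mul_assoc]
  gcongr

theorem SolidTIBF.norm_emb (T : SolidTIBF n E) (e : E) : T.norm (T.emb e) = ‖e‖ :=
  T.norm_eq (EventuallyEq.refl _ _)

/-- Norm limits and pointwise limits agree. -/
theorem SolidTIBF.emb_eq_of_tendsto (T : SolidTIBF n E) {e : ℕ → E} {e₀ : E}
    (he : Tendsto e atTop (𝓝 e₀)) {u : ℕ → Rn n → ℂ} {u₀ : Rn n → ℂ}
    (hu : ∀ k, T.emb (e k) =ᵐ[volume] u k)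
    (hlim : ∀ x, Tendsto (fun k => u k x) atTop (𝓝 (u₀ x))) : T.emb e₀ =ᵐ[volume] u₀ := by
  -- On a compact ball, norm convergence in `E` implies convergence in `L¹`. The balls exhaust the
  -- space.
  have key : ∀ m : ℕ, ∀ᵐ x ∂(volume.restrict (Metric.closedBall (0 : Rn n) m)),
      T.emb e₀ x = u₀ x := by
    intro m
    obtain ⟨C, hC, h⟩ := T.exists_lintegral_bound _ (isCompact_closedBall (0 : Rn n) m)
    set μ := volume.restrict (Metric.closedBall (0 : Rn n) m) with hμ
    have hmeas : ∀ k, AEMeasurable (fun x => ‖u k x - T.emb e₀ x‖ₑ) μ := fun k =>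
      ((((T.emb (e k)).aestronglyMeasurable.congr (hu k)).sub
        (T.emb e₀).aestronglyMeasurable).enorm).restrict
    have h1 : ∀ k, ∫⁻ x, ‖u k x - T.emb e₀ x‖ₑ ∂μ ≤ ENNReal.ofReal (C * ‖e k - e₀‖) := by
      intro k
      have h2 : T.emb (e k - e₀) =ᵐ[volume] fun x => u k x - T.emb e₀ x := by
        rw [map_sub]
        filter_upwards [AEEqFun.coeFn_sub (T.emb (e k)) (T.emb e₀), hu k] with x h3 h4
        rw [h3, Pi.sub_apply, h4]
      have h3 := h _ ⟨_, h2⟩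
      rwa [T.norm_eq h2] at h3
    -- Fatou's lemma: the integrals tend to `0`, and the `liminf` inside is the pointwise limit `‖u₀
    -- - emb e₀‖`.
    have h2 : ∫⁻ x, liminf (fun k => ‖u k x - T.emb e₀ x‖ₑ) atTop ∂μ = 0 := by
      refine le_antisymm ((lintegral_liminf_le' hmeas).trans ?_) zero_le
      have h3 : Tendsto (fun k => ENNReal.ofReal (C * ‖e k - e₀‖)) atTop (𝓝 0) := by
        have h4 : Tendsto (fun k => C * ‖e k - e₀‖) atTop (𝓝 0) := by
          simpa using (tendsto_iff_norm_sub_tendsto_zero.1 he).const_mul C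
        simpa using ENNReal.tendsto_ofReal h4
      rw [← h3.liminf_eq]
      exact liminf_le_liminf (Eventually.of_forall h1)
    have h3 : ∀ x, liminf (fun k => ‖u k x - T.emb e₀ x‖ₑ) atTop = ‖u₀ x - T.emb e₀ x‖ₑ :=
      fun x => (((hlim x).sub_const _).enorm).liminf_eq
    simp only [h3] at h2
    have h4 : AEMeasurable (fun x => ‖u₀ x - T.emb e₀ x‖ₑ) μ :=
      aemeasurable_of_tendsto_metrizable_ae' hmeas
        (Eventually.of_forall fun x => ((hlim x).sub_const _).enorm)
    rw [lintegral_eq_zero_iff' h4] at h2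
    filter_upwards [h2] with x hx
    simp only [Pi.zero_apply, enorm_eq_zero] at hx
    exact (sub_eq_zero.1 hx).symm
  have h1 : ∀ᵐ x ∂(volume.restrict (⋃ m : ℕ, Metric.closedBall (0 : Rn n) m)),
      T.emb e₀ x = u₀ x := (ae_restrict_iUnion_iff _ _).2 key
  rwa [Metric.iUnion_closedBall_nat, Measure.restrict_univ] at h1

/-- Completeness gives a sum in norm, which `emb_eq_of_tendsto` identifies with the pointwise sum.
-/
theorem SolidTIBF.mem_norm_of_hasSum (T : SolidTIBF n E) {h : ℕ → Rn n → ℂ} {b : ℕ → ℝ}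
    (hb : Summable b) (hmem : ∀ k, T.Mem (h k)) (hle : ∀ k, T.norm (h k) ≤ b k)
    {u : Rn n → ℂ} (hu : ∀ x, HasSum (fun k => h k x) (u x)) :
    T.Mem u ∧ T.norm u ≤ ∑' k, b k := by
  choose e he using hmem
  have hn : ∀ k, ‖e k‖ ≤ b k := fun k => by rw [← T.norm_eq (he k)]; exact hle k
  have hs : Summable e := Summable.of_norm_bounded hb hn
  have hp : ∀ N, T.emb (∑ k ∈ Finset.range N, e k) =ᵐ[volume]
      fun x => ∑ k ∈ Finset.range N, h k x := by
    intro N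
    induction N with
    | zero =>
      simp only [Finset.range_zero, Finset.sum_empty, map_zero]
      exact AEEqFun.coeFn_zero
    | succ N ih =>
      rw [Finset.sum_range_succ, map_add]
      filter_upwards [AEEqFun.coeFn_add (T.emb (∑ k ∈ Finset.range N, e k)) (T.emb (e N)), ih,
        he N] with x h1 h2 h3
      rw [h1, Pi.add_apply, h2, h3, Finset.sum_range_succ]
  have h1 := T.emb_eq_of_tendsto hs.hasSum.tendsto_sum_nat hp fun x => (hu x).tendsto_sum_nat
  refine ⟨⟨_, h1⟩, ?_⟩
  rw [T.norm_eq h1]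
  exact tsum_of_norm_bounded hb.hasSum hn

/-! ### Convolution with compactly supported functions -/

/-- The value at `x` only sees `f` on a ball of fixed radius about `x`, where its `L¹` norm is
controlled uniformly in `x`. -/
theorem SolidTIBF.exists_norm_convolution_apply_le (T : SolidTIBF n E) {χ : Rn n → ℂ}
    (hχ : Continuous χ) (hs : HasCompactSupport χ) : ∃ C : ℝ, 0 ≤ C ∧ ∀ f, T.Mem f → ∀ x,
      ‖(f ⋆[ContinuousLinearMap.mul ℂ ℂ, volume] χ) x‖ ≤ C * T.norm f := by
  obtain ⟨r, hr⟩ := hs.isCompact.isBounded.subset_closedBall (0 : Rn n)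
  obtain ⟨S, hS⟩ := hχ.bounded_above_of_compact_support hs
  have hS0 : 0 ≤ S := (_root_.norm_nonneg _).trans (hS 0)
  obtain ⟨C, hC, h⟩ := T.exists_lintegral_closedBall_bound r
  refine ⟨S * C, by positivity, fun f hf x => ?_⟩
  have h1 : ‖(f ⋆[ContinuousLinearMap.mul ℂ ℂ, volume] χ) x‖ₑ ≤
      ENNReal.ofReal (S * C * T.norm f) := by
    rw [convolution_def]
    refine (enorm_integral_le_lintegral_enorm _).trans ?_
    have h2 : ∀ t, ‖(ContinuousLinearMap.mul ℂ ℂ) (f t) (χ (x - t))‖ₑ ≤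
        ENNReal.ofReal S * (Metric.closedBall x r).indicator (fun t => ‖f t‖ₑ) t := by
      intro t
      rw [ContinuousLinearMap.mul_apply', enorm_mul]
      by_cases ht : t ∈ Metric.closedBall x r
      · rw [indicator_of_mem ht, mul_comm]
        gcongr
        rw [← ofReal_norm]
        exact ENNReal.ofReal_le_ofReal (hS _)
      · have h3 : χ (x - t) = 0 := by
          by_contra h4
          have h5 := hr (subset_tsupport χ h4)
          rw [Metric.mem_closedBall, dist_zero_right] at h5
          refine ht ?_
          rw [Metric.mem_closedBall, dist_comm, dist_eq_norm]
          exact h5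
        simp [h3]
    refine (lintegral_mono h2).trans ?_
    rw [lintegral_const_mul' _ _ ENNReal.ofReal_ne_top,
      lintegral_indicator measurableSet_closedBall, mul_assoc, ENNReal.ofReal_mul hS0]
    gcongr
    exact h x f hf
  rw [← ofReal_norm] at h1
  exact (ENNReal.ofReal_le_ofReal_iff (mul_nonneg (by positivity) (T.norm_nonneg _))).1 h1

theorem SolidTIBF.emb_convolution_add (T : SolidTIBF n E) (a b : E) {χ : Rn n → ℂ}
    (hχ : Continuous χ) (hs : HasCompactSupport χ) :
    (T.emb (a + b) ⋆[ContinuousLinearMap.mul ℂ ℂ, volume] χ) =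
      (T.emb a ⋆[ContinuousLinearMap.mul ℂ ℂ, volume] χ) +
        (T.emb b ⋆[ContinuousLinearMap.mul ℂ ℂ, volume] χ) := by
  rw [map_add, convolution_congr _ (AEEqFun.coeFn_add (T.emb a) (T.emb b)) (EventuallyEq.refl _ χ)]
  exact (hs.convolutionExists_right _ (T.locallyIntegrable a) hχ).add_distrib
    (hs.convolutionExists_right _ (T.locallyIntegrable b) hχ)

theorem SolidTIBF.emb_convolution_smul (T : SolidTIBF n E) (c : ℂ) (a : E) {χ : Rn n → ℂ} :
    (T.emb (c • a) ⋆[ContinuousLinearMap.mul ℂ ℂ, volume] χ) =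
      c • (T.emb a ⋆[ContinuousLinearMap.mul ℂ ℂ, volume] χ) := by
  rw [map_smul, convolution_congr _ (AEEqFun.coeFn_smul c (T.emb a)) (EventuallyEq.refl _ χ)]
  exact smul_convolution

/-- The axiom `convolution_mem` asserts membership only. The bound comes from the closed graph
principle, with the graph closed because values of the convolution depend continuously on `f`. -/
theorem SolidTIBF.exists_convolution_bound (T : SolidTIBF n E) {χ : Rn n → ℂ}
    (hχ : Continuous χ) (hs : HasCompactSupport χ) : ∃ C : ℝ, 0 ≤ C ∧ ∀ f, T.Mem f →
      T.Mem (f ⋆[ContinuousLinearMap.mul ℂ ℂ, volume] χ) ∧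
        T.norm (f ⋆[ContinuousLinearMap.mul ℂ ℂ, volume] χ) ≤ C * T.norm f := by
  obtain ⟨C, hC, hbound⟩ := T.exists_norm_convolution_apply_le hχ hs
  let F : Submodule ℂ (E × E) :=
    { carrier := {p | T.emb p.2 =ᵐ[volume]
        (T.emb p.1 ⋆[ContinuousLinearMap.mul ℂ ℂ, volume] χ)}
      add_mem' := by
        intro p q hp hq
        simp only [mem_ofPred_eq, Prod.fst_add, Prod.snd_add] at hp hq ⊢
        rw [T.emb_convolution_add _ _ hχ hs, map_add]
        filter_upwards [AEEqFun.coeFn_add (T.emb p.2) (T.emb q.2), hp, hq] with x h1 h2 h3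
        rw [h1, Pi.add_apply, Pi.add_apply, h2, h3]
      zero_mem' := by
        have h1 := T.emb_convolution_smul 0 0 (χ := χ)
        simp only [zero_smul] at h1
        simp only [mem_ofPred_eq, Prod.fst_zero, Prod.snd_zero, h1]
        rw [map_zero]
        exact AEEqFun.coeFn_zero
      smul_mem' := by
        intro c p hp
        simp only [mem_ofPred_eq, Prod.smul_fst, Prod.smul_snd] at hp ⊢
        rw [T.emb_convolution_smul, map_smul]
        filter_upwards [AEEqFun.coeFn_smul c (T.emb p.2), hp] with x h1 h2
        rw [h1, Pi.smul_apply, Pi.smul_apply, h2] }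
  have hF : IsClosed (F : Set (E × E)) := by
    refine IsSeqClosed.isClosed fun p q hp hpq => ?_
    have h1 : Tendsto (fun k => (p k).1) atTop (𝓝 q.1) := (continuous_fst.tendsto q).comp hpq
    have h2 : Tendsto (fun k => (p k).2) atTop (𝓝 q.2) := (continuous_snd.tendsto q).comp hpq
    refine T.emb_eq_of_tendsto h2 hp fun x => ?_
    rw [tendsto_iff_norm_sub_tendsto_zero]
    have h3 : Tendsto (fun k => C * ‖(p k).1 - q.1‖) atTop (𝓝 0) := by
      simpa using (tendsto_iff_norm_sub_tendsto_zero.1 h1).const_mul C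
    refine squeeze_zero (fun _ => _root_.norm_nonneg _) (fun k => ?_) h3
    have h4 := T.emb_convolution_add ((p k).1 - q.1) q.1 hχ hs
    rw [sub_add_cancel] at h4
    rw [h4, Pi.add_apply, add_sub_cancel_right, ← T.norm_emb]
    exact hbound _ ⟨_, EventuallyEq.refl _ _⟩ x
  obtain ⟨-, K, hK, h⟩ := exists_bound_of_closed_relations (fun _ => F) (fun _ => hF)
    (fun x => ⟨0, T.convolution_mem x χ hχ hs⟩)
  refine ⟨K, hK, fun f ⟨e, he⟩ => ?_⟩
  obtain ⟨g, hg, hge⟩ := h e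
  have h1 : T.emb g =ᵐ[volume] (f ⋆[ContinuousLinearMap.mul ℂ ℂ, volume] χ) := by
    have h2 : T.emb g =ᵐ[volume] (T.emb e ⋆[ContinuousLinearMap.mul ℂ ℂ, volume] χ) := hg
    rwa [convolution_congr _ he (EventuallyEq.refl _ χ)] at h2
  exact ⟨⟨g, h1⟩, by rwa [T.norm_eq h1, T.norm_eq he]⟩

/-! ### Integrability against a decaying weight -/

/-- The integrable weight `(1 + |x|)^{-(n+1)}`. -/
noncomputable def decay (x : Rn n) : ℝ := (1 + ‖x‖) ^ (-(n + 1 : ℝ))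

theorem decay_pos (x : Rn n) : 0 < decay x := by unfold decay; positivity

theorem continuous_decay : Continuous (decay (n := n)) := by
  unfold decay
  refine Continuous.rpow_const (by fun_prop) fun x => Or.inl ?_
  positivity

theorem integrable_decay : Integrable (decay (n := n)) volume := by
  unfold decay
  refine integrable_one_add_norm ?_
  simp

theorem decay_le (x y : Rn n) (h : dist x y ≤ 1) : decay x ≤ 2 ^ (n + 1 : ℝ) * decay y := by
  unfold decay
  rw [Real.rpow_neg (by positivity), Real.rpow_neg (by positivity), ← div_eq_mul_inv,
    inv_eq_one_div, div_le_div_iff₀ (by positivity) (by positivity), one_mul,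
    ← Real.mul_rpow (by positivity) (by positivity)]
  refine Real.rpow_le_rpow (by positivity) ?_ (by positivity)
  have h1 : ‖y‖ ≤ ‖x‖ + dist x y := by
    rw [dist_eq_norm]
    have := norm_sub_norm_le y x
    rw [norm_sub_rev] at this
    linarith
  nlinarith [norm_nonneg x]

/-- Averaging over unit balls: by Tonelli, `∫ |f| decay` is at most a constant times `∫ decay(y)
∫_{B(y,1)} |f(x)| dx dy`, since `decay` varies by a bounded factor on such balls. The inner
integrals are uniformly bounded by the norm of `f`. -/
theorem SolidTIBF.exists_integral_decay_bound (T : SolidTIBF n E) :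
    ∃ C : ℝ, 0 ≤ C ∧ ∀ f, T.Mem f → Integrable (fun x => ‖f x‖ * decay x) volume ∧
      ∫ x, ‖f x‖ * decay x ≤ C * T.norm f := by
  obtain ⟨C, hC, h⟩ := T.exists_lintegral_closedBall_bound 1
  set B := volume (Metric.closedBall (0 : Rn n) 1) with hB
  have hB0 : B ≠ 0 := (Metric.measure_closedBall_pos volume _ one_pos).ne'
  have hBt : B ≠ ⊤ := measure_closedBall_lt_top.ne
  set I : ℝ := ∫ x : Rn n, decay x with hI
  have hI0 : 0 ≤ I := integral_nonneg fun x => (decay_pos x).le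
  set C' : ℝ := 2 ^ (n + 1 : ℝ) * (C * I) / B.toReal with hC'
  have hC'0 : 0 ≤ C' := by positivity
  have key : ∀ f, T.Mem f → ∫⁻ x, ‖f x‖ₑ * ENNReal.ofReal (decay x) ≤
      ENNReal.ofReal (C' * T.norm f) := by
    intro f hf
    have hfm : AEMeasurable (fun x => ‖f x‖ₑ) volume :=
      hf.locallyIntegrable.aestronglyMeasurable.enorm
    have hset : MeasurableSet {p : Rn n × Rn n | dist p.1 p.2 ≤ 1} :=
      (isClosed_le continuous_dist continuous_const).measurableSet
    obtain ⟨k, hkm, hk⟩ : ∃ k : Rn n → Rn n → ENNReal, Measurable (Function.uncurry k) ∧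
        ∀ x y, k x y = if dist x y ≤ 1 then 1 else 0 :=
      ⟨fun x y => {p : Rn n × Rn n | dist p.1 p.2 ≤ 1}.indicator 1 (x, y),
        measurable_one.indicator hset, fun x y => rfl⟩
    have hkx : ∀ x, Measurable (k x) := fun x => hkm.of_uncurry_left
    have hk1 : ∀ x, ∫⁻ y, k x y = B := by
      intro x
      have h1 : k x = (Metric.closedBall x 1).indicator 1 := by
        funext y
        simp only [hk, indicator, Metric.mem_closedBall, dist_comm x y, Pi.one_apply]
      rw [h1, lintegral_indicator_one measurableSet_closedBall, hB,
        Measure.addHaar_closedBall_center]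
    have hdm : Measurable fun x : Rn n => ENNReal.ofReal (decay x) :=
      continuous_decay.measurable.ennreal_ofReal
    have h1 : B * ∫⁻ x, ‖f x‖ₑ * ENNReal.ofReal (decay x) ≤
        ∫⁻ x, ∫⁻ y, ‖f x‖ₑ * k x y * ENNReal.ofReal (2 ^ (n + 1 : ℝ) * decay y) := by
      rw [← lintegral_const_mul' _ _ hBt]
      refine lintegral_mono fun x => ?_
      calc B * (‖f x‖ₑ * ENNReal.ofReal (decay x))
          = ∫⁻ y, k x y * (‖f x‖ₑ * ENNReal.ofReal (decay x)) := by
            rw [lintegral_mul_const _ (hkx x), hk1]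
        _ ≤ _ := by
            refine lintegral_mono fun y => ?_
            by_cases hxy : dist x y ≤ 1
            · have h2 : k x y = 1 := by simp [hk, hxy]
              simp only [h2, one_mul, mul_one]
              gcongr
              exact decay_le x y hxy
            · have h2 : k x y = 0 := by simp [hk, hxy]
              simp [h2]
    have h2 : ∫⁻ x, ∫⁻ y, ‖f x‖ₑ * k x y * ENNReal.ofReal (2 ^ (n + 1 : ℝ) * decay y) =
        ∫⁻ y, ∫⁻ x, ‖f x‖ₑ * k x y * ENNReal.ofReal (2 ^ (n + 1 : ℝ) * decay y) := by
      refine lintegral_lintegral_swap ?_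
      refine AEMeasurable.mul (AEMeasurable.mul ?_ hkm.aemeasurable) ?_
      · exact hfm.comp_quasiMeasurePreserving Measure.quasiMeasurePreserving_fst
      · exact ((continuous_decay.measurable.const_mul _).comp measurable_snd).ennreal_ofReal
          |>.aemeasurable
    have h3 : ∫⁻ y, ∫⁻ x, ‖f x‖ₑ * k x y * ENNReal.ofReal (2 ^ (n + 1 : ℝ) * decay y) ≤
        ∫⁻ y : Rn n, ENNReal.ofReal (2 ^ (n + 1 : ℝ) * (C * T.norm f)) *
          ENNReal.ofReal (decay y) := by
      refine lintegral_mono fun y => ?_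
      rw [lintegral_mul_const' _ _ ENNReal.ofReal_ne_top]
      have h4 : ∫⁻ x, ‖f x‖ₑ * k x y = ∫⁻ x in Metric.closedBall y 1, ‖f x‖ₑ := by
        rw [← lintegral_indicator measurableSet_closedBall]
        refine lintegral_congr fun x => ?_
        simp only [hk, indicator, Metric.mem_closedBall]
        split_ifs <;> simp
      rw [h4, ENNReal.ofReal_mul (by positivity), ENNReal.ofReal_mul (by positivity)]
      calc _ ≤ ENNReal.ofReal (C * T.norm f) *
            (ENNReal.ofReal (2 ^ (n + 1 : ℝ)) * ENNReal.ofReal (decay y)) := by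
            gcongr
            exact h y f hf
        _ = _ := by ring
    rw [lintegral_const_mul' _ _ ENNReal.ofReal_ne_top,
      ← ofReal_integral_eq_lintegral_ofReal integrable_decay
        (Eventually.of_forall fun x => (decay_pos x).le), ← ENNReal.ofReal_mul
        (mul_nonneg (by positivity) (mul_nonneg hC (T.norm_nonneg _)))] at h3
    have h5 := (h1.trans_eq h2).trans h3
    have h6 : ENNReal.ofReal (2 ^ (n + 1 : ℝ) * (C * T.norm f) * I) =
        B * ENNReal.ofReal (C' * T.norm f) := by
      conv_rhs => rw [← ENNReal.ofReal_toReal hBt]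
      rw [← ENNReal.ofReal_mul ENNReal.toReal_nonneg, hC']
      congr 1
      have : B.toReal ≠ 0 := ENNReal.toReal_ne_zero.2 ⟨hB0, hBt⟩
      field_simp
    rw [h6] at h5
    exact (ENNReal.mul_le_mul_iff_right hB0 hBt).1 h5
  refine ⟨C', hC'0, fun f hf => ?_⟩
  have h1 := key f hf
  have hfm : AEStronglyMeasurable (fun x => ‖f x‖ * decay x) volume :=
    hf.locallyIntegrable.aestronglyMeasurable.norm.mul continuous_decay.aestronglyMeasurable
  have h2 : ∀ x, ENNReal.ofReal (‖f x‖ * decay x) = ‖f x‖ₑ * ENNReal.ofReal (decay x) :=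
    fun x => by rw [ENNReal.ofReal_mul (_root_.norm_nonneg _), ofReal_norm]
  have h0 : ∀ x, 0 ≤ ‖f x‖ * decay x := fun x => mul_nonneg (_root_.norm_nonneg _) (decay_pos x).le
  have h3 : Integrable (fun x => ‖f x‖ * decay x) volume := by
    refine ⟨hfm, ?_⟩
    rw [hasFiniteIntegral_iff_ofReal (Eventually.of_forall h0)]
    simp only [h2]
    exact h1.trans_lt ENNReal.ofReal_lt_top
  refine ⟨h3, ?_⟩
  rw [← ENNReal.ofReal_le_ofReal_iff (mul_nonneg hC'0 (T.norm_nonneg _)),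
    ofReal_integral_eq_lintegral_ofReal h3 (Eventually.of_forall h0)]
  simpa only [h2] using h1

/-! ### Uniform boundedness of linear families in unions of step spaces -/

theorem continuous_weightedDeriv (w : WeightFunction n) (α : MultiIndex n) {f : Rn n → ℂ}
    (hf : ContDiff ℝ ∞ f) : Continuous (weightedDeriv w α f) :=
  (contDiff_mderiv α hf).continuous.mul (Complex.continuous_ofReal.comp w.continuous_toFun)

theorem norm_weightedDeriv (w : WeightFunction n) (α : MultiIndex n) (f : Rn n → ℂ) (x : Rn n) :
    ‖weightedDeriv w α f x‖ = ‖mderiv α f x‖ * w x := by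
  have := w.one_le_toFun x
  rw [weightedDeriv, norm_mul, Complex.norm_real, Real.norm_of_nonneg (by linarith)]

theorem mem_stepSubmodule_iff (T : SolidTIBF n E) (M : WeightSequence n) (w : WeightFunction n)
    (f : Rn n → ℂ) : f ∈ stepSubmodule T M w ↔ ContDiff ℝ ∞ f ∧ ∃ A : ℝ, 0 ≤ A ∧
      ∀ α, T.Mem (weightedDeriv w α f) ∧ T.norm (weightedDeriv w α f) ≤ A * M α := by
  constructor
  · rintro ⟨h1, h2, A, hA⟩
    have h3 : ∀ α, T.norm (weightedDeriv w α f) ≤ A * M α := fun α =>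
      (div_le_iff₀ (M.pos α)).1 (hA ⟨α, rfl⟩)
    refine ⟨h1, A, ?_, fun α => ⟨h2 α, h3 α⟩⟩
    have h4 := (T.norm_nonneg _).trans (h3 0)
    rwa [M.map_zero, mul_one] at h4
  · rintro ⟨h1, A, -, h2⟩
    refine ⟨h1, fun α => (h2 α).1, A, ?_⟩
    rintro _ ⟨α, rfl⟩
    exact (div_le_iff₀ (M.pos α)).2 (h2 α).2

/-- The Baire step for step spaces: pointwise membership in a countable union improves to one index
and one constant. Pointwise continuity of the derivatives in `c` is what makes the relations closed.
-/
theorem exists_uniform_step_bound (T : SolidTIBF n E) {X : Type*} [NormedAddCommGroup X]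
    [NormedSpace ℂ X] [CompleteSpace X] (A : X →ₗ[ℂ] (Rn n → ℂ))
    (hA : ∀ c, ContDiff ℝ ∞ (A c)) (hc : ∀ α x, Continuous fun c => mderiv α (A c) x)
    (N : ℕ → WeightSequence n) (v : ℕ → WeightFunction n)
    (h : ∀ c, ∃ j, A c ∈ stepSubmodule T (N j) (v j)) :
    ∃ (j : ℕ) (C : ℝ), 0 ≤ C ∧ ∀ c α, T.Mem (weightedDeriv (v j) α (A c)) ∧
      T.norm (weightedDeriv (v j) α (A c)) ≤ C * ‖c‖ * N j α := by
  have hcoe : ∀ (j : ℕ) (α : MultiIndex n) (c : X) (x : Rn n),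
      ((N j α : ℂ))⁻¹ * weightedDeriv (v j) α (A c) x =
        mderiv α (A c) x * ((N j α : ℂ)⁻¹ * (v j x : ℂ)) := fun j α c x => by
    rw [weightedDeriv]
    ring
  -- The partner of `c` is the family of all `(A c)^{(α)} v / N_α`, an element of `ℓ^∞` with values
  -- in `E`; its sup norm is the step norm of `A c`.
  let F : ℕ → Submodule ℂ (X × BoundedContinuousFunction (MultiIndex n) E) := fun j =>
    { carrier := {p | ∀ α, T.emb (p.2 α) =ᵐ[volume]
        fun x => (N j α : ℂ)⁻¹ * weightedDeriv (v j) α (A p.1) x}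
      add_mem' := by
        intro p q hp hq α
        simp only [Prod.fst_add, Prod.snd_add, BoundedContinuousFunction.coe_add, Pi.add_apply]
        rw [map_add, map_add, weightedDeriv_add _ _ (hA _) (hA _)]
        filter_upwards [AEEqFun.coeFn_add (T.emb (p.2 α)) (T.emb (q.2 α)), hp α, hq α]
          with x h1 h2 h3
        rw [h1, Pi.add_apply, h2, h3, mul_add]
      zero_mem' := by
        intro α
        simp only [Prod.fst_zero, Prod.snd_zero, BoundedContinuousFunction.coe_zero,
          Pi.zero_apply]
        rw [map_zero, map_zero, weightedDeriv_zero]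
        simp only [mul_zero]
        exact AEEqFun.coeFn_zero
      smul_mem' := by
        intro c p hp α
        simp only [Prod.smul_fst, Prod.smul_snd, BoundedContinuousFunction.coe_smul]
        rw [map_smul, map_smul, weightedDeriv_smul _ _ _ (hA _)]
        filter_upwards [AEEqFun.coeFn_smul c (T.emb (p.2 α)), hp α] with x h1 h2
        rw [h1, Pi.smul_apply, h2, smul_eq_mul]
        ring }
  have hF : ∀ j, IsClosed (F j : Set (X × BoundedContinuousFunction (MultiIndex n) E)) := by
    intro j
    refine IsSeqClosed.isClosed fun p q hp hpq α => ?_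
    have h1 : Tendsto (fun k => (p k).1) atTop (𝓝 q.1) := (continuous_fst.tendsto q).comp hpq
    have h2 : Tendsto (fun k => (p k).2 α) atTop (𝓝 (q.2 α)) :=
      ((BoundedContinuousFunction.evalCLM ℂ α).continuous.tendsto q.2).comp
        ((continuous_snd.tendsto q).comp hpq)
    refine T.emb_eq_of_tendsto h2 (fun k => hp k α) fun x => ?_
    simp only [hcoe]
    exact (((hc α x).tendsto q.1).comp h1).mul_const _
  obtain ⟨j, C, hC, hb⟩ := exists_bound_of_closed_relations F hF (by
    intro c
    obtain ⟨j, hj⟩ := h c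
    obtain ⟨h1, B, hB, h2⟩ := (mem_stepSubmodule_iff T _ _ _).1 hj
    have h3 : ∀ α, ∃ e : E, T.emb e =ᵐ[volume]
        (fun x => (N j α : ℂ)⁻¹ * weightedDeriv (v j) α (A c) x) ∧ ‖e‖ ≤ B := by
      intro α
      obtain ⟨⟨e, he⟩, h4⟩ := T.mem_norm_smul (N j α : ℂ)⁻¹ (h2 α).1
      refine ⟨e, he, ?_⟩
      rw [← T.norm_eq he, h4, norm_inv, Complex.norm_real,
        Real.norm_of_nonneg ((N j).pos α).le, inv_mul_le_iff₀ ((N j).pos α), mul_comm]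
      exact (h2 α).2
    choose e he1 he2 using h3
    exact ⟨j, BoundedContinuousFunction.ofNormedAddCommGroupDiscrete e B he2, he1⟩)
  refine ⟨j, C, hC, fun c α => ?_⟩
  obtain ⟨y, hy, hyn⟩ := hb c
  have h1 := hy α
  have hN0 : (N j α : ℂ) ≠ 0 := by exact_mod_cast ((N j).pos α).ne'
  obtain ⟨h3, h4⟩ := T.mem_norm_smul (N j α : ℂ) ⟨_, h1⟩
  simp only [mul_inv_cancel_left₀ hN0] at h3 h4
  refine ⟨h3, ?_⟩
  rw [h4, T.norm_eq h1, Complex.norm_real, Real.norm_of_nonneg ((N j).pos α).le, mul_comm]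
  exact mul_le_mul_of_nonneg_right ((y.norm_coe_le_norm α).trans hyn) ((N j).pos α).le

/-- The series `∑ 2⁻ᵏ c_k g_k` as a linear map in `c`. -/
noncomputable def seriesMap (g : ℕ → Rn n → ℂ) {D : ℝ} (hD : ∀ k x, ‖g k x‖ ≤ D) :
    BoundedContinuousFunction ℕ ℂ →ₗ[ℂ] (Rn n → ℂ) where
  toFun := series g
  map_add' c d := by
    funext x
    rw [Pi.add_apply, series, series, series,
      ← (summable_series_term c fun k => hD k x).tsum_add (summable_series_term d fun k => hD k x)]
    refine tsum_congr fun k => ?_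
    rw [BoundedContinuousFunction.coe_add, Pi.add_apply]
    ring
  map_smul' a c := by
    funext x
    rw [Pi.smul_apply, RingHom.id_apply, series, series, smul_eq_mul, ← tsum_mul_left]
    refine tsum_congr fun k => ?_
    simp only [BoundedContinuousFunction.coe_smul, smul_eq_mul]
    ring

theorem continuous_series_apply {g : ℕ → Rn n → ℂ} {D : ℝ} (hD : ∀ k x, ‖g k x‖ ≤ D) (x : Rn n) :
    Continuous fun c => series g c x := by
  let ev : BoundedContinuousFunction ℕ ℂ →ₗ[ℂ] ℂ := (LinearMap.proj x).comp (seriesMap g hD)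
  exact (ev.mkContinuous (2 * D) fun c => norm_tsum_series_le c fun k => hD k x).continuous

/-- The sequence `e_k` as an element of the space of bounded sequences. -/
noncomputable def unitSeq (k : ℕ) : BoundedContinuousFunction ℕ ℂ :=
  BoundedContinuousFunction.ofNormedAddCommGroupDiscrete (Pi.single k 1) 1 fun j => by
    by_cases h : j = k
    · subst h
      simp
    · simp [h]

theorem norm_unitSeq_le (k : ℕ) : ‖unitSeq k‖ ≤ 1 := by
  refine (BoundedContinuousFunction.norm_le zero_le_one).2 fun j => ?_
  change ‖(Pi.single k 1 : ℕ → ℂ) j‖ ≤ 1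
  by_cases h : j = k
  · subst h
    simp
  · simp [h]

theorem series_unitSeq (g : ℕ → Rn n → ℂ) (k : ℕ) :
    series g (unitSeq k) = ((1 / 2 : ℂ) ^ k) • g k := by
  funext x
  rw [series, tsum_eq_single k]
  · change (Pi.single k 1 : ℕ → ℂ) k * _ * _ = _
    simp
  · intro j hj
    change (Pi.single k 1 : ℕ → ℂ) j * _ * _ = _
    simp [hj]

/-! ### Absorption of the geometric factors -/

/-- Condition [L] removes `H` from [I] and gains the factor `2 ^ len`, which pays for the number of
terms in the Leibniz rule. -/
theorem WeightSequenceSystem.condI_absorb {M : WeightSequenceSystem n} {r : Regime}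
    (hL : M.CondL r) (hI : M.CondI r) :
    match r with
    | .beurling => ∀ l : RPos, ∃ m k : RPos, ∃ C : ℝ, 0 < C ∧
        ∀ α β, 2 ^ len (α + β) * (M m α * M k β) ≤ C * M l (α + β)
    | .roumieu => ∀ m k : RPos, ∃ l : RPos, ∃ C : ℝ, 0 < C ∧
        ∀ α β, 2 ^ len (α + β) * (M m α * M k β) ≤ C * M l (α + β) := by
  cases r with
  | beurling =>
    intro l
    obtain ⟨m, k, C, H, hC, hH, h⟩ := hI l
    -- In the Beurling case [L] shrinks the two factors on the left; in the Roumieu case it enlarges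
    -- the sequence on the right.
    obtain ⟨m', C1, hC1, h1⟩ := hL (2 * H) (by positivity) m
    obtain ⟨k', C2, hC2, h2⟩ := hL (2 * H) (by positivity) k
    refine ⟨m', k', C1 * C2 * C, by positivity, fun α β => ?_⟩
    have h3 := mul_le_mul (h1 α) (h2 β)
      (mul_nonneg (by positivity) ((M k').pos β).le) (mul_nonneg hC1.le ((M m).pos α).le)
    have h4 := h α β
    have hHp : 0 < H ^ len (α + β) := by positivity
    refine le_of_mul_le_mul_left ?_ hHp
    calc H ^ len (α + β) * (2 ^ len (α + β) * (M m' α * M k' β))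
        = (2 * H) ^ len α * M m' α * ((2 * H) ^ len β * M k' β) := by
          rw [len_add, pow_add, pow_add, mul_pow, mul_pow]
          ring
      _ ≤ C1 * M m α * (C2 * M k β) := h3
      _ = C1 * C2 * (M m α * M k β) := by ring
      _ ≤ C1 * C2 * (C * H ^ len (α + β) * M l (α + β)) :=
          mul_le_mul_of_nonneg_left h4 (by positivity)
      _ = _ := by ring
  | roumieu =>
    intro m k
    obtain ⟨l, C, H, hC, hH, h⟩ := hI m k
    obtain ⟨l', C1, hC1, h1⟩ := hL (2 * H) (by positivity) l
    refine ⟨l', C * C1, by positivity, fun α β => ?_⟩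
    calc 2 ^ len (α + β) * (M m α * M k β)
        ≤ 2 ^ len (α + β) * (C * H ^ len (α + β) * M l (α + β)) :=
          mul_le_mul_of_nonneg_left (h α β) (by positivity)
      _ = C * ((2 * H) ^ len (α + β) * M l (α + β)) := by rw [mul_pow]; ring
      _ ≤ C * (C1 * M l' (α + β)) :=
          mul_le_mul_of_nonneg_left (h1 _) (by positivity)
      _ = _ := by ring

/-- The counterpart for a second factor growing geometrically, as the derivatives of a band-limited
function do. -/
theorem WeightSequenceSystem.condwI_absorb {N : WeightSequenceSystem n} {r : Regime}
    (hL : N.CondL r) (hI : N.CondwI r) {R : ℝ} (hR : 0 < R) :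
    match r with
    | .beurling => ∀ l : RPos, ∃ m : RPos, ∃ C : ℝ, 0 < C ∧
        ∀ α β, 2 ^ len (α + β) * (N m α * R ^ len β) ≤ C * N l (α + β)
    | .roumieu => ∀ m : RPos, ∃ l : RPos, ∃ C : ℝ, 0 < C ∧
        ∀ α β, 2 ^ len (α + β) * (N m α * R ^ len β) ≤ C * N l (α + β) := by
  cases r with
  | beurling =>
    intro l
    obtain ⟨m, H, hH, h⟩ := hI l
    -- The ratio in [wI] is free, so it can absorb the factors `2 * H` belonging to `β`; those
    -- belonging to `α` are left to [L].
    obtain ⟨C, hC, h⟩ := h (2 * H * R) (by positivity)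
    obtain ⟨m', C1, hC1, h1⟩ := hL (2 * H) (by positivity) m
    refine ⟨m', C1 * C, by positivity, fun α β => ?_⟩
    have hHp : 0 < H ^ len (α + β) := by positivity
    refine le_of_mul_le_mul_left ?_ hHp
    calc H ^ len (α + β) * (2 ^ len (α + β) * (N m' α * R ^ len β))
        = (2 * H) ^ len α * N m' α * (2 * H * R) ^ len β := by
          rw [len_add, pow_add, pow_add, mul_pow, mul_pow (2 * H), mul_pow]
          ring
      _ ≤ C1 * N m α * (2 * H * R) ^ len β :=
          mul_le_mul_of_nonneg_right (h1 α) (by positivity)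
      _ = C1 * (N m α * (2 * H * R) ^ len β) := by ring
      _ ≤ C1 * (C * H ^ len (α + β) * N l (α + β)) :=
          mul_le_mul_of_nonneg_left (h α β) (by positivity)
      _ = _ := by ring
  | roumieu =>
    intro m
    obtain ⟨l, H, hH, h⟩ := hI m
    obtain ⟨C, hC, h⟩ := h R hR
    obtain ⟨l', C1, hC1, h1⟩ := hL (2 * H) (by positivity) l
    refine ⟨l', C * C1, by positivity, fun α β => ?_⟩
    calc 2 ^ len (α + β) * (N m α * R ^ len β)
        ≤ 2 ^ len (α + β) * (C * H ^ len (α + β) * N l (α + β)) :=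
          mul_le_mul_of_nonneg_left (h α β) (by positivity)
      _ = C * ((2 * H) ^ len (α + β) * N l (α + β)) := by rw [mul_pow]; ring
      _ ≤ C * (C1 * N l' (α + β)) :=
          mul_le_mul_of_nonneg_left (h1 _) (by positivity)
      _ = _ := by ring

/-! ### Sufficiency of the growth relations -/

/-- An estimate near infinity extends to all of space because `v` is bounded on compact sets and `w
≥ 1`. -/
theorem exists_le_of_isBigO {v w : WeightFunction n}
    (h : v.toFun =O[cocompact (Rn n)] w.toFun) : ∃ C : ℝ, 0 < C ∧ ∀ x, v x ≤ C * w x := by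
  obtain ⟨c, hc⟩ := h.bound
  obtain ⟨K, hK, hKs⟩ := mem_cocompact.1 hc
  obtain ⟨B, hB⟩ := hK.exists_bound_of_continuousOn v.continuous_toFun.continuousOn
  refine ⟨max 1 (max c B), by positivity, fun x => ?_⟩
  have hw := w.one_le_toFun x
  have hv := v.one_le_toFun x
  by_cases hx : x ∈ K
  · have h1 := (le_abs_self _).trans (hB x hx)
    have h2 : B ≤ max 1 (max c B) := (le_max_right _ _).trans (le_max_right _ _)
    have h3 : (1 : ℝ) ≤ max 1 (max c B) := le_max_left _ _
    nlinarith
  · have h1 : ‖v x‖ ≤ c * ‖w x‖ := hKs hx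
    rw [Real.norm_of_nonneg (by linarith), Real.norm_of_nonneg (by linarith)] at h1
    refine h1.trans ?_
    have h2 : c ≤ max 1 (max c B) := (le_max_left _ _).trans (le_max_right _ _)
    gcongr

theorem mem_norm_weightedDeriv_le (T : SolidTIBF n E) {w v : WeightFunction n} {C : ℝ}
    (hC : 0 ≤ C) (h : ∀ x, v x ≤ C * w x) {f : Rn n → ℂ} (hf : ContDiff ℝ ∞ f)
    {α : MultiIndex n} (hm : T.Mem (weightedDeriv w α f)) :
    T.Mem (weightedDeriv v α f) ∧
      T.norm (weightedDeriv v α f) ≤ C * T.norm (weightedDeriv w α f) := by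
  refine T.mem_norm_le hm (continuous_weightedDeriv v α hf).locallyIntegrable hC fun x => ?_
  rw [norm_weightedDeriv, norm_weightedDeriv]
  calc ‖mderiv α f x‖ * v x ≤ ‖mderiv α f x‖ * (C * w x) := by
        gcongr
        exact h x
    _ = _ := by ring

theorem stepSubmodule_le (T : SolidTIBF n E) {M N : WeightSequence n} {w v : WeightFunction n}
    {C₁ C₂ : ℝ} (h1 : ∀ α, M α ≤ C₁ * N α) (hC : 0 ≤ C₂) (h2 : ∀ x, v x ≤ C₂ * w x) :
    stepSubmodule T M w ≤ stepSubmodule T N v := by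
  intro f hf
  rw [mem_stepSubmodule_iff] at hf ⊢
  obtain ⟨hf, A, hA, h⟩ := hf
  have hC₁ : 0 ≤ C₁ := by
    have := h1 0
    rw [M.map_zero, N.map_zero] at this
    linarith
  refine ⟨hf, C₂ * (A * C₁), by positivity, fun α => ?_⟩
  obtain ⟨h3, h4⟩ := mem_norm_weightedDeriv_le T hC h2 hf (h α).1
  refine ⟨h3, h4.trans ?_⟩
  calc C₂ * T.norm (weightedDeriv w α f) ≤ C₂ * (A * (C₁ * N α)) := by
        gcongr
        exact (h α).2.trans (by gcongr; exact h1 α)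
    _ = _ := by ring

/-- The inclusion between two step spaces. -/
noncomputable def stepInclusion (T : SolidTIBF n E) {M N : WeightSequence n}
    {w v : WeightFunction n} (h : stepSubmodule T M w ≤ stepSubmodule T N v) :
    Step T M w →ₗ[ℂ] Step T N v :=
  Submodule.inclusion h

theorem continuous_stepInclusion (T : SolidTIBF n E) {M N : WeightSequence n}
    {w v : WeightFunction n} {C₁ C₂ : ℝ} (h1 : ∀ α, M α ≤ C₁ * N α) (hC : 0 ≤ C₂)
    (h2 : ∀ x, v x ≤ C₂ * w x) :
    Continuous (stepInclusion T (stepSubmodule_le T h1 hC h2)) := by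
  refine AddMonoidHomClass.continuous_of_bound _ (C₂ * C₁) fun f => ?_
  change (⨆ α : MultiIndex n, T.norm (weightedDeriv v α f.1) / N α) ≤
    C₂ * C₁ * ⨆ α : MultiIndex n, T.norm (weightedDeriv w α f.1) / M α
  have hC₁ : 0 ≤ C₁ := by
    have := h1 0
    rw [M.map_zero, N.map_zero] at this
    linarith
  refine ciSup_le fun α => ?_
  rw [div_le_iff₀ (N.pos α)]
  refine (mem_norm_weightedDeriv_le T hC h2 f.2.1 (f.2.2.1 α)).2.trans ?_
  have h3 := le_ciSup f.2.2.2 α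
  have h4 := (div_le_iff₀ (M.pos α)).1 h3
  set S := ⨆ α : MultiIndex n, T.norm (weightedDeriv w α f.1) / M α
  have hS : 0 ≤ S := Real.iSup_nonneg fun α => div_nonneg (T.norm_nonneg _) (M.pos α).le
  calc _ ≤ C₂ * (S * (C₁ * N α)) := by
        gcongr
        exact h4.trans (by gcongr; exact h1 α)
    _ = _ := by ring

theorem exists_continuous_inclusion_beurling (T : SolidTIBF n E) {M N : WeightSequenceSystem n}
    {W V : WeightFunctionSystem n} (hMN : M.Incl N .beurling) (hWV : W.Incl V .beurling) :
    ∃ h : beurlingSpace T M W ≤ beurlingSpace T N V,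
      Continuous[beurlingTopology T M W, beurlingTopology T N V] (Submodule.inclusion h) := by
  have key : ∀ l, ∃ (m : RPos) (C₁ C₂ : ℝ), (∀ α, M m α ≤ C₁ * N l α) ∧ 0 ≤ C₂ ∧
      ∀ x, V l x ≤ C₂ * W m x := by
    intro l
    obtain ⟨m₁, C₁, hC₁, h1⟩ := hMN l
    obtain ⟨m₂, h2⟩ := hWV l
    obtain ⟨C₂, hC₂, h2⟩ := exists_le_of_isBigO h2
    -- Lowering the index makes the sequence smaller and the weight larger, so both estimates
    -- survive at the minimum.
    refine ⟨min m₁ m₂, C₁, C₂, fun α => (M.mono _ _ (min_le_left _ _) α).trans (h1 α), hC₂.le,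
      fun x => (h2 x).trans ?_⟩
    exact mul_le_mul_of_nonneg_left (W.anti _ _ (min_le_right _ _) x) hC₂.le
  choose m C₁ C₂ h1 hC h2 using key
  refine ⟨fun f hf l => stepSubmodule_le T (h1 l) (hC l) (h2 l) (hf (m l)), ?_⟩
  refine continuous_iInf_rng.2 fun l => continuous_induced_rng.2 ?_
  refine continuous_iInf_dom (i := m l) ?_
  have h3 := @Continuous.comp _ _ _ (TopologicalSpace.induced (beurlingToStep T M W (m l)) _) _ _
    (beurlingToStep T M W (m l)) _ (continuous_stepInclusion T (h1 l) (hC l) (h2 l))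
    continuous_induced_dom
  exact h3

theorem exists_continuous_inclusion_roumieu (T : SolidTIBF n E) {M N : WeightSequenceSystem n}
    {W V : WeightFunctionSystem n} (hMN : M.Incl N .roumieu) (hWV : W.Incl V .roumieu) :
    ∃ h : roumieuSpace T M W ≤ roumieuSpace T N V,
      Continuous[roumieuTopology T M W, roumieuTopology T N V] (Submodule.inclusion h) := by
  have key : ∀ m, ∃ (l : RPos) (C₁ C₂ : ℝ), (∀ α, M m α ≤ C₁ * N l α) ∧ 0 ≤ C₂ ∧
      ∀ x, V l x ≤ C₂ * W m x := by
    intro m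
    obtain ⟨l₁, C₁, hC₁, h1⟩ := hMN m
    obtain ⟨l₂, h2⟩ := hWV m
    obtain ⟨C₂, hC₂, h2⟩ := exists_le_of_isBigO h2
    refine ⟨max l₁ l₂, C₁, C₂, fun α => (h1 α).trans ?_, hC₂.le,
      fun x => (V.anti _ _ (le_max_right _ _) x).trans (h2 x)⟩
    exact mul_le_mul_of_nonneg_left (N.mono _ _ (le_max_left _ _) α) hC₁.le
  choose l C₁ C₂ h1 hC h2 using key
  have hle : roumieuSpace T M W ≤ roumieuSpace T N V := fun f ⟨m, hf⟩ =>
    ⟨l m, stepSubmodule_le T (h1 m) (hC m) (h2 m) hf⟩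
  refine ⟨hle, ?_⟩
  -- Each admissible topology `t` on the target pulls back along the inclusion to an admissible one
  -- on the source, and the source topology is the finest of these.
  refine continuous_sInf_rng.2 fun t ⟨ht1, ht2, ht3, ht4⟩ => ?_
  rw [continuous_iff_le_induced]
  refine sInf_le ⟨?_, ?_, ?_, fun m => ?_⟩
  · exact topologicalAddGroup_induced (Submodule.inclusion hle)
  · exact continuousSMul_induced (Submodule.inclusion hle)
  · exact LocallyConvexSpace.induced ((Submodule.inclusion hle).restrictScalars ℝ)
  · refine continuous_induced_rng.2 ?_
    exact (ht4 (l m)).comp (continuous_stepInclusion T (h1 m) (hC m) (h2 m))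

theorem exists_continuous_inclusion (T : SolidTIBF n E) {M N : WeightSequenceSystem n}
    {W V : WeightFunctionSystem n} {r : Regime} (hMN : M.Incl N r) (hWV : W.Incl V r) :
    ∃ h : space T M W r ≤ space T N V r,
      Continuous[topology T M W r, topology T N V r] (Submodule.inclusion h) := by
  cases r with
  | beurling => exact exists_continuous_inclusion_beurling T hMN hWV
  | roumieu => exact exists_continuous_inclusion_roumieu T hMN hWV

/-! ### Regularization by convolution -/

/-- The derivative has to fall on `f`, since it is the derivatives of `f` that the step norm
controls. It is computed on `χ` and moved over by parts; the compact support of `χ` gives the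
integrability. -/
theorem pderiv_convolution {f χ : Rn n → ℂ} (hf : ContDiff ℝ ∞ f) (hχ : ContDiff ℝ ∞ χ)
    (hs : HasCompactSupport χ) (i : Fin n) :
    pderiv i (f ⋆[ContinuousLinearMap.mul ℂ ℂ, volume] χ) =
      (pderiv i f ⋆[ContinuousLinearMap.mul ℂ ℂ, volume] χ) := by
  funext x
  have hfl : LocallyIntegrable f volume := hf.continuous.locallyIntegrable
  have hf' : LocallyIntegrable (pderiv i f) volume :=
    (contDiff_pderiv i hf).continuous.locallyIntegrable
  have hχ' : Continuous (pderiv i χ) := (contDiff_pderiv i hχ).continuous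
  have hs' : HasCompactSupport (pderiv i χ) := hs.fderiv_apply ℝ _
  set e : Rn n := EuclideanSpace.single i 1 with he
  have h1 := ((hs.hasFDerivAt_convolution_right
    ((ContinuousLinearMap.mul ℝ ℂ)) hfl (hχ.of_le (by exact_mod_cast le_top)) x)).fderiv
  have h2 : pderiv i (f ⋆[ContinuousLinearMap.mul ℂ ℂ, volume] χ) x =
      (f ⋆[ContinuousLinearMap.mul ℝ ℂ, volume] pderiv i χ) x := by
    have h3 := convolution_precompR_apply (ContinuousLinearMap.mul ℝ ℂ) (μ := volume) hfl
      (hs.fderiv ℝ) (hχ.continuous_fderiv (by simp)) x e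
    rw [← h1] at h3
    exact h3
  rw [h2, convolution_def, convolution_def]
  have hu : ∀ t, fderiv ℝ (fun t => χ (x - t)) t e = - pderiv i χ (x - t) := by
    intro t
    have h5 := (((hχ.differentiable (by simp)) (x - t)).hasFDerivAt.comp t
      ((hasFDerivAt_id t).const_sub x)).fderiv
    change fderiv ℝ (fun t => χ (x - t)) t = _ at h5
    rw [h5]
    simp [pderiv, he]
  have i1 : Integrable fun t => f t * pderiv i χ (x - t) :=
    hs'.convolutionExists_right (ContinuousLinearMap.mul ℝ ℂ) hfl hχ' x
  have i2 : Integrable fun t => pderiv i f t * χ (x - t) :=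
    hs.convolutionExists_right (ContinuousLinearMap.mul ℝ ℂ) hf' hχ.continuous x
  have i3 : Integrable fun t => f t * χ (x - t) :=
    hs.convolutionExists_right (ContinuousLinearMap.mul ℝ ℂ) hfl hχ.continuous x
  have hd : Differentiable ℝ fun t => χ (x - t) :=
    (hχ.differentiable (by simp)).comp (differentiable_id.const_sub x)
  have h4 := integral_mul_fderiv_eq_neg_fderiv_mul_of_integrable (μ := volume) (f := f)
    (g := fun t => χ (x - t)) (v := e) i2 (by
      simp only [hu, mul_neg]
      exact i1.neg) i3
    (fun y _ => (hf.differentiable (by simp)) y) (fun y _ => hd y)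
  simp only [hu, mul_neg, integral_neg, neg_inj] at h4
  exact h4

theorem contDiff_convolution {f χ : Rn n → ℂ} (hf : ContDiff ℝ ∞ f) (hχ : ContDiff ℝ ∞ χ)
    (hs : HasCompactSupport χ) :
    ContDiff ℝ ∞ (f ⋆[ContinuousLinearMap.mul ℂ ℂ, volume] χ) :=
  hs.contDiff_convolution_right (n := ⊤) (ContinuousLinearMap.mul ℝ ℂ)
    hf.continuous.locallyIntegrable hχ

theorem mderiv_convolution {f χ : Rn n → ℂ} (hf : ContDiff ℝ ∞ f) (hχ : ContDiff ℝ ∞ χ)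
    (hs : HasCompactSupport χ) (α : MultiIndex n) :
    mderiv α (f ⋆[ContinuousLinearMap.mul ℂ ℂ, volume] χ) =
      (mderiv α f ⋆[ContinuousLinearMap.mul ℂ ℂ, volume] χ) := by
  induction α using multiIndex_induction with
  | h0 => rw [mderiv_zero_index, mderiv_zero_index]
  | h1 α i ih =>
    rw [mderiv_add_single _ _ (contDiff_convolution hf hχ hs), ih, mderiv_add_single _ _ hf,
      pderiv_convolution (contDiff_mderiv α hf) hχ hs]

/-- Under the integral the weight is split along `x = (x - t) + t`: `w₂` goes to the kernel and `w₃`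
to `h`. -/
theorem norm_convolution_mul_le {h χ : Rn n → ℂ} (hh : Continuous h) (hχ : Continuous χ)
    (hs : HasCompactSupport χ) {w₁ w₂ w₃ : WeightFunction n} {C : ℝ} (hC : 0 ≤ C)
    (hw : ∀ x y, w₁ (x + y) ≤ C * w₂ x * w₃ y) (x : Rn n) :
    ‖(h ⋆[ContinuousLinearMap.mul ℂ ℂ, volume] χ) x‖ * w₁ x ≤
      C * ‖((fun t => ((‖h t‖ * w₃ t : ℝ) : ℂ)) ⋆[ContinuousLinearMap.mul ℂ ℂ, volume]
        (fun t => ((‖χ t‖ * w₂ t : ℝ) : ℂ))) x‖ := by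
  have c1 : Continuous fun t => ((‖h t‖ * w₃ t : ℝ) : ℂ) :=
    Complex.continuous_ofReal.comp (hh.norm.mul w₃.continuous_toFun)
  have c2 : Continuous fun t => ((‖χ t‖ * w₂ t : ℝ) : ℂ) :=
    Complex.continuous_ofReal.comp (hχ.norm.mul w₂.continuous_toFun)
  have s2 : HasCompactSupport fun t => ((‖χ t‖ * w₂ t : ℝ) : ℂ) := by
    refine hs.mono fun t ht => ?_
    simp only [Function.mem_support] at ht ⊢
    intro h0
    simp [h0] at ht
  have i1 := s2.convolutionExists_right (ContinuousLinearMap.mul ℂ ℂ)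
    (μ := volume) c1.locallyIntegrable c2 x
  rw [convolution_def, convolution_def]
  have i2 : Integrable fun t => (‖h t‖ * w₃ t) * (‖χ (x - t)‖ * w₂ (x - t)) := by
    have h1 := i1.norm
    refine h1.congr (Eventually.of_forall fun t => ?_)
    have := w₃.one_le_toFun t
    have := w₂.one_le_toFun (x - t)
    simp only [ContinuousLinearMap.mul_apply', norm_mul, Complex.norm_real]
    rw [Real.norm_of_nonneg (by positivity), Real.norm_of_nonneg (by linarith),
      Real.norm_of_nonneg (by positivity), Real.norm_of_nonneg (by linarith)]
  have h1 : ∫ t, (ContinuousLinearMap.mul ℂ ℂ) ((‖h t‖ * w₃ t : ℝ) : ℂ)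
      ((‖χ (x - t)‖ * w₂ (x - t) : ℝ) : ℂ) =
      ((∫ t, (‖h t‖ * w₃ t) * (‖χ (x - t)‖ * w₂ (x - t)) : ℝ) : ℂ) := by
    rw [← integral_complex_ofReal]
    refine integral_congr_ae (Eventually.of_forall fun t => ?_)
    simp only [ContinuousLinearMap.mul_apply', Complex.ofReal_mul]
  rw [h1, Complex.norm_real]
  have hw1 : 0 ≤ w₁ x := by linarith [w₁.one_le_toFun x]
  calc ‖∫ t, (ContinuousLinearMap.mul ℂ ℂ) (h t) (χ (x - t))‖ * w₁ x
      ≤ (∫ t, ‖h t‖ * ‖χ (x - t)‖) * w₁ x := by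
        refine mul_le_mul_of_nonneg_right ?_ hw1
        refine (norm_integral_le_integral_norm _).trans_eq ?_
        refine integral_congr_ae (Eventually.of_forall fun t => ?_)
        simp only [ContinuousLinearMap.mul_apply', norm_mul]
    _ = ∫ t, ‖h t‖ * ‖χ (x - t)‖ * w₁ x := (integral_mul_const _ _).symm
    _ ≤ ∫ t, C * ((‖h t‖ * w₃ t) * (‖χ (x - t)‖ * w₂ (x - t))) := by
        refine integral_mono_of_nonneg (Eventually.of_forall fun t => by positivity)
          (i2.const_mul C) (Eventually.of_forall fun t => ?_)
        have h2 := hw (x - t) t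
        rw [sub_add_cancel] at h2
        calc ‖h t‖ * ‖χ (x - t)‖ * w₁ x
            ≤ ‖h t‖ * ‖χ (x - t)‖ * (C * w₂ (x - t) * w₃ t) := by gcongr
          _ = _ := by ring
    _ = C * ∫ t, (‖h t‖ * w₃ t) * (‖χ (x - t)‖ * w₂ (x - t)) := integral_const_mul _ _
    _ ≤ _ := by
        gcongr
        exact le_abs_self _

/-- The kernel `|χ| w₂` is again continuous with compact support, so `exists_convolution_bound`
applies with a constant independent of `f` and `α`. -/
theorem exists_weightedDeriv_convolution_bound (T : SolidTIBF n E) {χ : Rn n → ℂ}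
    (hχ : ContDiff ℝ ∞ χ) (hs : HasCompactSupport χ) {w₁ w₂ w₃ : WeightFunction n} {C : ℝ}
    (hC : 0 ≤ C) (hw : ∀ x y, w₁ (x + y) ≤ C * w₂ x * w₃ y) :
    ∃ K : ℝ, 0 ≤ K ∧ ∀ (f : Rn n → ℂ) (α : MultiIndex n), ContDiff ℝ ∞ f →
      T.Mem (weightedDeriv w₃ α f) →
      T.Mem (weightedDeriv w₁ α (f ⋆[ContinuousLinearMap.mul ℂ ℂ, volume] χ)) ∧
      T.norm (weightedDeriv w₁ α (f ⋆[ContinuousLinearMap.mul ℂ ℂ, volume] χ)) ≤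
        K * T.norm (weightedDeriv w₃ α f) := by
  have c2 : Continuous fun t => ((‖χ t‖ * w₂ t : ℝ) : ℂ) :=
    Complex.continuous_ofReal.comp (hχ.continuous.norm.mul w₂.continuous_toFun)
  have s2 : HasCompactSupport fun t => ((‖χ t‖ * w₂ t : ℝ) : ℂ) := by
    refine hs.mono fun t ht => ?_
    simp only [Function.mem_support] at ht ⊢
    intro h0
    simp [h0] at ht
  obtain ⟨K, hK, h⟩ := T.exists_convolution_bound c2 s2
  refine ⟨C * K, by positivity, fun f α hf hm => ?_⟩
  have hc := (contDiff_mderiv α hf).continuous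
  have c1 : Continuous fun t => ((‖mderiv α f t‖ * w₃ t : ℝ) : ℂ) :=
    Complex.continuous_ofReal.comp (hc.norm.mul w₃.continuous_toFun)
  obtain ⟨m1, n1⟩ := T.mem_norm_mono hm c1 fun x => by
    rw [norm_weightedDeriv, Complex.norm_real, Real.norm_of_nonneg]
    have := w₃.one_le_toFun x
    positivity
  obtain ⟨m2, n2⟩ := h _ m1
  obtain ⟨m3, n3⟩ := T.mem_norm_le m2
    (continuous_weightedDeriv w₁ α (contDiff_convolution hf hχ hs)).locallyIntegrable hC
    fun x => by
      rw [norm_weightedDeriv, mderiv_convolution hf hχ hs]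
      exact norm_convolution_mul_le hc hχ.continuous hs hC hw x
  refine ⟨m3, n3.trans ?_⟩
  rw [mul_assoc]
  gcongr
  exact n2.trans (by gcongr)

theorem stepSubmodule_mono' (T : SolidTIBF n E) (M : WeightSequenceSystem n)
    (W : WeightFunctionSystem n) {a b c d : RPos} (h : a ≤ c) (h' : b ≤ d) :
    stepSubmodule T (M a) (W b) ≤ stepSubmodule T (M c) (W d) :=
  stepSubmodule_le T (C₁ := 1) (C₂ := 1) (fun α => by simpa using M.mono a c h α) zero_le_one
    fun x => by simpa using W.anti d b h' x

/-- Decouples the two indices, which share one parameter in the definition of the space;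
`step_le_roumieuSpace` is the dual statement. -/
theorem beurlingSpace_le_step (T : SolidTIBF n E) (M : WeightSequenceSystem n)
    (W : WeightFunctionSystem n) (a b : RPos) :
    beurlingSpace T M W ≤ stepSubmodule T (M a) (W b) := fun _ hf =>
  stepSubmodule_mono' T M W (min_le_left a b) (min_le_right a b) (hf (min a b))

theorem step_le_roumieuSpace (T : SolidTIBF n E) (M : WeightSequenceSystem n)
    (W : WeightFunctionSystem n) (a b : RPos) :
    stepSubmodule T (M a) (W b) ≤ roumieuSpace T M W := fun _ hf =>
  ⟨max a b, stepSubmodule_mono' T M W (le_max_left a b) (le_max_right a b) hf⟩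

theorem convolution_mem_space (T : SolidTIBF n E) {M : WeightSequenceSystem n}
    {W : WeightFunctionSystem n} {r : Regime} (hW : W.CondM r) {χ : Rn n → ℂ}
    (hχ : ContDiff ℝ ∞ χ) (hs : HasCompactSupport χ) {f : Rn n → ℂ} (hf : f ∈ space T M W r) :
    (f ⋆[ContinuousLinearMap.mul ℂ ℂ, volume] χ) ∈ space T M W r := by
  have key : ∀ {M' : WeightSequence n} {w₁ w₂ w₃ : WeightFunction n} {C : ℝ}, 0 ≤ C →
      (∀ x y, w₁ (x + y) ≤ C * w₂ x * w₃ y) → f ∈ stepSubmodule T M' w₃ →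
      (f ⋆[ContinuousLinearMap.mul ℂ ℂ, volume] χ) ∈ stepSubmodule T M' w₁ := by
    intro M' w₁ w₂ w₃ C hC hw hf
    rw [mem_stepSubmodule_iff] at hf ⊢
    obtain ⟨hf, A, hA, h⟩ := hf
    obtain ⟨K, hK, h'⟩ := exists_weightedDeriv_convolution_bound T hχ hs hC hw
    refine ⟨contDiff_convolution hf hχ hs, K * A, by positivity, fun α => ?_⟩
    obtain ⟨h1, h2⟩ := h' f α hf (h α).1
    refine ⟨h1, h2.trans ?_⟩
    rw [mul_assoc]
    exact mul_le_mul_of_nonneg_left (h α).2 hK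
  cases r with
  | beurling =>
    intro l
    obtain ⟨m, k, C, hC, h⟩ := hW l
    exact key hC.le h (beurlingSpace_le_step T M W l k hf)
  | roumieu =>
    obtain ⟨m, hf⟩ := hf
    obtain ⟨l, C, hC, h⟩ := hW m m
    exact step_le_roumieuSpace T M W m l (key hC.le h hf)

theorem contDiff_of_mem_space (T : SolidTIBF n E) {M : WeightSequenceSystem n}
    {W : WeightFunctionSystem n} {r : Regime} {f : Rn n → ℂ} (hf : f ∈ space T M W r) :
    ContDiff ℝ ∞ f ∧ ∀ α, T.Mem (mderiv α f) := by
  have key : ∀ {M' : WeightSequence n} {w : WeightFunction n}, f ∈ stepSubmodule T M' w →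
      ContDiff ℝ ∞ f ∧ ∀ α, T.Mem (mderiv α f) := fun {_ w} hf =>
    ⟨hf.1, fun α => (T.mem_norm_mono (hf.2.1 α) (contDiff_mderiv α hf.1).continuous fun x => by
      rw [norm_weightedDeriv]
      exact le_mul_of_one_le_right (norm_nonneg _) (w.one_le_toFun x)).1⟩
  cases r with
  | beurling => exact key (hf ⟨1, one_pos⟩)
  | roumieu =>
    obtain ⟨m, hf⟩ := hf
    exact key hf

/-- A non-trivial space contains a function with bounded derivatives that does not vanish at the
origin. -/
theorem exists_bounded_mem_space (T : SolidTIBF n E) {M : WeightSequenceSystem n}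
    {W : WeightFunctionSystem n} {r : Regime} (hW : W.CondM r) (hne : space T M W r ≠ ⊥) :
    ∃ f ∈ space T M W r, f 0 ≠ 0 ∧ ∃ D : MultiIndex n → ℝ, ∀ α x, ‖mderiv α f x‖ ≤ D α := by
  obtain ⟨f, hf, hf0⟩ := (Submodule.ne_bot_iff _).1 hne
  obtain ⟨hfs, hfm⟩ := contDiff_of_mem_space T hf
  obtain ⟨g, hg, hgs, hgf⟩ : ∃ g : Rn n → ℝ, ContDiff ℝ ∞ g ∧ HasCompactSupport g ∧
      ∫ x, g x • f x ≠ 0 := by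
    by_contra! h
    refine hf0 ?_
    have h1 := ae_eq_zero_of_integral_contDiff_smul_eq_zero
      hfs.continuous.locallyIntegrable h
    exact (hfs.continuous.ae_eq_iff_eq volume continuous_const).1 h1
  -- With the reflected test function, the value of the convolution at the origin is the non-zero
  -- integral of `g f`.
  let χ : Rn n → ℂ := fun x => (g (-x) : ℂ)
  have hχ : ContDiff ℝ ∞ χ := Complex.ofRealCLM.contDiff.comp (hg.comp contDiff_neg)
  have hχs : HasCompactSupport χ :=
    (hgs.comp_homeomorph (Homeomorph.neg (Rn n))).comp_left (g := ((↑) : ℝ → ℂ)) (by simp)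
  refine ⟨_, convolution_mem_space T hW hχ hχs hf, ?_, ?_⟩
  · rw [convolution_def]
    convert hgf using 1
    refine integral_congr_ae (Eventually.of_forall fun t => ?_)
    simp [χ, mul_comm]
  · obtain ⟨C, hC, h⟩ := T.exists_norm_convolution_apply_le hχ.continuous hχs
    refine ⟨fun α => C * T.norm (mderiv α f), fun α x => ?_⟩
    rw [mderiv_convolution hfs hχ hχs]
    exact h _ (hfm α) x

/-! ### Necessity of the relation between the weight functions -/

theorem exists_weightedDeriv_translate_bound (T : SolidTIBF n E) :
    ∃ K : ℝ, 0 < K ∧ ∀ (w₁ w₂ w₃ : WeightFunction n) (C : ℝ), 0 ≤ C →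
      (∀ x y, w₁ (x + y) ≤ C * w₂ x * w₃ y) → ∀ (f : Rn n → ℂ), ContDiff ℝ ∞ f →
      ∀ (α : MultiIndex n) (a : Rn n), T.Mem (weightedDeriv w₃ α f) →
      T.Mem (weightedDeriv w₁ α fun x => f (x - a)) ∧
      T.norm (weightedDeriv w₁ α fun x => f (x - a)) ≤
        C * w₂ a * (K * T.norm (weightedDeriv w₃ α f)) := by
  obtain ⟨K, hK, h⟩ := T.exists_translate_bound
  refine ⟨K, hK, fun w₁ w₂ w₃ C hC hw f hf α a hm => ?_⟩
  obtain ⟨m1, n1⟩ := h a _ hm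
  have hfa : ContDiff ℝ ∞ fun x => f (x - a) := hf.comp (contDiff_id.sub contDiff_const)
  have hw2 : 0 ≤ w₂ a := by linarith [w₂.one_le_toFun a]
  obtain ⟨m2, n2⟩ := T.mem_norm_le m1 (continuous_weightedDeriv w₁ α hfa).locallyIntegrable
    (mul_nonneg hC hw2) fun x => by
      rw [norm_weightedDeriv, norm_weightedDeriv, mderiv_comp_sub α a hf]
      have h2 := hw a (x - a)
      rw [add_sub_cancel] at h2
      calc ‖mderiv α f (x - a)‖ * w₁ x ≤ ‖mderiv α f (x - a)‖ * (C * w₂ a * w₃ (x - a)) := by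
            gcongr
        _ = _ := by ring
  exact ⟨m2, n2.trans (mul_le_mul_of_nonneg_left n1 (mul_nonneg hC hw2))⟩

/-- Near `a` the weight `v` is at least `v' a / C`. Hence the weighted translate dominates `v' a /
C` times the translate of a fixed non-zero piece of `f`. -/
theorem exists_weight_le_norm_translate (T : SolidTIBF n E) {v v' : WeightFunction n} {C : ℝ}
    (hC : 0 < C) (h : ∀ x, ∀ y ∈ Metric.ball (0 : Rn n) 1, v' (x + y) ≤ C * v x)
    {f : Rn n → ℂ} (hf : ContDiff ℝ ∞ f) (hm : T.Mem f) (hf0 : f 0 ≠ 0) :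
    ∃ K : ℝ, 0 < K ∧ ∀ a, T.Mem (weightedDeriv v 0 fun x => f (x - a)) →
      v' a ≤ K * T.norm (weightedDeriv v 0 fun x => f (x - a)) := by
  -- A continuous cut-off of `f` that vanishes outside the unit ball; its norm is positive since `f
  -- 0 ≠ 0`.
  let F : Rn n → ℂ := fun x => f x * (max 0 (1 - ‖x‖) : ℝ)
  have hF : Continuous F := hf.continuous.mul (Complex.continuous_ofReal.comp
    (continuous_const.max (continuous_const.sub continuous_norm)))
  have hnF : ∀ x, ‖F x‖ = ‖f x‖ * max 0 (1 - ‖x‖) := fun x => by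
    simp only [F, norm_mul, Complex.norm_real]
    rw [Real.norm_of_nonneg (le_max_left _ _)]
  obtain ⟨mF, -⟩ := T.mem_norm_mono hm hF fun x => by
    rw [hnF]
    exact mul_le_of_le_one_right (norm_nonneg _)
      (max_le zero_le_one (by linarith [norm_nonneg x]))
  have hF0 : T.norm F ≠ 0 := fun h0 => by
    have h1 := (hF.ae_eq_iff_eq volume continuous_const).1 (T.ae_eq_zero mF h0)
    have h2 := congrFun h1 0
    simp [F, hf0] at h2
  have hFpos : 0 < T.norm F := lt_of_le_of_ne (T.norm_nonneg F) (Ne.symm hF0)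
  obtain ⟨K, hK, hT⟩ := T.exists_translate_bound
  refine ⟨C * K / T.norm F, by positivity, fun a ha => ?_⟩
  have hv' : 0 < v' a := by linarith [v'.one_le_toFun a]
  obtain ⟨mFa, -⟩ := hT a F mF
  have h1 : ∀ x, ‖F (x - a)‖ ≤ C / v' a * ‖weightedDeriv v 0 (fun x => f (x - a)) x‖ := by
    intro x
    rw [norm_weightedDeriv, mderiv_zero_index, hnF, div_mul_eq_mul_div, le_div_iff₀ hv']
    by_cases hx : ‖x - a‖ < 1
    · have h2 := h x (a - x) (by rwa [mem_ball_zero_iff, norm_sub_rev])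
      rw [add_sub_cancel] at h2
      have h3 : max 0 (1 - ‖x - a‖) ≤ 1 :=
        max_le zero_le_one (by linarith [norm_nonneg (x - a)])
      calc ‖f (x - a)‖ * max 0 (1 - ‖x - a‖) * v' a ≤ ‖f (x - a)‖ * 1 * (C * v x) := by gcongr
        _ = _ := by ring
    · rw [max_eq_left (by linarith), mul_zero, zero_mul]
      have := v.one_le_toFun x
      positivity
  obtain ⟨-, n1⟩ := T.mem_norm_le ha
    (hF.comp (continuous_id.sub continuous_const)).locallyIntegrable (by positivity) h1
  -- Translations are bounded but need not be isometric, so `F` is translated back to bound its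
  -- fixed norm from above.
  obtain ⟨-, n2⟩ := hT (-a) _ mFa
  simp only [sub_neg_eq_add, add_sub_cancel_right] at n2
  have h4 := n2.trans (mul_le_mul_of_nonneg_left n1 hK.le)
  set S := T.norm (weightedDeriv v 0 fun x => f (x - a))
  rw [div_mul_eq_mul_div, le_div_iff₀ hFpos]
  have h5 : K * (C / v' a * S) = K * C * S / v' a := by ring
  change T.norm F ≤ K * (C / v' a * S) at h4
  rw [h5, le_div_iff₀ hv'] at h4
  linarith

/-- The sup bounds `hD` give smoothness and termwise differentiation; the bounds in `E`, uniform in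
`k`, give absolute convergence of each weighted derivative. -/
theorem series_mem_stepSubmodule (T : SolidTIBF n E) {M : WeightSequence n} {w : WeightFunction n}
    {g : ℕ → Rn n → ℂ} (hg : ∀ k, ContDiff ℝ ∞ (g k)) {D : MultiIndex n → ℝ}
    (hD : ∀ α k x, ‖mderiv α (g k) x‖ ≤ D α) {B : ℝ}
    (h : ∀ k α, T.Mem (weightedDeriv w α (g k)) ∧ T.norm (weightedDeriv w α (g k)) ≤ B * M α)
    (c : BoundedContinuousFunction ℕ ℂ) : series g c ∈ stepSubmodule T M w := by
  obtain ⟨hs, hd⟩ := contDiff_series_and_mderiv_series hg hD c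
  have hB : 0 ≤ B := by
    have h1 := (T.norm_nonneg _).trans (h 0 0).2
    rwa [M.map_zero, mul_one] at h1
  rw [mem_stepSubmodule_iff]
  refine ⟨hs, 2 * (‖c‖ * B), by positivity, fun α => ?_⟩
  have h1 := fun k => T.mem_norm_smul (c k * (1 / 2) ^ k) (h k α).1
  obtain ⟨m1, n1⟩ := T.mem_norm_of_hasSum
    (h := fun k x => c k * (1 / 2) ^ k * weightedDeriv w α (g k) x)
    (summable_series_bound (‖c‖ * (B * M α))) (fun k => (h1 k).1) (fun k => by
      rw [(h1 k).2, norm_mul]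
      have h2 : ‖((1 / 2 : ℂ)) ^ k‖ = (1 / 2 : ℝ) ^ k := by simp
      rw [h2]
      calc ‖c k‖ * (1 / 2) ^ k * T.norm (weightedDeriv w α (g k))
          ≤ ‖c‖ * (1 / 2) ^ k * (B * M α) := by
            have := T.norm_nonneg (weightedDeriv w α (g k))
            gcongr
            · exact c.norm_coe_le_norm k
            · exact (h k α).2
        _ = _ := by ring) (u := weightedDeriv w α (series g c)) (fun x => by
      have h3 := ((summable_series_term c fun k => hD α k x).hasSum).mul_right (w x : ℂ)
      rw [weightedDeriv, hd]
      simpa only [weightedDeriv, mul_assoc, series] using h3)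
  refine ⟨m1, n1.trans ?_⟩
  rw [tsum_mul_left, tsum_geometric_of_lt_one (by norm_num) (by norm_num)]
  apply le_of_eq
  ring

/-! ### Series of weighted translates -/

theorem mderiv_const_mul (c : ℂ) {f : Rn n → ℂ} (hf : ContDiff ℝ ∞ f) (α : MultiIndex n) :
    mderiv α (fun x => c * f x) = fun x => c * mderiv α f x :=
  mderiv_smul α c hf

theorem weightedDeriv_const_mul (w : WeightFunction n) (c : ℂ) {f : Rn n → ℂ}
    (hf : ContDiff ℝ ∞ f) (α : MultiIndex n) :
    weightedDeriv w α (fun x => c * f x) = fun x => c * weightedDeriv w α f x :=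
  weightedDeriv_smul w α c hf

/-- Uniform bounds on the members of a sequence all of whose series belong to a countable union
of step spaces. -/
theorem exists_uniform_series_bound (T : SolidTIBF n E) {g : ℕ → Rn n → ℂ}
    (A : BoundedContinuousFunction ℕ ℂ →ₗ[ℂ] (Rn n → ℂ)) (hA : ∀ c, ContDiff ℝ ∞ (A c))
    (hc : ∀ α x, Continuous fun c => mderiv α (A c) x) (hg : ∀ k, ContDiff ℝ ∞ (g k))
    (hAg : ∀ k, A (unitSeq k) = (1 / 2 : ℂ) ^ k • g k)
    (N : ℕ → WeightSequence n) (v : ℕ → WeightFunction n)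
    (h : ∀ c, ∃ j, A c ∈ stepSubmodule T (N j) (v j)) :
    ∃ (j : ℕ) (C : ℝ), 0 ≤ C ∧ ∀ k α, T.Mem (weightedDeriv (v j) α (g k)) ∧
      T.norm (weightedDeriv (v j) α (g k)) ≤ C * 2 ^ k * N j α := by
  obtain ⟨j, C, hC, h1⟩ := exists_uniform_step_bound T A hA hc N v h
  refine ⟨j, C, hC, fun k α => ?_⟩
  obtain ⟨m1, n1⟩ := h1 (unitSeq k) α
  -- The `k`-th unit sequence produces `2⁻ᵏ g_k`; undoing this scaling costs `2 ^ k`.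
  have h2 : weightedDeriv (v j) α (g k) =
      fun x => (2 : ℂ) ^ k * weightedDeriv (v j) α (A (unitSeq k)) x := by
    rw [hAg, weightedDeriv_smul _ _ _ (hg k)]
    funext x
    rw [← mul_assoc, ← mul_pow]
    norm_num
  obtain ⟨m2, n2⟩ := T.mem_norm_smul ((2 : ℂ) ^ k) m1
  rw [h2]
  refine ⟨m2, ?_⟩
  rw [n2]
  have h3 : ‖(2 : ℂ) ^ k‖ = 2 ^ k := by simp
  rw [h3]
  have h4 : C * ‖unitSeq k‖ ≤ C := mul_le_of_le_one_right hC (norm_unitSeq_le k)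
  calc _ ≤ (2 : ℝ) ^ k * (C * N j α) := by
        gcongr
        exact n1.trans (mul_le_mul_of_nonneg_right h4 ((N j).pos α).le)
    _ = _ := by ring

/-- The weighted translates `w_k(x_k)⁻¹ T_{x_k} f`. -/
noncomputable def weightedTranslate (f : Rn n → ℂ) (w : ℕ → WeightFunction n) (x : ℕ → Rn n)
    (k : ℕ) (t : Rn n) : ℂ :=
  ((w k (x k) : ℂ))⁻¹ * f (t - x k)

theorem contDiff_translate {f : Rn n → ℂ} (hf : ContDiff ℝ ∞ f) (a : Rn n) :
    ContDiff ℝ ∞ fun x => f (x - a) :=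
  hf.comp (contDiff_id.sub contDiff_const)

theorem contDiff_weightedTranslate {f : Rn n → ℂ} (hf : ContDiff ℝ ∞ f)
    (w : ℕ → WeightFunction n) (x : ℕ → Rn n) (k : ℕ) :
    ContDiff ℝ ∞ (weightedTranslate f w x k) :=
  contDiff_const.mul (contDiff_translate hf _)

theorem norm_inv_weight (w : WeightFunction n) (x : Rn n) : ‖((w x : ℂ))⁻¹‖ = (w x)⁻¹ := by
  have := w.one_le_toFun x
  rw [norm_inv, Complex.norm_real, Real.norm_of_nonneg (by linarith)]

theorem norm_mderiv_weightedTranslate_le {f : Rn n → ℂ} (hf : ContDiff ℝ ∞ f)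
    {D : MultiIndex n → ℝ} (hD : ∀ α x, ‖mderiv α f x‖ ≤ D α) (w : ℕ → WeightFunction n)
    (x : ℕ → Rn n) (α : MultiIndex n) (k : ℕ) (t : Rn n) :
    ‖mderiv α (weightedTranslate f w x k) t‖ ≤ D α := by
  unfold weightedTranslate
  rw [mderiv_const_mul _ (contDiff_translate hf _), mderiv_comp_sub _ _ hf, norm_mul,
    norm_inv_weight]
  have h1 := (w k).one_le_toFun (x k)
  refine (mul_le_of_le_one_left (norm_nonneg _) (inv_le_one_of_one_le₀ h1)).trans (hD _ _)

theorem exists_translate_bound_of_series_mem (T : SolidTIBF n E) {f : Rn n → ℂ}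
    (hf : ContDiff ℝ ∞ f) {D : MultiIndex n → ℝ} (hD : ∀ α x, ‖mderiv α f x‖ ≤ D α)
    (w : ℕ → WeightFunction n) (x : ℕ → Rn n)
    (N : ℕ → WeightSequence n) (v : ℕ → WeightFunction n)
    (h : ∀ c, ∃ j, series (weightedTranslate f w x) c ∈ stepSubmodule T (N j) (v j)) :
    ∃ (j : ℕ) (C : ℝ), 0 ≤ C ∧ ∀ k, T.Mem (weightedDeriv (v j) 0 fun t => f (t - x k)) ∧
      T.norm (weightedDeriv (v j) 0 fun t => f (t - x k)) ≤ C * 2 ^ k * w k (x k) := by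
  have hg := contDiff_weightedTranslate hf w x
  have hgD := norm_mderiv_weightedTranslate_le hf hD w x
  have hD0 : ∀ k t, ‖weightedTranslate f w x k t‖ ≤ D 0 := fun k t => by
    simpa only [mderiv_zero_index] using hgD 0 k t
  obtain ⟨j, C, hC, h1⟩ := exists_uniform_series_bound T (g := weightedTranslate f w x)
    (seriesMap _ hD0)
    (fun c => (contDiff_series_and_mderiv_series hg hgD c).1) (fun α y => by
      have h2 : ∀ c, mderiv α (seriesMap _ hD0 c) y =
        series (fun k => mderiv α (weightedTranslate f w x k)) c y := fun c =>
          congrFun ((contDiff_series_and_mderiv_series hg hgD c).2 α) y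
      simp only [h2]
      exact continuous_series_apply (fun k t => hgD α k t) y) hg
    (fun k => series_unitSeq _ k) N v h
  refine ⟨j, C, hC, fun k => ?_⟩
  obtain ⟨m1, n1⟩ := h1 k 0
  have hw := (w k).one_le_toFun (x k)
  have hw0 : (w k (x k) : ℂ) ≠ 0 := by exact_mod_cast (by linarith : w k (x k) ≠ 0)
  obtain ⟨m2, n2⟩ := T.mem_norm_smul (w k (x k) : ℂ) m1
  have h3 : (fun t => (w k (x k) : ℂ) * weightedDeriv (v j) 0 (weightedTranslate f w x k) t) =
      weightedDeriv (v j) 0 fun t => f (t - x k) := by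
    unfold weightedTranslate
    rw [weightedDeriv_const_mul _ _ (contDiff_translate hf _)]
    funext t
    rw [mul_inv_cancel_left₀ hw0]
  rw [h3] at m2 n2
  refine ⟨m2, ?_⟩
  rw [n2, Complex.norm_real, Real.norm_of_nonneg (by linarith), mul_comm]
  rw [(N j).map_zero, mul_one] at n1
  gcongr

theorem weightedTranslate_bound (T : SolidTIBF n E) {K : ℝ} {M : WeightSequence n}
    {w₁ w₂ w₃ : WeightFunction n} {C : ℝ} {f : Rn n → ℂ} (hf : ContDiff ℝ ∞ f)
    (hK : ∀ (α : MultiIndex n) (a : Rn n), T.Mem (weightedDeriv w₃ α f) →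
      T.Mem (weightedDeriv w₁ α fun x => f (x - a)) ∧
      T.norm (weightedDeriv w₁ α fun x => f (x - a)) ≤
        C * w₂ a * (K * T.norm (weightedDeriv w₃ α f)))
    (hC : 0 ≤ C) (hK0 : 0 ≤ K) {A : ℝ}
    (hA : ∀ α, T.Mem (weightedDeriv w₃ α f) ∧ T.norm (weightedDeriv w₃ α f) ≤ A * M α)
    (w : ℕ → WeightFunction n) (x : ℕ → Rn n) {k : ℕ} {B : ℝ} (hB : w₂ (x k) ≤ B * w k (x k))
    (α : MultiIndex n) :
    T.Mem (weightedDeriv w₁ α (weightedTranslate f w x k)) ∧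
      T.norm (weightedDeriv w₁ α (weightedTranslate f w x k)) ≤ C * K * A * B * M α := by
  obtain ⟨m1, n1⟩ := hK α (x k) (hA α).1
  obtain ⟨m2, n2⟩ := T.mem_norm_smul ((w k (x k) : ℂ)⁻¹) m1
  unfold weightedTranslate
  rw [weightedDeriv_const_mul _ _ (contDiff_translate hf _)]
  refine ⟨m2, ?_⟩
  have hw := (w k).one_le_toFun (x k)
  have hw2 := w₂.one_le_toFun (x k)
  rw [n2, norm_inv_weight, inv_mul_le_iff₀ (by linarith)]
  have hAM : 0 ≤ A * M α := (T.norm_nonneg _).trans (hA α).2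
  calc _ ≤ C * w₂ (x k) * (K * (A * M α)) := by
        refine n1.trans ?_
        have := (hA α).2
        gcongr
    _ ≤ C * (B * w k (x k)) * (K * (A * M α)) := by gcongr
    _ = _ := by ring

/-! ### Countable parameter families and the relation between the weights -/

/-- The positive number `1 / (k + 1)`. -/
noncomputable def invSucc (k : ℕ) : RPos := ⟨1 / ((k : ℝ) + 1), by positivity⟩

theorem exists_invSucc_le (l : RPos) : ∃ K : ℕ, ∀ k, K ≤ k → invSucc k ≤ l := by
  obtain ⟨K, hK⟩ := exists_nat_one_div_lt l.2
  refine ⟨K, fun k hk => Subtype.coe_le_coe.1 ?_⟩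
  refine le_trans ?_ hK.le
  change 1 / ((k : ℝ) + 1) ≤ 1 / ((K : ℝ) + 1)
  gcongr

/-- The positive number `k + 1`. -/
noncomputable def natSucc (k : ℕ) : RPos := ⟨(k : ℝ) + 1, by positivity⟩

theorem exists_le_natSucc (l : RPos) : ∃ K : ℕ, ∀ k, K ≤ k → l ≤ natSucc k := by
  obtain ⟨K, hK⟩ := exists_nat_ge l.1
  refine ⟨K, fun k hk => Subtype.coe_le_coe.1 ?_⟩
  change l.1 ≤ (k : ℝ) + 1
  have : (K : ℝ) ≤ k := by exact_mod_cast hk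
  linarith

theorem exists_lt_of_not_isBigO {v w : WeightFunction n}
    (h : ¬ v.toFun =O[cocompact (Rn n)] w.toFun) (C : ℝ) : ∃ x, C * w x < v x := by
  by_contra! h1
  refine h (IsBigO.of_bound C (Eventually.of_forall fun x => ?_))
  have hw := w.one_le_toFun x
  have hv := v.one_le_toFun x
  rw [Real.norm_of_nonneg (by linarith), Real.norm_of_nonneg (by linarith)]
  exact h1 x

theorem mem_roumieuSpace_natSucc (T : SolidTIBF n E) {M : WeightSequenceSystem n}
    {W : WeightFunctionSystem n} {f : Rn n → ℂ} (hf : f ∈ roumieuSpace T M W) :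
    ∃ j : ℕ, f ∈ stepSubmodule T (M (natSucc j)) (W (natSucc j)) := by
  obtain ⟨l, hl⟩ := hf
  obtain ⟨j, hj⟩ := exists_le_natSucc l
  exact ⟨j, stepSubmodule_mono T M W (hj j le_rfl) hl⟩

/-- The contradiction ending each necessity proof: an excess `k` over `2 ^ k` beats every constant.
-/
theorem not_forall_natCast_mul_lt (K C : ℝ) {x : ℕ → ℝ} (hx : ∀ k, 0 < x k) {k₀ : ℕ}
    (h : ∀ k, k₀ ≤ k → (k : ℝ) * 2 ^ k * x k < K * (C * 2 ^ k * x k)) : False := by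
  obtain ⟨k, hk⟩ := exists_nat_ge (max (k₀ : ℝ) (K * C))
  have h1 := h k (by exact_mod_cast (le_max_left _ _).trans hk)
  have h2 : K * C ≤ k := (le_max_right _ _).trans hk
  have h3 : 0 < 2 ^ k * x k := mul_pos (by positivity) (hx k)
  nlinarith

theorem weight_incl_beurling (T : SolidTIBF n E) {M N : WeightSequenceSystem n}
    {W V : WeightFunctionSystem n} (hW : W.CondM .beurling) (hV : V.CondwM .beurling)
    (hne : beurlingSpace T M W ≠ ⊥) (hsub : beurlingSpace T M W ≤ beurlingSpace T N V) :
    W.Incl V .beurling := by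
  obtain ⟨f, hf, hf0, D, hD⟩ := exists_bounded_mem_space T (r := .beurling) hW hne
  obtain ⟨hfs, hfm⟩ := contDiff_of_mem_space T (r := .beurling) hf
  have hfm0 : T.Mem f := by simpa only [mderiv_zero_index] using hfm 0
  intro l
  by_contra! hcon
  obtain ⟨m, C, hC, hVm⟩ := hV l
  -- For the fixed `l` the relation fails for every `m`, in particular along the cofinal sequence `1
  -- / (k + 1)`; the factor `2 ^ k` anticipates the loss in the Baire step.
  choose x hx using fun k : ℕ =>
    exists_lt_of_not_isBigO (hcon (invSucc k)) ((k : ℝ) * 2 ^ k)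
  obtain ⟨K, hK, hKb⟩ := exists_weightedDeriv_translate_bound T
  have hgD := norm_mderiv_weightedTranslate_le hfs hD (fun k => W (invSucc k)) x
  have hmem : ∀ c, series (weightedTranslate f (fun k => W (invSucc k)) x) c ∈
      beurlingSpace T M W := by
    intro c a
    obtain ⟨b, d, C', hC', hWa⟩ := hW a
    obtain ⟨-, A, hA, hAb⟩ :=
      (mem_stepSubmodule_iff T _ _ _).1 (beurlingSpace_le_step T M W a d hf)
    obtain ⟨k₀, hk₀⟩ := exists_invSucc_le b
    -- As soon as `1 / (k + 1) ≤ b`, the normalizing weight dominates `W b`. The finitely many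
    -- earlier `k` are absorbed in the sum.
    let B : ℝ := 1 + ∑ k ∈ Finset.range k₀, W b (x k)
    have hB : ∀ k, W b (x k) ≤ B * W (invSucc k) (x k) := by
      intro k
      have h0 : ∀ k, 0 ≤ W b (x k) := fun k => by linarith [(W b).one_le_toFun (x k)]
      have hs : 0 ≤ ∑ k ∈ Finset.range k₀, W b (x k) := Finset.sum_nonneg fun k _ => h0 k
      have h1 := (W (invSucc k)).one_le_toFun (x k)
      rcases lt_or_ge k k₀ with hk | hk
      · have h2 := Finset.single_le_sum (f := fun k => W b (x k)) (fun k _ => h0 k)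
          (Finset.mem_range.2 hk)
        have h3 : W b (x k) ≤ B := by
          simp only [B]
          linarith
        have h4 : 0 ≤ B := (h0 k).trans h3
        nlinarith
      · have h2 := W.anti b (invSucc k) (hk₀ k hk) (x k)
        refine h2.trans (le_mul_of_one_le_left (by linarith) ?_)
        simp only [B]
        linarith
    exact series_mem_stepSubmodule T (contDiff_weightedTranslate hfs _ x) hgD
      (fun k => weightedTranslate_bound T hfs (hKb _ _ _ C' hC'.le hWa f hfs) hC'.le hK.le hAb _ x
        (hB k)) c
  -- In the Beurling case only the target step `m` supplied by [wM] is needed, hence the constant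
  -- families.
  obtain ⟨-, C₁, hC₁, h1⟩ := exists_translate_bound_of_series_mem T hfs hD _ x
    (fun _ => N m) (fun _ => V m) fun c => ⟨0, hsub (hmem c) m⟩
  obtain ⟨K', hK', h2⟩ := exists_weight_le_norm_translate T hC hVm hfs hfm0 hf0
  refine not_forall_natCast_mul_lt K' C₁ (x := fun k => W (invSucc k) (x k)) (k₀ := 0)
    (fun k => by linarith [(W (invSucc k)).one_le_toFun (x k)]) fun k _ => ?_
  refine (hx k).trans_le ((h2 (x k) (h1 k).1).trans ?_)
  exact mul_le_mul_of_nonneg_left (h1 k).2 hK'.le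

theorem weight_incl_roumieu (T : SolidTIBF n E) {M N : WeightSequenceSystem n}
    {W V : WeightFunctionSystem n} (hW : W.CondM .roumieu) (hV : V.CondwM .roumieu)
    (hne : roumieuSpace T M W ≠ ⊥) (hsub : roumieuSpace T M W ≤ roumieuSpace T N V) :
    W.Incl V .roumieu := by
  obtain ⟨f, hf, hf0, D, hD⟩ := exists_bounded_mem_space T (r := .roumieu) hW hne
  obtain ⟨hfs, hfm⟩ := contDiff_of_mem_space T (r := .roumieu) hf
  have hfm0 : T.Mem f := by simpa only [mderiv_zero_index] using hfm 0
  intro m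
  by_contra! hcon
  choose x hx using fun k : ℕ =>
    exists_lt_of_not_isBigO (hcon (natSucc k)) ((k : ℝ) * 2 ^ k)
  obtain ⟨K, hK, hKb⟩ := exists_weightedDeriv_translate_bound T
  have hgD := norm_mderiv_weightedTranslate_le hfs hD (fun _ => W m) x
  have hmem : ∀ c, series (weightedTranslate f (fun _ => W m) x) c ∈ roumieuSpace T M W := by
    intro c
    obtain ⟨a, ha⟩ := hf
    obtain ⟨b, C', hC', hWa⟩ := hW m a
    obtain ⟨-, A, hA, hAb⟩ := (mem_stepSubmodule_iff T _ _ _).1 ha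
    refine step_le_roumieuSpace T M W a b (series_mem_stepSubmodule T
      (contDiff_weightedTranslate hfs _ x) hgD (fun k => weightedTranslate_bound T hfs
        (hKb _ _ _ C' hC'.le hWa f hfs) hC'.le hK.le hAb _ x (B := 1) ?_) c)
    rw [one_mul]
  obtain ⟨j, C₁, hC₁, h1⟩ := exists_translate_bound_of_series_mem T hfs hD _ x
    (fun j => N (natSucc j)) (fun j => V (natSucc j)) fun c =>
      mem_roumieuSpace_natSucc T (hsub (hmem c))
  -- The target step `j` is known only after the Baire argument. The points `x k` were chosen
  -- against all `V (natSucc k)`, and those with `k` large lie below `V l`.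
  obtain ⟨l, C, hC, hVl⟩ := hV (natSucc j)
  obtain ⟨K', hK', h2⟩ := exists_weight_le_norm_translate T hC hVl hfs hfm0 hf0
  obtain ⟨k₀, hk₀⟩ := exists_le_natSucc l
  refine not_forall_natCast_mul_lt K' C₁ (x := fun k => W m (x k)) (k₀ := k₀)
    (fun k => by linarith [(W m).one_le_toFun (x k)]) fun k hk => ?_
  refine (hx k).trans_le ((V.anti _ _ (hk₀ k hk) (x k)).trans ((h2 (x k) (h1 k).1).trans ?_))
  exact mul_le_mul_of_nonneg_left (h1 k).2 hK'.le

/-! ### Log-convex weight sequences -/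

theorem prod_le_pow_len {ξ : Fin n → ℝ} (hξ : ∀ i, 0 ≤ ξ i) {R : ℝ} (hR : ∀ i, ξ i ≤ R)
    (β : MultiIndex n) : ∏ i, ξ i ^ β i ≤ R ^ len β := by
  rw [len, ← Finset.prod_pow_eq_pow_sum]
  exact Finset.prod_le_prod (fun i _ => pow_nonneg (hξ i) _)
    fun i _ => pow_le_pow_left₀ (hξ i) (hR i) _

/-- By the root condition `M` dominates `R ^ len` outside a finite box of multi-indices, and inside
the box a finite sum does. -/
theorem WeightSequence.exists_pow_len_le (M : WeightSequence n) {R : ℝ} (hR : 0 ≤ R) :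
    ∃ C : ℝ, 0 < C ∧ ∀ β, R ^ len β ≤ C * M β := by
  obtain ⟨s, hs, h⟩ := mem_comap.1 (M.tendsto_root.eventually_ge_atTop R)
  obtain ⟨k₀, hk₀⟩ := mem_atTop_sets.1 hs
  have h0 : ∀ β, 0 ≤ R ^ len β / M β := fun β => div_nonneg (by positivity) (M.pos β).le
  set S : ℝ := ∑ β ∈ Finset.Iic (fun _ => k₀ : MultiIndex n), R ^ len β / M β with hS
  have hS0 : 0 ≤ S := Finset.sum_nonneg fun β _ => h0 β
  refine ⟨1 + S, by positivity, fun β => ?_⟩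
  by_cases hβ : β ∈ Finset.Iic (fun _ => k₀ : MultiIndex n)
  · have h1 := Finset.single_le_sum (f := fun β => R ^ len β / M β) (fun β _ => h0 β) hβ
    rw [← div_le_iff₀ (M.pos β)]
    linarith
  · have h1 : k₀ < len β := by
      by_contra! h2
      refine hβ (Finset.mem_Iic.2 fun i => ?_)
      exact (Finset.single_le_sum (f := β) (fun _ _ => Nat.zero_le _)
        (Finset.mem_univ i)).trans h2
    have h2 : R ≤ M β ^ (1 / (len β : ℝ)) := h (hk₀ _ h1.le)
    have h3 : (len β : ℝ) ≠ 0 := by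
      have : 0 < len β := by omega
      exact_mod_cast this.ne'
    have h4 : R ^ len β ≤ M β := by
      calc R ^ len β ≤ (M β ^ (1 / (len β : ℝ))) ^ len β := pow_le_pow_left₀ hR h2 _
        _ = M β := by
          rw [← Real.rpow_natCast, ← Real.rpow_mul (M.pos β).le, one_div, inv_mul_cancel₀ h3,
            Real.rpow_one]
    exact h4.trans (le_mul_of_one_le_left (M.pos β).le (by linarith))

/-- Existence of a subgradient of a convex function at a point of an open convex set. -/
theorem exists_subgradient {U : Set (Fin n → ℝ)} (hU : IsOpen U) {F : (Fin n → ℝ) → ℝ}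
    (hF : ConvexOn ℝ U F) {a : Fin n → ℝ} (ha : a ∈ U) :
    ∃ η : Fin n → ℝ, ∀ x ∈ U, F a + ∑ i, η i * (x i - a i) ≤ F x := by
  have hc : ContinuousOn F U := hF.continuousOn hU
  have hopen : IsOpen {p : (Fin n → ℝ) × ℝ | p.1 ∈ U ∧ F p.1 < p.2} := by
    have h1 : ContinuousOn (fun p : (Fin n → ℝ) × ℝ => p.2 - F p.1) (U ×ˢ univ) :=
      continuousOn_snd.sub (hc.comp continuousOn_fst fun p hp => hp.1)
    have h2 := h1.isOpen_inter_preimage (hU.prod isOpen_univ) (isOpen_Ioi (a := (0 : ℝ)))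
    convert h2 using 1
    ext p
    simp
  -- The point on the graph is separated from the open strict epigraph.
  obtain ⟨φ, hφ⟩ := geometric_hahn_banach_point_open hF.convex_strict_epigraph hopen
    (x := (a, F a)) fun h => lt_irrefl _ h.2
  have hsplit : ∀ x t, φ (x, t) = φ (x, 0) + t * φ (0, 1) := by
    intro x t
    have h1 : (x, t) = (x, (0 : ℝ)) + t • ((0 : Fin n → ℝ), (1 : ℝ)) := by simp
    rw [h1, map_add, map_smul, smul_eq_mul]
  set s := φ (0, 1) with hs
  -- The separating hyperplane is not vertical: the point at height `F a + 1` lies in the epigraph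
  -- directly above `(a, F a)`.
  have hs0 : 0 < s := by
    have h1 := hφ (a, F a + 1) ⟨ha, by simp⟩
    rw [hsplit a (F a), hsplit a (F a + 1)] at h1
    linarith
  have hlin : ∀ x : Fin n → ℝ, φ (x, 0) = ∑ i, x i * φ (Pi.single i 1, 0) := by
    intro x
    have h1 : (x, (0 : ℝ)) = ∑ i, x i • ((Pi.single i 1 : Fin n → ℝ), (0 : ℝ)) := by
      refine Prod.ext ?_ ?_
      · rw [Prod.fst_sum]
        ext j
        simp [Finset.sum_apply, Pi.single_apply]
      · rw [Prod.snd_sum]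
        simp
    rw [h1, map_sum]
    simp only [map_smul, smul_eq_mul]
  refine ⟨fun i => -(φ (Pi.single i 1, 0) / s), fun x hx => ?_⟩
  have h1 : φ (a, F a) ≤ φ (x, F x) := by
    refine le_of_forall_pos_lt_add fun ε hε => ?_
    have h2 := hφ (x, F x + ε / s) ⟨hx, lt_add_of_pos_right _ (by positivity)⟩
    rw [hsplit x (F x + ε / s)] at h2
    rw [hsplit x (F x)]
    have h3 : ε / s * s = ε := div_mul_cancel₀ _ hs0.ne'
    linarith
  rw [hsplit a, hsplit x, hlin a, hlin x] at h1
  have h2 : ∑ i, -(φ (Pi.single i 1, 0) / s) * (x i - a i) =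
      (∑ i, a i * φ (Pi.single i 1, 0) - ∑ i, x i * φ (Pi.single i 1, 0)) / s := by
    rw [← Finset.sum_sub_distrib, Finset.sum_div]
    refine Finset.sum_congr rfl fun i _ => ?_
    ring
  rw [h2, ← le_sub_iff_add_le', div_le_iff₀ hs0]
  linarith

/-- At a boundary point of the orthant a convex function may lack a subgradient. Composing with the
projection `P` onto the face of `α` makes `α` an interior point, at the price of testing only `β` in
that face. -/
theorem WeightSequence.LogConvex.exists_face_subgradient {M : WeightSequence n}
    (hM : M.LogConvex) (α : MultiIndex n) : ∃ η : Fin n → ℝ, ∀ β : MultiIndex n,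
      (∀ i, α i = 0 → β i = 0) →
      Real.log (M α) + ∑ i, η i * ((β i : ℝ) - α i) ≤ Real.log (M β) := by
  obtain ⟨F, hF, hlog⟩ := hM
  let P : (Fin n → ℝ) →ₗ[ℝ] (Fin n → ℝ) :=
    LinearMap.pi fun i => if α i = 0 then 0 else LinearMap.proj i
  have hP : ∀ x i, P x i = if α i = 0 then 0 else x i := by
    intro x i
    simp only [P, LinearMap.pi_apply]
    split_ifs <;> rfl
  let U : Set (Fin n → ℝ) := {x | ∀ i, α i ≠ 0 → 0 < x i}
  have hUeq : U = ⋂ i, {x | α i ≠ 0 → 0 < x i} := by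
    ext x
    simp [U]
  have hU : IsOpen U := by
    rw [hUeq]
    refine isOpen_iInter_of_finite fun i => ?_
    by_cases hi : α i = 0
    · simp [hi]
    · simpa [hi] using isOpen_lt continuous_const (continuous_apply i)
  have hUc : Convex ℝ U := by
    intro x hx y hy a b ha hb hab i hi
    have h1 := hx i hi
    have h2 := hy i hi
    simp only [Pi.add_apply, Pi.smul_apply, smul_eq_mul]
    rcases ha.eq_or_lt with rfl | ha
    · have : b = 1 := by linarith
      subst this
      linarith
    · have := mul_pos ha h1
      have := mul_nonneg hb h2.le
      linarith
  have hF' : ConvexOn ℝ U (F ∘ P) := by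
    refine (hF.comp_linearMap P).subset (fun x hx i => ?_) hUc
    rw [hP]
    split_ifs with hi
    · exact le_rfl
    · exact (hx i hi).le
  let a : Fin n → ℝ := fun i => α i
  have ha : a ∈ U := fun i hi => by
    change (0 : ℝ) < (α i : ℝ)
    exact_mod_cast Nat.pos_of_ne_zero hi
  obtain ⟨η, hη⟩ := exists_subgradient hU hF' ha
  refine ⟨η, fun β hβ => ?_⟩
  let b : Fin n → ℝ := fun i => β i
  have hPa : P a = a := by
    ext i
    rw [hP]
    split_ifs with hi
    · simp [a, hi]
    · rfl
  have hPb : P b = b := by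
    ext i
    rw [hP]
    split_ifs with hi
    · simp [b, hβ i hi]
    · rfl
  -- Some coordinates of `β` may vanish where those of `α` do not, so `b` need not lie in `U`. The
  -- midpoint with `a` does, and convexity passes from there to `b`.
  let z : Fin n → ℝ := (1 / 2 : ℝ) • a + (1 / 2 : ℝ) • b
  have hz : z ∈ U := fun i hi => by
    have h1 := ha i hi
    have h2 : 0 ≤ b i := Nat.cast_nonneg _
    simp only [z, Pi.add_apply, Pi.smul_apply, smul_eq_mul]
    linarith
  have h1 := hη z hz
  have ha0 : a ∈ {x : Fin n → ℝ | ∀ i, 0 ≤ x i} := fun i => Nat.cast_nonneg _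
  have hb0 : b ∈ {x : Fin n → ℝ | ∀ i, 0 ≤ x i} := fun i => Nat.cast_nonneg _
  have h2 := hF.2 ha0 hb0 (by norm_num : (0 : ℝ) ≤ 1 / 2) (by norm_num : (0 : ℝ) ≤ 1 / 2)
    (by norm_num)
  have hPz : P z = z := by
    simp only [z, map_add, map_smul, hPa, hPb]
  simp only [Function.comp_apply, hPa, hPz] at h1
  have h3 : ∑ i, η i * (z i - a i) = 1 / 2 * ∑ i, η i * (b i - a i) := by
    rw [Finset.mul_sum]
    refine Finset.sum_congr rfl fun i _ => ?_
    simp only [z, Pi.add_apply, Pi.smul_apply, smul_eq_mul]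
    ring
  rw [h3] at h1
  rw [← hlog α, ← hlog β]
  simp only [smul_eq_mul] at h2
  change F a + ∑ i, η i * (b i - a i) ≤ F b
  change F z ≤ _ at h2
  linarith

/-- For a log-convex weight sequence, every quotient `ξ^β / M_β` is maximal at a prescribed
multi-index for a suitable `ξ`. -/
theorem WeightSequence.LogConvex.exists_maximizing {M : WeightSequence n}
    (hM : M.LogConvex) (α : MultiIndex n) : ∃ ξ : Fin n → ℝ, (∀ i, 0 < ξ i) ∧
      ∀ β, (∏ i, ξ i ^ β i) * M α ≤ (∏ i, ξ i ^ α i) * M β := by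
  obtain ⟨η, hη⟩ := hM.exists_face_subgradient α
  let R : ℝ := Real.exp (∑ i, |η i|)
  obtain ⟨C, hC, hR⟩ := M.exists_pow_len_le (R := R) (Real.exp_pos _).le
  -- Large enough to offset the terms independent of `β` when `β` leaves the face of `α`.
  let L : ℝ := |Real.log (M α)| + |∑ i, if α i = 0 then 0 else η i * α i| + |Real.log C|
  have hL : 0 ≤ L := by positivity
  -- Transversally to the face, `ξ_i = exp (-L)` is so small that one positive entry of `β` there
  -- settles the inequality, the remaining factors being at most `R ^ len β ≤ C * M β`.
  let η' : Fin n → ℝ := fun i => if α i = 0 then -L else η i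
  have hprod : ∀ β : MultiIndex n, ∏ i, Real.exp (η' i) ^ β i =
      Real.exp (∑ i, η' i * β i) := by
    intro β
    rw [Real.exp_sum]
    refine Finset.prod_congr rfl fun i _ => ?_
    rw [← Real.exp_nat_mul, mul_comm]
  refine ⟨fun i => Real.exp (η' i), fun i => Real.exp_pos _, fun β => ?_⟩
  rw [hprod, hprod, ← Real.exp_log (M.pos α), ← Real.exp_log (M.pos β), ← Real.exp_add,
    ← Real.exp_add, Real.exp_le_exp]
  have hα : ∑ i, η' i * α i = ∑ i, if α i = 0 then 0 else η i * α i := by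
    refine Finset.sum_congr rfl fun i _ => ?_
    by_cases hi : α i = 0
    · simp [hi]
    · simp [η', hi]
  by_cases hβ : ∀ i, α i = 0 → β i = 0
  · have h1 := hη β hβ
    have h2 : ∑ i, η i * ((β i : ℝ) - α i) = ∑ i, η' i * β i - ∑ i, η' i * α i := by
      rw [← Finset.sum_sub_distrib]
      refine Finset.sum_congr rfl fun i _ => ?_
      by_cases hi : α i = 0
      · simp [hi, hβ i hi]
      · simp [η', hi]
        ring
    rw [h2] at h1
    linarith
  · push Not at hβ
    obtain ⟨j, hj, hβj⟩ := hβ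
    have h1 : (len β : ℝ) * ∑ i, |η i| ≤ Real.log C + Real.log (M β) := by
      have h2 := Real.log_le_log (by positivity) (hR β)
      rw [Real.log_mul hC.ne' (M.pos β).ne', Real.log_pow, Real.log_exp] at h2
      exact h2
    have h2 : ∑ i, η' i * β i ≤ (len β : ℝ) * ∑ i, |η i| - L := by
      have h3 : ∀ i, η' i * β i ≤ β i * ∑ k, |η k| - if i = j then L else 0 := by
        intro i
        have h4 : 0 ≤ ∑ k, |η k| := Finset.sum_nonneg fun k _ => abs_nonneg _
        have h5 : (0 : ℝ) ≤ β i := Nat.cast_nonneg _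
        by_cases hij : i = j
        · subst hij
          have h6 : (1 : ℝ) ≤ β i := by exact_mod_cast Nat.one_le_iff_ne_zero.2 hβj
          simp only [η', hj, if_true]
          nlinarith
        · simp only [hij, if_false, sub_zero]
          have h7 : |η i| ≤ ∑ k, |η k| :=
            Finset.single_le_sum (f := fun k => |η k|) (fun k _ => abs_nonneg _)
              (Finset.mem_univ i)
          have h8 := le_abs_self (η i)
          by_cases hi : α i = 0
          · simp only [η', hi, if_true]
            nlinarith
          · simp only [η', hi, if_false]
            nlinarith
      refine (Finset.sum_le_sum fun i _ => h3 i).trans_eq ?_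
      rw [Finset.sum_sub_distrib, ← Finset.sum_mul, len]
      simp
    rw [hα]
    have h3 := le_abs_self (Real.log (M α))
    have h4 := neg_abs_le (∑ i, if α i = 0 then 0 else η i * (α i : ℝ))
    have h5 := le_abs_self (Real.log C)
    simp only [L] at h2
    linarith

/-! ### Band-limited functions -/

/-- There is a function of exponential type all of whose derivatives decay integrably. -/
theorem exists_bandlimited (n : ℕ) : ∃ (g : Rn n → ℂ) (R C : ℝ), 0 < R ∧ 0 ≤ C ∧ ContDiff ℝ ∞ g ∧
    g 0 ≠ 0 ∧ ∀ β x, ‖mderiv β g x‖ ≤ C * R ^ len β * decay x := by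
  let b : ContDiffBump (0 : Rn n) := ⟨1 / 2, 1, by norm_num, by norm_num⟩
  let ψ : Rn n → ℂ := fun x => (b x : ℂ)
  have hψ : ContDiff ℝ ∞ ψ := Complex.ofRealCLM.contDiff.comp b.contDiff
  have hψs : HasCompactSupport ψ := b.hasCompactSupport.comp_left (g := ((↑) : ℝ → ℂ)) (by simp)
  have hsupp : ∀ q v, 1 < ‖v‖ → iteratedFDeriv ℝ q ψ v = 0 := by
    intro q v hv
    by_contra h
    have h1 : v ∈ tsupport ψ := support_iteratedFDeriv_subset q h
    have h2 : tsupport ψ ⊆ Metric.closedBall 0 1 := by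
      rw [← b.tsupport_eq]
      exact closure_mono fun x hx h0 => hx (by simp only [ψ, h0, Complex.ofReal_zero])
    have h3 := h2 h1
    rw [mem_closedBall_zero_iff] at h3
    linarith
  have hint : ∀ k q : ℕ, Integrable fun v => ‖v‖ ^ k * ‖iteratedFDeriv ℝ q ψ v‖ := by
    intro k q
    refine Continuous.integrable_of_hasCompactSupport ?_ ?_
    · exact (continuous_norm.pow k).mul
        (hψ.continuous_iteratedFDeriv (m := q) (by exact_mod_cast le_top)).norm
    · exact (hψs.iteratedFDeriv q).norm.mul_left
  let S : ℕ → ℝ := fun m => ∑ q ∈ Finset.range (m + 1), ∫ v, ‖iteratedFDeriv ℝ q ψ v‖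
  have hS : ∀ m, 0 ≤ S m := fun m =>
    Finset.sum_nonneg fun q _ => integral_nonneg fun v => norm_nonneg _
  -- Differentiating `𝓕 ψ` multiplies `ψ` by powers of `v`, harmless on the unit ball; powers of `w`
  -- cost derivatives of `ψ`. For fixed `m`, the bound is geometric in `k` up to a polynomial
  -- factor.
  have key : ∀ (m k : ℕ) (w : Rn n), ‖w‖ ^ m * ‖iteratedFDeriv ℝ k (𝓕 ψ) w‖ ≤
      (2 * Real.pi) ^ k * (2 * k + 2) ^ m * ((k + 1) * S m) := by
    intro m k w
    refine (Real.pow_mul_norm_iteratedFDeriv_fourier_le (K := ⊤) (N := ⊤) hψ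
      (fun k q _ _ => hint k q) le_top le_top w).trans ?_
    refine mul_le_mul_of_nonneg_left ?_ (by positivity)
    rw [Finset.sum_product]
    have h1 : ∀ p ∈ Finset.range (k + 1), ∑ q ∈ Finset.range (m + 1),
        ∫ v, ‖v‖ ^ p * ‖iteratedFDeriv ℝ q ψ v‖ ≤ S m := by
      intro p _
      refine Finset.sum_le_sum fun q _ => ?_
      refine integral_mono (hint p q) (by simpa using hint 0 q) fun v => ?_
      by_cases hv : ‖v‖ ≤ 1
      · exact mul_le_of_le_one_left (norm_nonneg _) (pow_le_one₀ (norm_nonneg _) hv)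
      · simp [hsupp q v (not_le.1 hv)]
    refine (Finset.sum_le_sum h1).trans_eq ?_
    simp
  have hg : ContDiff ℝ ∞ (𝓕 ψ) := Real.contDiff_fourier (N := ⊤) fun k _ => by
    simpa using hint k 0
  -- The ratio combines `2 * π` per derivative with `2 ^ (n + 2)`, which absorbs `(2 * k + 2) ^ (n +
  -- 2)`. The exponents `m = 0` and `m = n + 1` together give the decay.
  refine ⟨𝓕 ψ, 2 * Real.pi * 2 ^ (n + 2), 2 ^ n * (2 ^ (n + 2) * (S 0 + S (n + 1))),
    by positivity, ?_, hg, ?_, ?_⟩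
  · have := hS 0
    have := hS (n + 1)
    positivity
  · rw [Real.fourier_eq]
    simp only [inner_zero_right, neg_zero, AddChar.map_zero_eq_one, one_smul]
    change ∫ v, (b v : ℂ) ≠ 0
    rw [integral_complex_ofReal]
    exact_mod_cast (b.integral_pos (μ := volume)).ne'
  · intro β x
    refine (norm_mderiv_le β hg x).trans ?_
    set k := len β with hk
    have h0 := key 0 k x
    have h1 := key (n + 1) k x
    rw [pow_zero, pow_zero, one_mul, mul_one] at h0
    have hd : decay x = ((1 + ‖x‖) ^ (n + 1))⁻¹ := by
      rw [decay, Real.rpow_neg (by positivity)]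
      norm_cast
    rw [hd, ← div_eq_mul_inv, le_div_iff₀ (by positivity)]
    have h2 : (1 + ‖x‖) ^ (n + 1) ≤ 2 ^ n * (1 + ‖x‖ ^ (n + 1)) := by
      simpa using add_pow_le zero_le_one (norm_nonneg x) (n + 1)
    set J := ‖iteratedFDeriv ℝ k (𝓕 ψ) x‖ with hJ
    have hJ0 : 0 ≤ J := norm_nonneg _
    have hk1 : (1 : ℝ) ≤ 2 * k + 2 := by
      have : (0 : ℝ) ≤ k := Nat.cast_nonneg k
      linarith
    have hk2 : ((2 : ℝ) * k + 2) ≤ 2 * 2 ^ k := by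
      have : k + 1 ≤ 2 ^ k := Nat.lt_two_pow_self
      have : ((k : ℝ) + 1) ≤ 2 ^ k := by exact_mod_cast this
      linarith
    have hk0 : (k : ℝ) + 1 ≤ 2 * k + 2 := by
      have : (0 : ℝ) ≤ k := Nat.cast_nonneg k
      linarith
    have h3 : (2 * Real.pi) ^ k * ((k + 1) * S 0) ≤
        (2 * Real.pi) ^ k * ((2 * k + 2) ^ (n + 2) * S 0) := by
      have := hS 0
      gcongr
      exact hk0.trans (le_self_pow₀ hk1 (by omega))
    have h4 : (2 * Real.pi) ^ k * (2 * k + 2) ^ (n + 1) * ((k + 1) * S (n + 1)) ≤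
        (2 * Real.pi) ^ k * ((2 * k + 2) ^ (n + 2) * S (n + 1)) := by
      have := hS (n + 1)
      rw [pow_succ _ (n + 1), mul_assoc, mul_assoc]
      gcongr
    have h5 : ((2 : ℝ) * k + 2) ^ (n + 2) ≤ 2 ^ (n + 2) * (2 ^ (n + 2)) ^ k := by
      refine (pow_le_pow_left₀ (by linarith) hk2 _).trans_eq ?_
      rw [mul_pow, ← pow_mul, ← pow_mul, mul_comm k]
    have hSS : 0 ≤ S 0 + S (n + 1) := add_nonneg (hS 0) (hS _)
    calc J * (1 + ‖x‖) ^ (n + 1) ≤ J * (2 ^ n * (1 + ‖x‖ ^ (n + 1))) := by gcongr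
      _ = 2 ^ n * (J + ‖x‖ ^ (n + 1) * J) := by ring
      _ ≤ 2 ^ n * ((2 * Real.pi) ^ k * ((2 * k + 2) ^ (n + 2) * S 0) +
          (2 * Real.pi) ^ k * ((2 * k + 2) ^ (n + 2) * S (n + 1))) := by
          exact mul_le_mul_of_nonneg_left (add_le_add (h0.trans h3) (h1.trans h4)) (by positivity)
      _ = 2 ^ n * (2 * Real.pi) ^ k * (S 0 + S (n + 1)) * (2 * k + 2) ^ (n + 2) := by ring
      _ ≤ 2 ^ n * (2 * Real.pi) ^ k * (S 0 + S (n + 1)) *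
          (2 ^ (n + 2) * (2 ^ (n + 2)) ^ k) := by gcongr
      _ = _ := by
          rw [mul_pow (2 * Real.pi)]
          ring

/-- Some modulation of a non-vanishing integrable continuous function has non-zero integral. -/
theorem exists_integral_expo_ne_zero {u : Rn n → ℂ} (hu : Continuous u) (hi : Integrable u)
    (h0 : u 0 ≠ 0) : ∃ η : Fin n → ℝ, ∫ x, u x * expo η x ≠ 0 := by
  by_contra! h
  -- If all modulated integrals vanish, so does the Fourier transform, and inversion gives `u 0 =
  -- 0`.
  have h1 : 𝓕 u = 0 := by
    funext w
    rw [Real.fourier_eq']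
    rw [Pi.zero_apply, ← h fun i => -2 * Real.pi * w i]
    refine integral_congr_ae (Eventually.of_forall fun x => ?_)
    simp only [smul_eq_mul, expo]
    rw [mul_comm]
    congr 4
    rw [PiLp.inner_apply, Finset.mul_sum]
    refine Finset.sum_congr rfl fun i _ => ?_
    simp
    ring
  have h2 := hu.fourierInv_fourier_eq hi (by rw [h1]; exact integrable_zero _ _ _)
  refine h0 ?_
  rw [← h2, h1, Real.fourierInv_eq]
  simp

/-! ### Multiplication by functions with controlled derivatives -/

theorem SolidTIBF.mem_norm_list_sum (T : SolidTIBF n E) {ι : Type*} (L : List ι)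
    (h : ι → Rn n → ℂ) {c : ℝ} (hL : ∀ p ∈ L, T.Mem (h p) ∧ T.norm (h p) ≤ c) :
    T.Mem (fun x => (L.map fun p => h p x).sum) ∧
      T.norm (fun x => (L.map fun p => h p x).sum) ≤ L.length * c := by
  induction L with
  | nil =>
    simp only [List.map_nil, List.sum_nil, List.length_nil, Nat.cast_zero, zero_mul]
    exact ⟨T.mem_zero, T.norm_zero.le⟩
  | cons p L ih =>
    obtain ⟨m1, n1⟩ := ih fun q hq => hL q (List.mem_cons_of_mem _ hq)
    obtain ⟨m2, n2⟩ := hL p List.mem_cons_self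
    obtain ⟨m3, n3⟩ := T.mem_norm_add m2 m1
    simp only [List.map_cons, List.sum_cons, List.length_cons, Nat.cast_add, Nat.cast_one]
    exact ⟨m3, n3.trans (by linarith)⟩

/-- The Leibniz list has `2 ^ len α` terms, and `hM` makes each of them smaller than the desired
bound by this factor. -/
theorem mul_mem_stepSubmodule (T : SolidTIBF n E) {M₁ M₂ M₃ : WeightSequence n}
    {w : WeightFunction n} {C : ℝ}
    (hM : ∀ β γ, 2 ^ len (β + γ) * (M₁ β * M₂ γ) ≤ C * M₃ (β + γ)) {f φ : Rn n → ℂ}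
    (hf : f ∈ stepSubmodule T M₁ w) (hφ : ContDiff ℝ ∞ φ) {B : ℝ}
    (hB : ∀ γ x, ‖mderiv γ φ x‖ ≤ B * M₂ γ) :
    (fun x => f x * φ x) ∈ stepSubmodule T M₃ w := by
  rw [mem_stepSubmodule_iff] at hf ⊢
  obtain ⟨hfs, A, hA, hfA⟩ := hf
  have hB0 : 0 ≤ B := by
    have h1 := (norm_nonneg _).trans (hB 0 0)
    rwa [M₂.map_zero, mul_one] at h1
  have hC : 0 ≤ C := by
    have h1 := hM 0 0
    simp only [add_zero, len_zero, M₁.map_zero, M₂.map_zero, M₃.map_zero] at h1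
    linarith
  refine ⟨hfs.mul hφ, C * A * B, by positivity, fun α => ?_⟩
  obtain ⟨L, hL1, hL2, hL3⟩ := exists_leibniz_apply α
  have h1 : weightedDeriv w α (fun x => f x * φ x) = fun x =>
      (L.map fun p => weightedDeriv w p.1 f x * mderiv p.2 φ x).sum := by
    funext x
    rw [weightedDeriv, hL3 f φ hfs hφ, ← List.sum_map_mul_right]
    congr 2
    funext p
    rw [weightedDeriv]
    ring
  rw [h1]
  have h2 := T.mem_norm_list_sum L (fun p x => weightedDeriv w p.1 f x * mderiv p.2 φ x)
    (c := C * A * B * M₃ α / 2 ^ len α) fun p hp => by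
      have hp2 := (M₂.pos p.2).le
      obtain ⟨m1, n1⟩ := T.mem_norm_le (hfA p.1).1
        ((continuous_weightedDeriv w p.1 hfs).mul
          (contDiff_mderiv p.2 hφ).continuous).locallyIntegrable
        (C := B * M₂ p.2) (mul_nonneg hB0 hp2) fun x => by
          rw [Pi.mul_apply, norm_mul, mul_comm]
          exact mul_le_mul_of_nonneg_right (hB _ x) (norm_nonneg _)
      refine ⟨m1, n1.trans ?_⟩
      rw [le_div_iff₀ (by positivity)]
      have h3 := hM p.1 p.2
      rw [hL2 p hp] at h3
      calc B * M₂ p.2 * T.norm (weightedDeriv w p.1 f) * 2 ^ len α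
          ≤ B * M₂ p.2 * (A * M₁ p.1) * 2 ^ len α := by
            have := (hfA p.1).2
            gcongr
        _ = A * B * (2 ^ len α * (M₁ p.1 * M₂ p.2)) := by ring
        _ ≤ A * B * (C * M₃ α) := by gcongr
        _ = _ := by ring
  refine ⟨h2.1, h2.2.trans_eq ?_⟩
  rw [hL1]
  push_cast
  rw [mul_div_cancel₀]
  positivity

/-! ### A lower bound for modulations -/

theorem integral_mderiv_mul_expo {u : Rn n → ℂ} (hu : ContDiff ℝ ∞ u)
    (hi : ∀ α, Integrable (mderiv α u)) (ξ : Fin n → ℝ) (α : MultiIndex n) :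
    ∫ x, mderiv α u x * expo (-ξ) x = symb ξ α * ∫ x, u x * expo (-ξ) x := by
  have hie : ∀ α, Integrable fun x => mderiv α u x * expo (-ξ) x := by
    intro α
    refine (hi α).mul_bdd (c := 1) (contDiff_expo _).continuous.aestronglyMeasurable ?_
    exact Eventually.of_forall fun x => (norm_expo _ x).le
  induction α using multiIndex_induction with
  | h0 => rw [mderiv_zero_index, symb_zero, one_mul]
  | h1 α i ih =>
    have hd : ∀ x, fderiv ℝ (expo (-ξ)) x (EuclideanSpace.single i 1) =
        -(ξ i * Complex.I) * expo (-ξ) x := by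
      intro x
      have h1 := pderiv_expo (-ξ) i x
      rw [pderiv] at h1
      rw [h1, Pi.neg_apply]
      push_cast
      ring
    have h1 := integral_mul_fderiv_eq_neg_fderiv_mul_of_integrable (μ := volume)
      (f := mderiv α u) (g := expo (-ξ)) (v := EuclideanSpace.single i 1)
      (by
        have h2 := hie (α + Pi.single i 1)
        rw [mderiv_add_single _ _ hu] at h2
        exact h2)
      (by
        simp only [hd]
        refine ((hie α).const_mul (-(ξ i * Complex.I))).congr (Eventually.of_forall fun x => ?_)
        simp only
        ring)
      (hie α) (fun x _ => ((contDiff_mderiv α hu).differentiable (by simp)) x)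
      (fun x _ => ((contDiff_expo _).differentiable (by simp)) x)
    rw [mderiv_add_single _ _ hu, symb_add_single, mul_assoc, ← ih]
    have h2 : ∫ x, mderiv α u x * fderiv ℝ (expo (-ξ)) x (EuclideanSpace.single i 1) =
        -((ξ i * Complex.I) * ∫ x, mderiv α u x * expo (-ξ) x) := by
      rw [← integral_const_mul, ← integral_neg]
      refine integral_congr_ae (Eventually.of_forall fun x => ?_)
      simp only [hd]
      ring
    rw [h2, neg_inj] at h1
    exact h1.symm

/-- Since `f g` is the product of `f exp(iξ·x) g` and `exp(-iξ·x)`, integration by parts turns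
`(iξ)^α ∫ f g` into an integral of `∂^α (f exp(iξ·x) g)`. Leibniz distributes `∂^α`; `decay` makes
the terms integrable against functions of `E`, and `hN` sums them. `K` does not depend on `f`, `ξ`
or the sequences. -/
theorem exists_symb_bound (T : SolidTIBF n E) {g : Rn n → ℂ} (hg : ContDiff ℝ ∞ g) {R Cg : ℝ}
    (hR : 0 < R) (hCg : 0 ≤ Cg) (hgb : ∀ β x, ‖mderiv β g x‖ ≤ Cg * R ^ len β * decay x) :
    ∃ K : ℝ, 0 ≤ K ∧ ∀ (N₁ N₂ : WeightSequence n) (C : ℝ),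
      (∀ β γ, 2 ^ len (β + γ) * (N₁ β * R ^ len γ) ≤ C * N₂ (β + γ)) →
      ∀ (f : Rn n → ℂ), ContDiff ℝ ∞ f → ∀ (ξ : Fin n → ℝ) (A : ℝ), 0 ≤ A →
      (∀ β, T.Mem (mderiv β fun x => f x * expo ξ x) ∧
        T.norm (mderiv β fun x => f x * expo ξ x) ≤ A * N₁ β) →
      ∀ α, (∏ i, |ξ i| ^ α i) * ‖∫ x, f x * g x‖ ≤ K * C * A * N₂ α := by
  obtain ⟨K, hK, hdec⟩ := T.exists_integral_decay_bound
  refine ⟨K * Cg, by positivity, fun N₁ N₂ C hN f hf ξ A hA hb α => ?_⟩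
  set h : Rn n → ℂ := fun x => f x * expo ξ x with hh
  have hhs : ContDiff ℝ ∞ h := hf.mul (contDiff_expo ξ)
  have hus : ContDiff ℝ ∞ fun x => h x * g x := hhs.mul hg
  have key : ∀ α, Integrable (mderiv α fun x => h x * g x) ∧
      ∫ x, ‖mderiv α (fun x => h x * g x) x‖ ≤ K * Cg * C * A * N₂ α := by
    intro α
    obtain ⟨L, hL1, hL2, hL3⟩ := exists_leibniz_apply α
    have hm : mderiv α (fun x => h x * g x) =
        fun x => (L.map fun p => mderiv p.1 h x * mderiv p.2 g x).sum :=
      funext fun x => hL3 h g hhs hg x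
    have hterm : ∀ p ∈ L, Integrable (fun x => mderiv p.1 h x * mderiv p.2 g x) ∧
        ∫ x, ‖mderiv p.1 h x * mderiv p.2 g x‖ ≤ K * Cg * C * A * N₂ α / 2 ^ len α := by
      intro p hp
      obtain ⟨hmp, hnp⟩ := hb p.1
      obtain ⟨i1, i2⟩ := hdec _ hmp
      have h1 : ∀ x, ‖mderiv p.1 h x * mderiv p.2 g x‖ ≤
          Cg * R ^ len p.2 * (‖mderiv p.1 h x‖ * decay x) := fun x => by
        rw [norm_mul]
        calc _ ≤ ‖mderiv p.1 h x‖ * (Cg * R ^ len p.2 * decay x) := by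
              gcongr
              exact hgb _ x
          _ = _ := by ring
      have hc : Continuous fun x => mderiv p.1 h x * mderiv p.2 g x :=
        (contDiff_mderiv _ hhs).continuous.mul (contDiff_mderiv _ hg).continuous
      have h2 : Integrable (fun x => mderiv p.1 h x * mderiv p.2 g x) :=
        (i1.const_mul (Cg * R ^ len p.2)).mono' hc.aestronglyMeasurable
          (Eventually.of_forall h1)
      refine ⟨h2, (integral_mono h2.norm (i1.const_mul (Cg * R ^ len p.2)) h1).trans ?_⟩
      rw [integral_const_mul, le_div_iff₀ (by positivity)]
      have h3 := hN p.1 p.2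
      rw [hL2 p hp] at h3
      calc Cg * R ^ len p.2 * (∫ x, ‖mderiv p.1 h x‖ * decay x) * 2 ^ len α
          ≤ Cg * R ^ len p.2 * (K * (A * N₁ p.1)) * 2 ^ len α := by
            gcongr
            exact i2.trans (by gcongr)
        _ = K * Cg * A * (2 ^ len α * (N₁ p.1 * R ^ len p.2)) := by ring
        _ ≤ K * Cg * A * (C * N₂ α) := by gcongr
        _ = _ := by ring
    have hlist : ∀ L : List (MultiIndex n × MultiIndex n), (∀ p ∈ L,
        Integrable (fun x => mderiv p.1 h x * mderiv p.2 g x) ∧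
        ∫ x, ‖mderiv p.1 h x * mderiv p.2 g x‖ ≤ K * Cg * C * A * N₂ α / 2 ^ len α) →
        Integrable (fun x => (L.map fun p => mderiv p.1 h x * mderiv p.2 g x).sum) ∧
        ∫ x, ‖(L.map fun p => mderiv p.1 h x * mderiv p.2 g x).sum‖ ≤
          L.length * (K * Cg * C * A * N₂ α / 2 ^ len α) := by
      intro L hL
      induction L with
      | nil => simp
      | cons p L ih =>
        obtain ⟨i1, b1⟩ := ih fun q hq => hL q (List.mem_cons_of_mem _ hq)
        obtain ⟨i2, b2⟩ := hL p List.mem_cons_self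
        simp only [List.map_cons, List.sum_cons, List.length_cons, Nat.cast_add, Nat.cast_one]
        refine ⟨i2.add i1, ?_⟩
        have h4 := integral_mono (i2.add i1).norm (i2.norm.add i1.norm)
          fun x => norm_add_le _ _
        simp only [Pi.add_apply] at h4
        rw [integral_add i2.norm i1.norm] at h4
        linarith
    obtain ⟨i1, b1⟩ := hlist L hterm
    rw [hm]
    refine ⟨i1, b1.trans_eq ?_⟩
    rw [hL1]
    push_cast
    rw [mul_div_cancel₀]
    positivity
  have h1 := integral_mderiv_mul_expo hus (fun α => (key α).1) ξ α
  have h2 : ∀ x, h x * g x * expo (-ξ) x = f x * g x := fun x => by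
    rw [hh]
    have := expo_mul_expo_neg ξ x
    linear_combination f x * g x * this
  simp only [h2] at h1
  rw [← norm_symb, ← norm_mul, ← h1]
  refine (norm_integral_le_integral_norm _).trans ?_
  simp only [norm_mul, norm_expo, mul_one]
  exact (key α).2

/-! ### Necessity of the relation between the weight sequences -/

theorem WeightSequence.exists_lt_of_not_incl {M N : WeightSequence n} (h : ¬ M.Incl N) (C : ℝ) :
    ∃ α, C * N α < M α := by
  by_contra! h1
  refine h ⟨max C 1, by positivity, fun α => (h1 α).trans ?_⟩
  exact mul_le_mul_of_nonneg_right (le_max_left _ _) (N.pos α).le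

/-- The scaled exponential `x ↦ P⁻¹ exp(i ξ·x)`. -/
noncomputable def scaledExpo (P : ℝ) (ξ : Fin n → ℝ) (x : Rn n) : ℂ :=
  (P : ℂ)⁻¹ * expo ξ x

theorem contDiff_scaledExpo (P : ℝ) (ξ : Fin n → ℝ) : ContDiff ℝ ∞ (scaledExpo P ξ) :=
  contDiff_const.mul (contDiff_expo ξ)

theorem norm_mderiv_scaledExpo_le {P : ℝ} (hP : 0 < P) {ξ : Fin n → ℝ} {β : MultiIndex n} {D : ℝ}
    (h : ∏ i, |ξ i| ^ β i ≤ P * D) (x : Rn n) : ‖mderiv β (scaledExpo P ξ) x‖ ≤ D := by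
  unfold scaledExpo
  rw [mderiv_const_mul _ (contDiff_expo ξ), norm_mul, norm_mderiv_expo, norm_inv,
    Complex.norm_real, Real.norm_of_nonneg hP.le, inv_mul_le_iff₀ hP]
  exact h

/-- Taking `P = ξ^α / M_α` in `exists_maximizing` normalizes the exponentials: all their derivatives
stay below `M k`, with equality at the critical index. -/
theorem WeightSequence.exists_scaled_frequencies {M : ℕ → WeightSequence n}
    (hM : ∀ k, (M k).LogConvex) (α : ℕ → MultiIndex n) :
    ∃ (P : ℕ → ℝ) (ξ : ℕ → Fin n → ℝ), (∀ k, 0 < P k) ∧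
      (∀ k, ∏ i, |ξ k i| ^ α k i = P k * M k (α k)) ∧
      ∀ k β, ∏ i, |ξ k i| ^ β i ≤ P k * M k β := by
  choose ξ hξ h using fun k => (hM k).exists_maximizing (α k)
  have habs : ∀ k i, |ξ k i| = ξ k i := fun k i => abs_of_pos (hξ k i)
  refine ⟨fun k => (∏ i, ξ k i ^ α k i) / M k (α k), ξ, fun k => ?_, fun k => ?_, fun k β => ?_⟩
  · exact div_pos (Finset.prod_pos fun i _ => pow_pos (hξ k i) _) ((M k).pos _)
  · simp only [habs]
    rw [div_mul_cancel₀ _ ((M k).pos _).ne']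
  · simp only [habs]
    rw [div_mul_eq_mul_div, le_div_iff₀ ((M k).pos _)]
    exact h k β

theorem mul_series_mem_stepSubmodule (T : SolidTIBF n E) {M₁ M₂ M₃ : WeightSequence n}
    {w : WeightFunction n} {C : ℝ}
    (hM : ∀ β γ, 2 ^ len (β + γ) * (M₁ β * M₂ γ) ≤ C * M₃ (β + γ)) {f : Rn n → ℂ}
    (hf : f ∈ stepSubmodule T M₁ w) {g : ℕ → Rn n → ℂ} (hg : ∀ k, ContDiff ℝ ∞ (g k)) {B : ℝ}
    (hB : ∀ γ k x, ‖mderiv γ (g k) x‖ ≤ B * M₂ γ) (c : BoundedContinuousFunction ℕ ℂ) :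
    (fun x => f x * series g c x) ∈ stepSubmodule T M₃ w := by
  obtain ⟨hs, hd⟩ := contDiff_series_and_mderiv_series hg hB c
  refine mul_mem_stepSubmodule T hM hf hs (B := 2 * B * ‖c‖) fun γ x => ?_
  rw [hd]
  refine (norm_tsum_series_le c fun k => hB γ k x).trans_eq ?_
  ring

/-- Multiplication of the values of a linear map by a fixed function. -/
noncomputable def mulLeftMap {X : Type*} [AddCommGroup X] [Module ℂ X] (f : Rn n → ℂ)
    (A : X →ₗ[ℂ] (Rn n → ℂ)) : X →ₗ[ℂ] (Rn n → ℂ) :=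
  (LinearMap.mulLeft ℂ f).comp A

/-- The Baire step for the products `f φ_k`. The target weight is at least `1` and is dropped, as
only the derivatives matter for the lower bound. -/
theorem exists_modulation_bound_of_series_mem (T : SolidTIBF n E) {f : Rn n → ℂ}
    (hf : ContDiff ℝ ∞ f) {P : ℕ → ℝ} (hP : ∀ k, 0 < P k) {ξ : ℕ → Fin n → ℝ}
    {D : MultiIndex n → ℝ} (hD : ∀ k β, ∏ i, |ξ k i| ^ β i ≤ P k * D β)
    (N : ℕ → WeightSequence n) (v : ℕ → WeightFunction n)
    (h : ∀ c, ∃ j, (fun x => f x * series (fun k => scaledExpo (P k) (ξ k)) c x) ∈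
      stepSubmodule T (N j) (v j)) :
    ∃ (j : ℕ) (C : ℝ), 0 ≤ C ∧ ∀ k β, T.Mem (mderiv β fun x => f x * expo (ξ k) x) ∧
      T.norm (mderiv β fun x => f x * expo (ξ k) x) ≤ C * 2 ^ k * P k * N j β := by
  set φ : ℕ → Rn n → ℂ := fun k => scaledExpo (P k) (ξ k) with hφ
  have hφs : ∀ k, ContDiff ℝ ∞ (φ k) := fun k => contDiff_scaledExpo _ _
  have hφD : ∀ β k x, ‖mderiv β (φ k) x‖ ≤ D β := fun β k x =>
    norm_mderiv_scaledExpo_le (hP k) (hD k β) x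
  have hfφ : ∀ k, ContDiff ℝ ∞ (f * φ k) := fun k => hf.mul (hφs k)
  have hφ0 : ∀ k x, ‖φ k x‖ ≤ D 0 := fun k x => by
    simpa only [mderiv_zero_index] using hφD 0 k x
  have hs := contDiff_series_and_mderiv_series hφs hφD
  obtain ⟨j, C, hC, h1⟩ := exists_uniform_series_bound T (g := fun k => f * φ k)
    (mulLeftMap f (seriesMap φ hφ0)) (fun c => hf.mul (hs c).1) (fun β x => by
      obtain ⟨L, -, -, hL⟩ := exists_leibniz_apply β
      have h2 : ∀ c, mderiv β (mulLeftMap f (seriesMap φ hφ0) c) x =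
          (L.map fun p => mderiv p.1 f x * series (fun k => mderiv p.2 (φ k)) c x).sum := by
        intro c
        have h3 := hL f (series φ c) hf (hs c).1 x
        simp only [(hs c).2] at h3
        exact h3
      simp only [h2]
      refine continuous_list_sum L fun p _ => continuous_const.mul ?_
      exact continuous_series_apply (fun k x => hφD p.2 k x) x)
    hfφ (fun k => by
      change f * series φ (unitSeq k) = _
      rw [series_unitSeq, mul_smul_comm]) N v h
  refine ⟨j, C, hC, fun k β => ?_⟩
  obtain ⟨m1, n1⟩ := h1 k β
  have hP0 : (P k : ℂ) ≠ 0 := by exact_mod_cast (hP k).ne'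
  have h2 : mderiv β (fun x => f x * expo (ξ k) x) =
      fun x => (P k : ℂ) * mderiv β (f * φ k) x := by
    rw [← mderiv_const_mul _ (hfφ k)]
    congr 1
    funext x
    simp only [hφ, Pi.mul_apply, scaledExpo]
    field_simp
  obtain ⟨m2, n2⟩ := T.mem_norm_mono m1 (contDiff_mderiv β (hfφ k)).continuous
    fun x => by
      rw [norm_weightedDeriv]
      exact le_mul_of_one_le_right (norm_nonneg _) ((v j).one_le_toFun x)
  obtain ⟨m3, n3⟩ := T.mem_norm_smul (P k : ℂ) m2
  rw [h2]
  refine ⟨m3, ?_⟩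
  rw [n3, Complex.norm_real, Real.norm_of_nonneg (hP k).le]
  calc _ ≤ P k * (C * 2 ^ k * N j β) :=
        mul_le_mul_of_nonneg_left (n2.trans n1) (hP k).le
    _ = _ := by ring

/-- Derivatives of a fixed exponential grow geometrically and are therefore dominated by every
weight sequence. -/
theorem mul_expo_mem_space (T : SolidTIBF n E) {M : WeightSequenceSystem n}
    {W : WeightFunctionSystem n} {r : Regime} (hL : M.CondL r) (hI : M.CondI r) {f : Rn n → ℂ}
    (hf : f ∈ space T M W r) (η : Fin n → ℝ) : (fun x => f x * expo η x) ∈ space T M W r := by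
  have hb : ∀ M' : WeightSequence n, ∃ B, ∀ γ x, ‖mderiv γ (expo η) x‖ ≤ B * M' γ := by
    intro M'
    obtain ⟨B, -, h⟩ := M'.exists_pow_len_le (R := ∑ i, |η i|)
      (Finset.sum_nonneg fun i _ => abs_nonneg _)
    refine ⟨B, fun γ x => ?_⟩
    rw [norm_mderiv_expo]
    refine (prod_le_pow_len (fun i => abs_nonneg _) (fun i => ?_) γ).trans (h γ)
    exact Finset.single_le_sum (f := fun i => |η i|) (fun i _ => abs_nonneg _)
      (Finset.mem_univ i)
  have hI' := WeightSequenceSystem.condI_absorb hL hI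
  cases r with
  | beurling =>
    intro a
    obtain ⟨b, d, C, -, h⟩ := hI' a
    obtain ⟨B, hB⟩ := hb (M d)
    exact mul_mem_stepSubmodule T h (beurlingSpace_le_step T M W b a hf) (contDiff_expo η) hB
  | roumieu =>
    obtain ⟨a, hf⟩ := hf
    obtain ⟨l, C, -, h⟩ := hI' a a
    obtain ⟨B, hB⟩ := hb (M a)
    exact step_le_roumieuSpace T M W l a (mul_mem_stepSubmodule T h hf (contDiff_expo η) hB)

/-- The product `f g` does not vanish at the origin, so some modulation has non-zero integral; the
modulation is transferred to `f`, which stays in the space. -/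
theorem exists_mem_space_integral_mul_ne_zero (T : SolidTIBF n E) {M : WeightSequenceSystem n}
    {W : WeightFunctionSystem n} {r : Regime} (hL : M.CondL r) (hI : M.CondI r) (hW : W.CondM r)
    (hne : space T M W r ≠ ⊥) {g : Rn n → ℂ} (hg : ContDiff ℝ ∞ g) (hg0 : g 0 ≠ 0) {C : ℝ}
    (hgb : ∀ x, ‖g x‖ ≤ C * decay x) :
    ∃ f ∈ space T M W r, ∫ x, f x * g x ≠ 0 := by
  obtain ⟨f, hf, hf0, -⟩ := exists_bounded_mem_space T hW hne
  obtain ⟨hfs, hfm⟩ := contDiff_of_mem_space T hf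
  have hfm0 : T.Mem f := by simpa only [mderiv_zero_index] using hfm 0
  obtain ⟨_, _, hdec⟩ := T.exists_integral_decay_bound
  have hc : Continuous fun x => f x * g x := hfs.continuous.mul hg.continuous
  have hi : Integrable fun x => f x * g x := by
    refine ((hdec f hfm0).1.const_mul C).mono' hc.aestronglyMeasurable
      (Eventually.of_forall fun x => ?_)
    rw [norm_mul]
    calc ‖f x‖ * ‖g x‖ ≤ ‖f x‖ * (C * decay x) := by
          gcongr
          exact hgb x
      _ = _ := by ring
  obtain ⟨η, hη⟩ := exists_integral_expo_ne_zero hc hi (mul_ne_zero hf0 hg0)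
  refine ⟨_, mul_expo_mem_space T hL hI hf η, ?_⟩
  simpa only [mul_right_comm] using hη

/-- The modulations of a fixed function cannot be bounded if `M_k(α_k)` is too large compared to
`N(α_k)`. -/
theorem not_forall_lt_of_modulation_bound (T : SolidTIBF n E) {g : Rn n → ℂ}
    (hg : ContDiff ℝ ∞ g) {R Cg : ℝ} (hR : 0 < R) (hCg : 0 ≤ Cg)
    (hgb : ∀ β x, ‖mderiv β g x‖ ≤ Cg * R ^ len β * decay x) {f : Rn n → ℂ}
    (hf : ContDiff ℝ ∞ f) (hfg : ∫ x, f x * g x ≠ 0) {N₁ N₂ : WeightSequence n} {C : ℝ}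
    (hN : ∀ β γ, 2 ^ len (β + γ) * (N₁ β * R ^ len γ) ≤ C * N₂ (β + γ))
    {P : ℕ → ℝ} (hP : ∀ k, 0 < P k) {ξ : ℕ → Fin n → ℝ} {α : ℕ → MultiIndex n} {m : ℕ → ℝ}
    (hξ : ∀ k, ∏ i, |ξ k i| ^ α k i = P k * m k) {C₁ : ℝ} (hC₁ : 0 ≤ C₁)
    (hb : ∀ k β, T.Mem (mderiv β fun x => f x * expo (ξ k) x) ∧
      T.norm (mderiv β fun x => f x * expo (ξ k) x) ≤ C₁ * 2 ^ k * P k * N₁ β) {k₀ : ℕ}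
    (hm : ∀ k, k₀ ≤ k → (k : ℝ) * 2 ^ k * N₂ (α k) < m k) : False := by
  obtain ⟨K, hK, h⟩ := exists_symb_bound T hg hR hCg hgb
  have hI : 0 < ‖∫ x, f x * g x‖ := norm_pos_iff.2 hfg
  refine not_forall_natCast_mul_lt (K * C / ‖∫ x, f x * g x‖) C₁ (x := fun k => N₂ (α k))
    (fun k => N₂.pos _) (k₀ := k₀) fun k hk => (hm k hk).trans_le ?_
  have h1 := h N₁ N₂ C hN f hf (ξ k) (C₁ * 2 ^ k * P k)
    (mul_nonneg (by positivity) (hP k).le) (hb k) (α k)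
  rw [hξ] at h1
  rw [div_mul_eq_mul_div, le_div_iff₀ hI]
  -- The normalizing constant `P k` occurs on both sides and cancels.
  refine le_of_mul_le_mul_left ?_ (hP k)
  linarith

theorem sequence_incl_beurling (T : SolidTIBF n E) {M N : WeightSequenceSystem n}
    {W V : WeightFunctionSystem n} (hM : M.LogConvex) (hML : M.CondL .beurling)
    (hMI : M.CondI .beurling) (hNL : N.CondL .beurling) (hNI : N.CondwI .beurling)
    (hW : W.CondM .beurling) (hne : beurlingSpace T M W ≠ ⊥)
    (hsub : beurlingSpace T M W ≤ beurlingSpace T N V) : M.Incl N .beurling := by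
  obtain ⟨g, R, Cg, hR, hCg, hg, hg0, hgb⟩ := exists_bandlimited n
  obtain ⟨f, hf, hfg⟩ := exists_mem_space_integral_mul_ne_zero T (r := .beurling) hML hMI hW hne
    hg hg0 (C := Cg) fun x => by simpa [mderiv_zero_index, len_zero] using hgb 0 x
  have hfs := (contDiff_of_mem_space T (r := .beurling) hf).1
  intro l
  by_contra! hcon
  obtain ⟨m, C, -, hN⟩ := WeightSequenceSystem.condwI_absorb hNL hNI hR l
  choose α hα using fun k : ℕ =>
    WeightSequence.exists_lt_of_not_incl (hcon (invSucc k)) ((k : ℝ) * 2 ^ k)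
  obtain ⟨P, ξ, hP, hξ, hξM⟩ :=
    WeightSequence.exists_scaled_frequencies (fun k => hM (invSucc k)) α
  have hmem : ∀ c, (fun x => f x * series (fun k => scaledExpo (P k) (ξ k)) c x) ∈
      beurlingSpace T M W := by
    intro c a
    obtain ⟨b, d, C', -, hI⟩ := WeightSequenceSystem.condI_absorb hML hMI a
    obtain ⟨k₀, hk₀⟩ := exists_invSucc_le d
    -- For small `k` the sequence `M (invSucc k)` need not lie below `M d`; these finitely many
    -- exponentials are bounded individually, by geometric growth.
    have hB : ∀ k, ∃ B, 0 ≤ B ∧ ∀ γ, ∏ i, |ξ k i| ^ γ i ≤ P k * (B * M d γ) := by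
      intro k
      obtain ⟨B, hB, h⟩ := (M d).exists_pow_len_le (R := ∑ i, |ξ k i|)
        (Finset.sum_nonneg fun i _ => abs_nonneg _)
      refine ⟨B / P k, (div_pos hB (hP k)).le, fun γ => ?_⟩
      rw [div_mul_eq_mul_div, mul_div_cancel₀ _ (hP k).ne']
      refine (prod_le_pow_len (fun i => abs_nonneg _) (fun i => ?_) γ).trans (h γ)
      exact Finset.single_le_sum (f := fun i => |ξ k i|) (fun i _ => abs_nonneg _)
        (Finset.mem_univ i)
    choose B hB0 hB using hB
    have hs : 0 ≤ ∑ k ∈ Finset.range k₀, B k := Finset.sum_nonneg fun k _ => hB0 k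
    refine mul_series_mem_stepSubmodule T hI (beurlingSpace_le_step T M W b a hf)
      (fun k => contDiff_scaledExpo _ _) (B := 1 + ∑ k ∈ Finset.range k₀, B k)
      (fun γ k x => norm_mderiv_scaledExpo_le (hP k) ?_ x) c
    have hd := ((M d).pos γ).le
    rcases lt_or_ge k k₀ with hk | hk
    · have h2 := Finset.single_le_sum (f := B) (fun k _ => hB0 k) (Finset.mem_range.2 hk)
      refine (hB k γ).trans (mul_le_mul_of_nonneg_left ?_ (hP k).le)
      exact mul_le_mul_of_nonneg_right (by linarith) hd
    · refine (hξM k γ).trans (mul_le_mul_of_nonneg_left ?_ (hP k).le)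
      exact (M.mono _ _ (hk₀ k hk) γ).trans (le_mul_of_one_le_left hd (by linarith))
  -- `M (invSucc 0)` majorizes all the sequences used, which gives derivative bounds uniform in `k`.
  have hle : ∀ k, invSucc k ≤ invSucc 0 := fun k => Subtype.coe_le_coe.1 <| by
    change 1 / ((k : ℝ) + 1) ≤ 1 / (((0 : ℕ) : ℝ) + 1)
    gcongr
    exact Nat.zero_le k
  obtain ⟨-, C₁, hC₁, h1⟩ := exists_modulation_bound_of_series_mem T hfs hP (D := M (invSucc 0))
    (fun k β => (hξM k β).trans (mul_le_mul_of_nonneg_left (M.mono _ _ (hle k) β) (hP k).le))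
    (fun _ => N m) (fun _ => V m) fun c => ⟨0, hsub (hmem c) m⟩
  exact not_forall_lt_of_modulation_bound T hg hR hCg hgb hfs hfg hN hP hξ hC₁ h1 (k₀ := 0)
    fun k _ => hα k

theorem sequence_incl_roumieu (T : SolidTIBF n E) {M N : WeightSequenceSystem n}
    {W V : WeightFunctionSystem n} (hM : M.LogConvex) (hML : M.CondL .roumieu)
    (hMI : M.CondI .roumieu) (hNL : N.CondL .roumieu) (hNI : N.CondwI .roumieu)
    (hW : W.CondM .roumieu) (hne : roumieuSpace T M W ≠ ⊥)
    (hsub : roumieuSpace T M W ≤ roumieuSpace T N V) : M.Incl N .roumieu := by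
  obtain ⟨g, R, Cg, hR, hCg, hg, hg0, hgb⟩ := exists_bandlimited n
  obtain ⟨f, hf, hfg⟩ := exists_mem_space_integral_mul_ne_zero T (r := .roumieu) hML hMI hW hne
    hg hg0 (C := Cg) fun x => by simpa [mderiv_zero_index, len_zero] using hgb 0 x
  have hfs := (contDiff_of_mem_space T (r := .roumieu) hf).1
  intro m
  by_contra! hcon
  choose α hα using fun k : ℕ =>
    WeightSequence.exists_lt_of_not_incl (hcon (natSucc k)) ((k : ℝ) * 2 ^ k)
  obtain ⟨P, ξ, hP, hξ, hξM⟩ := WeightSequence.exists_scaled_frequencies (fun _ => hM m) α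
  obtain ⟨a, ha⟩ := hf
  obtain ⟨b, C', -, hI⟩ := WeightSequenceSystem.condI_absorb hML hMI a m
  have hmem : ∀ c, (fun x => f x * series (fun k => scaledExpo (P k) (ξ k)) c x) ∈
      roumieuSpace T M W := fun c =>
    step_le_roumieuSpace T M W b a (mul_series_mem_stepSubmodule T hI ha
      (fun k => contDiff_scaledExpo _ _) (B := 1)
      (fun γ k x => norm_mderiv_scaledExpo_le (hP k) (by simpa using hξM k γ) x) c)
  obtain ⟨j, C₁, hC₁, h1⟩ := exists_modulation_bound_of_series_mem T hfs hP hξM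
    (fun j => N (natSucc j)) (fun j => V (natSucc j)) fun c =>
      mem_roumieuSpace_natSucc T (hsub (hmem c))
  -- Condition [wI] is applied at the step `j` found by the Baire argument; the resulting `l` lies
  -- below `natSucc k` for large `k`, where the indices `α k` still violate the relation.
  obtain ⟨l, C, -, hN⟩ := WeightSequenceSystem.condwI_absorb hNL hNI hR (natSucc j)
  obtain ⟨k₀, hk₀⟩ := exists_le_natSucc l
  refine not_forall_lt_of_modulation_bound T hg hR hCg hgb hfs hfg hN hP hξ hC₁ h1 (k₀ := k₀)
    fun k hk => lt_of_le_of_lt ?_ (hα k)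
  exact mul_le_mul_of_nonneg_left (N.mono _ _ (hk₀ k hk) _) (by positivity)

end

end GelfandShilov

theorem theorem3p3 {n : ℕ} {E : Type*} [NormedAddCommGroup E] [NormedSpace ℂ E]
    [CompleteSpace E] (T : GelfandShilov.SolidTIBF n E) (r : GelfandShilov.Regime)
    (M N : GelfandShilov.WeightSequenceSystem n) (W V : GelfandShilov.WeightFunctionSystem n)
    (hM : M.LogConvex) (hML : M.CondL r) (hMI : M.CondI r)
    (hN : N.LogConvex) (hNL : N.CondL r) (hNwI : N.CondwI r)
    (hW : W.CondM r) (hV : V.CondwM r)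
    (hne : GelfandShilov.space T M W r ≠ ⊥) :
    List.TFAE [
      M.Incl N r ∧ W.Incl V r,
      (GelfandShilov.space T M W r : Set (GelfandShilov.Rn n → ℂ)) ⊆
        GelfandShilov.space T N V r,
      ∃ h : GelfandShilov.space T M W r ≤ GelfandShilov.space T N V r,
        Continuous[GelfandShilov.topology T M W r, GelfandShilov.topology T N V r]
          (Submodule.inclusion h)] := by
  tfae_have 1 → 3 := fun h => GelfandShilov.exists_continuous_inclusion T h.1 h.2
  tfae_have 3 → 2 := fun ⟨h, _⟩ => h
  tfae_have 2 → 1 := fun h => by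
    cases r with
    | beurling =>
      exact ⟨GelfandShilov.sequence_incl_beurling T hM hML hMI hNL hNwI hW hne h,
        GelfandShilov.weight_incl_beurling T hW hV hne h⟩
    | roumieu =>
      exact ⟨GelfandShilov.sequence_incl_roumieu T hM hML hMI hNL hNwI hW hne h,
        GelfandShilov.weight_incl_roumieu T hW hV hne h⟩
  tfae_finish
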